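/- **Theorem B.** Let $Y_n=Y(\mathfrak{gl}_n)$ be the Yangian over $\mathbb C$: the associative $\mathbb{C}$-algebra on generators $T_{i,j}^{(r)}$ ($1\le i,j\le n$, $r\ge 1$) subject to the relations $$(u-v)[T_{i,j}(u),T_{h,k}(v)]=T_{h,j}(u)T_{i,k}(v)-T_{h,j}(v)T_{i,k}(u),$$ where $T_{i,j}(u)=\sum_{r\ge 0}T_{i,j}^{(r)}u^{-r}$ and $T_{i,j}^{(0)}=\delta_{i,j}$. Let $\nu=(\nu_1,\dots,\nu_m)$ be a tuple of positive integers summing to $n$, and let $T(u)=F(u)D(u)E(u)$ be the unique factorization of the matrix $T(u)=(T_{i,j}(u))$ into block matrices of shape $\nu$ with entries in $Y_n[[u^{-1}]]$, where $D(u)$ is block diagonal with diagonal blocks $D_a(u)=\big(\sum_{r\ge0}D_{a;i,j}^{(r)}u^{-r}\big)_{1\le i,j\le\nu_a}$, $E(u)$ is block upper unitriangular and $F(u)$ is block lower unitriangular, the off-diagonal blocks of $E(u)$ and $F(u)$ having zero constant term. Write $E_{a;i,j}^{(r)}$ ($1\le i\le\nu_a$, $1\le j\le \nu_{a+1}$)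 for the $u^{-r}$-coefficients of the entries of the $(a,a+1)$ block of $E(u)$, and $F_{a;i,j}^{(r)}$ ($1\le i\le\nu_{a+1}$, $1\le j\le\nu_a$) for those of the $(a+1,a)$ block of $F(u)$, $r\ge 1$. Let $Y_\nu$, $Y_\nu^+$, $Y_\nu^-$ be the subalgebras of $Y_n$ generated by all $D_{a;i,j}^{(r)}$, all $E_{a;i,j}^{(r)}$ and all $F_{a;i,j}^{(r)}$, respectively. Set $E_{a,a+1;i,j}^{(r)}:=E_{a;i,j}^{(r)}$, $F_{a,a+1;j,i}^{(r)}:=F_{a;j,i}^{(r)}$ and, inductively for $b>a+1$, $$E_{a,b;i,j}^{(r)}:=[E_{a,b-1;i,k}^{(r)},E_{b-1;k,j}^{(1)}],\qquad F_{a,b;j,i}^{(r)}:=[F_{b-1;j,k}^{(1)},F_{a,b-1;k,i}^{(r)}]\qquad(1\le i\le\nu_a,\ 1\le j\le\nu_b),$$ for any $1\le k\le\nu_{b-1}$. These elements do not depend on the choice of $k$, and, for any fixed total orders on the index sets of the families concerned, the following hold. (i) The ordered monomials in $\{D_{a;i,j}^{(r)}\}_{1\le a\le m,\,1\le i,j\le\nu_a,\,r\ge1}$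 form a basis of $Y_\nu$. (ii) The ordered monomials in $\{E_{a,b;i,j}^{(r)}\}_{1\le a<b\le m,\,1\le i\le\nu_a,\,1\le j\le\nu_b,\,r\ge1}$ form a basis of $Y_\nu^+$. (iii) The ordered monomials in $\{F_{a,b;i,j}^{(r)}\}_{1\le a<b\le m,\,1\le i\le\nu_b,\,1\le j\le\nu_a,\,r\ge1}$ form a basis of $Y_\nu^-$. (iv) The ordered monomials in the union of the three families form a basis of $Y_n$. In particular the multiplication map $Y_\nu^-\otimes Y_\nu\otimes Y_\nu^+\to Y_n$ is an isomorphism of vector spaces. -/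

import Mathlib

open scoped TensorProduct

noncomputable section

namespace Yang

/-! ### The Yangian of `gl_n` over `ℂ` -/

/-- The free generator `T_{i,j}^{(r)}`, with the convention `T_{i,j}^{(0)} = δ_{i,j}`. -/
def freeT (n : ℕ) (i j : Fin n) (r : ℕ) : FreeAlgebra ℂ (Fin n × Fin n × ℕ+) :=
  if h : 0 < r then FreeAlgebra.ι ℂ (i, j, ⟨r, h⟩) else if i = j then 1 else 0

/-- The defining relations
`(u - v) [T_{i,j}(u), T_{h,k}(v)] = T_{h,j}(u) T_{i,k}(v) - T_{h,j}(v) T_{i,k}(u)`,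
read off at the coefficient of `u^{-r} v^{-s}`. -/
inductive Rel (n : ℕ) :
    FreeAlgebra ℂ (Fin n × Fin n × ℕ+) → FreeAlgebra ℂ (Fin n × Fin n × ℕ+) → Prop
  | rtt (i j h k : Fin n) (r s : ℕ) :
      Rel n
        (⁅freeT n i j (r + 1), freeT n h k s⁆ - ⁅freeT n i j r, freeT n h k (s + 1)⁆)
        (freeT n h j r * freeT n i k s - freeT n h j s * freeT n i k r)

/-- The Yangian `Y_n = Y(gl_n)`. -/
def Yangian (n : ℕ) : Type := RingQuot (Rel n)

instance (n : ℕ) : Ring (Yangian n) := inferInstanceAs (Ring (RingQuot (Rel n)))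

instance (n : ℕ) : Algebra ℂ (Yangian n) := inferInstanceAs (Algebra ℂ (RingQuot (Rel n)))

/-- The quotient map onto `Y_n`. -/
def proj (n : ℕ) : FreeAlgebra ℂ (Fin n × Fin n × ℕ+) →ₐ[ℂ] Yangian n :=
  RingQuot.mkAlgHom ℂ (Rel n)

/-- The element `T_{i,j}^{(r)}` of `Y_n`. -/
def T (n : ℕ) (i j : Fin n) (r : ℕ) : Yangian n := proj n (freeT n i j r)

theorem T_zero (n : ℕ) (i j : Fin n) : T n i j 0 = if i = j then 1 else 0 := by
  simp only [T, freeT, lt_irrefl, dite_false]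
  split_ifs <;> simp

/-! ### Block Gauss factorization -/

section Gauss

variable {ι β R : Type*} [Fintype ι] [DecidableEq ι] [LinearOrder β] [Ring R]

/-- `M = F D E` is the Gauss factorization of a square matrix of power series, relative to the
partition of the rows and columns into the blocks given by `b`: `D` is block diagonal, `E` is block
upper unitriangular, `F` is block lower unitriangular, and the off-diagonal blocks of `E` and `F`
have no constant term. -/
structure IsBlockGauss (b : ι → β) (M F D E : Matrix ι ι (PowerSeries R)) : Prop where
  factor : M = F * D * E
  diag : ∀ i j, b i ≠ b j → D i j = 0
  upper : ∀ i j, b j ≤ b i → E i j = if i = j then 1 else 0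
  lower : ∀ i j, b i ≤ b j → F i j = if i = j then 1 else 0
  upper_const : ∀ i j, b i < b j → PowerSeries.constantCoeff (E i j) = 0
  lower_const : ∀ i j, b j < b i → PowerSeries.constantCoeff (F i j) = 0

def truncBelow {A : Type*} [Zero A] (r : ℕ) (f : ℕ → A) (p : ℕ) : A := if p < r then f p else 0

theorem coeff_mul3 {A : Type*} [Ring A] (f d e : ℕ → A) (hf : f 0 = 1) (hd : d 0 = 1)
    (he : e 0 = 1) (r : ℕ) (hr : 0 < r) :
    PowerSeries.coeff r (PowerSeries.mk f * PowerSeries.mk d * PowerSeries.mk e) =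
      f r + d r + e r + PowerSeries.coeff r (PowerSeries.mk (truncBelow r f) *
        PowerSeries.mk (truncBelow r d) * PowerSeries.mk (truncBelow r e)) := by
  have key : ∀ g : ℕ → A, PowerSeries.mk g =
      PowerSeries.mk (truncBelow r g) + PowerSeries.X ^ r * PowerSeries.mk (fun p => g (p + r)) := by
    intro g
    ext p
    rw [map_add, PowerSeries.coeff_X_pow_mul']
    simp only [PowerSeries.coeff_mk, truncBelow]
    by_cases h : p < r
    · simp [h, not_le.mpr h]
    · simp [h, not_lt.mp h]
  have split : PowerSeries.mk f * PowerSeries.mk d * PowerSeries.mk e =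
      PowerSeries.mk (truncBelow r f) * PowerSeries.mk (truncBelow r d) *
          PowerSeries.mk (truncBelow r e) +
        PowerSeries.X ^ r *
          (PowerSeries.mk (fun p => f (p + r)) * PowerSeries.mk d * PowerSeries.mk e +
            PowerSeries.mk (truncBelow r f) * PowerSeries.mk (fun p => d (p + r)) *
              PowerSeries.mk e +
            PowerSeries.mk (truncBelow r f) * PowerSeries.mk (truncBelow r d) *
              PowerSeries.mk (fun p => e (p + r))) := by
    have c : ∀ φ ψ : PowerSeries A, φ * (PowerSeries.X ^ r * ψ) = PowerSeries.X ^ r * (φ * ψ) := by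
      intro φ ψ
      rw [← mul_assoc, (PowerSeries.commute_X_pow φ r).eq, mul_assoc]
    have h1 : PowerSeries.mk f * PowerSeries.mk d * PowerSeries.mk e =
        PowerSeries.mk (truncBelow r f) * PowerSeries.mk d * PowerSeries.mk e +
        PowerSeries.X ^ r *
          (PowerSeries.mk (fun p => f (p + r)) * PowerSeries.mk d * PowerSeries.mk e) := by
      conv_lhs => rw [key f]
      simp only [add_mul, mul_assoc]
    have h2 : PowerSeries.mk (truncBelow r f) * PowerSeries.mk d * PowerSeries.mk e =
        PowerSeries.mk (truncBelow r f) * PowerSeries.mk (truncBelow r d) * PowerSeries.mk e +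
        PowerSeries.X ^ r * (PowerSeries.mk (truncBelow r f) *
          PowerSeries.mk (fun p => d (p + r)) * PowerSeries.mk e) := by
      conv_lhs => rw [key d]
      simp only [add_mul, mul_add, mul_assoc, c]
    have h3 : PowerSeries.mk (truncBelow r f) * PowerSeries.mk (truncBelow r d) *
          PowerSeries.mk e =
        PowerSeries.mk (truncBelow r f) * PowerSeries.mk (truncBelow r d) *
          PowerSeries.mk (truncBelow r e) +
        PowerSeries.X ^ r * (PowerSeries.mk (truncBelow r f) * PowerSeries.mk (truncBelow r d) *
          PowerSeries.mk (fun p => e (p + r))) := by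
      conv_lhs => rw [key e]
      rw [mul_add, c]
    rw [h1, h2, h3, mul_add, mul_add]
    abel
  rw [split, map_add, PowerSeries.coeff_X_pow_mul', if_pos le_rfl, Nat.sub_self, add_comm]
  congr 1
  simp only [PowerSeries.coeff_zero_eq_constantCoeff, map_add, map_mul,
    ← PowerSeries.coeff_zero_eq_constantCoeff_apply, PowerSeries.coeff_mk, truncBelow, hr, if_true,
    hf, hd, he]
  simp

/-- The matrix of `r`-th coefficients. -/
def matCoeff (M : Matrix ι ι (PowerSeries R)) (r : ℕ) : Matrix ι ι R :=
  Matrix.of fun i j => PowerSeries.coeff r (M i j)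

theorem mk_matCoeff_mul (M N : Matrix ι ι (PowerSeries R)) :
    PowerSeries.mk (matCoeff (M * N)) =
      PowerSeries.mk (matCoeff M) * PowerSeries.mk (matCoeff N) := by
  ext r i j
  simp only [PowerSeries.coeff_mk, PowerSeries.coeff_mul, matCoeff, Matrix.mul_apply, map_sum,
    Matrix.sum_apply]
  exact Finset.sum_comm

/-- Coefficientwise recursion for the sum of the three factors of a Gauss factorization. -/
def gaussSum {A : Type*} [Ring A] (lo di up : A → A) (t : ℕ → A) (r : ℕ) : A :=
  t r - PowerSeries.coeff r
    (PowerSeries.mk (fun p => if _h : p < r then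
        (if p = 0 then 1 else lo (gaussSum lo di up t p)) else 0) *
      PowerSeries.mk (fun p => if _h : p < r then
        (if p = 0 then 1 else di (gaussSum lo di up t p)) else 0) *
      PowerSeries.mk (fun p => if _h : p < r then
        (if p = 0 then 1 else up (gaussSum lo di up t p)) else 0))
termination_by r

theorem exists_mul3 {A : Type*} [Ring A] (lo di up : A → A) (h : ∀ a, lo a + di a + up a = a)
    (t : ℕ → A) (ht : t 0 = 1) :
    ∃ g : ℕ → A, PowerSeries.mk t =
      PowerSeries.mk (fun p => if p = 0 then 1 else lo (g p)) *
      PowerSeries.mk (fun p => if p = 0 then 1 else di (g p)) *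
      PowerSeries.mk (fun p => if p = 0 then 1 else up (g p)) := by
  refine ⟨gaussSum lo di up t, ?_⟩
  ext r
  rcases Nat.eq_zero_or_pos r with rfl | hr
  · simp [ht]
  · rw [coeff_mul3 (fun p => if p = 0 then 1 else lo (gaussSum lo di up t p))
      (fun p => if p = 0 then 1 else di (gaussSum lo di up t p))
      (fun p => if p = 0 then 1 else up (gaussSum lo di up t p))
      (if_pos rfl) (if_pos rfl) (if_pos rfl) r hr]
    simp only [hr.ne', if_false, h]
    have e := gaussSum.eq_1 lo di up t r
    rw [eq_sub_iff_add_eq] at e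
    simp only [dite_eq_ite] at e
    rw [PowerSeries.coeff_mk]
    exact e.symm

/-- Existence of the block Gauss factorization. -/
theorem exists_isBlockGauss (b : ι → β) (M : Matrix ι ι (PowerSeries R))
    (hM : matCoeff M 0 = 1) :
    ∃ X : Matrix ι ι (PowerSeries R) × Matrix ι ι (PowerSeries R) × Matrix ι ι (PowerSeries R),
      IsBlockGauss b M X.1 X.2.1 X.2.2 := by
  obtain ⟨g, hg⟩ := exists_mul3 (A := Matrix ι ι R)
    (fun a => Matrix.of fun i j => if b j < b i then a i j else 0)
    (fun a => Matrix.of fun i j => if b i = b j then a i j else 0)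
    (fun a => Matrix.of fun i j => if b i < b j then a i j else 0)
    (by
      intro a
      ext i j
      simp only [Matrix.add_apply, Matrix.of_apply]
      rcases lt_trichotomy (b i) (b j) with h | h | h
      · simp [h, h.ne, h.not_gt]
      · simp [h]
      · simp [h, h.ne', h.not_gt])
    (matCoeff M) hM
  set f : ℕ → Matrix ι ι R := fun p =>
    if p = 0 then 1 else Matrix.of fun i j => if b j < b i then g p i j else 0 with hf
  set d : ℕ → Matrix ι ι R := fun p =>
    if p = 0 then 1 else Matrix.of fun i j => if b i = b j then g p i j else 0 with hd
  set e : ℕ → Matrix ι ι R := fun p =>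
    if p = 0 then 1 else Matrix.of fun i j => if b i < b j then g p i j else 0 with he
  have back : ∀ x : ℕ → Matrix ι ι R,
      matCoeff (Matrix.of fun i j => PowerSeries.mk fun r => x r i j) = x := by
    intro x
    ext r i j
    simp [matCoeff]
  refine ⟨(Matrix.of fun i j => PowerSeries.mk fun r => f r i j, Matrix.of fun i j => PowerSeries.mk fun r => d r i j,
    Matrix.of fun i j => PowerSeries.mk fun r => e r i j), ?_, ?_, ?_, ?_, ?_, ?_⟩
  · have h := hg
    rw [← back f, ← back d, ← back e, ← mk_matCoeff_mul, ← mk_matCoeff_mul] at h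
    ext i j r
    have h' := congrArg (PowerSeries.coeff r) h
    simp only [PowerSeries.coeff_mk] at h'
    exact congrFun (congrFun h' i) j
  · intro i j hij
    have hne : i ≠ j := fun h => hij (h ▸ rfl)
    ext r
    rcases Nat.eq_zero_or_pos r with rfl | hr
    · simp [hd, hne]
    · simp [hd, hr.ne', hij]
  · intro i j hij
    ext r
    rcases Nat.eq_zero_or_pos r with rfl | hr
    · by_cases h : i = j <;>
        simp [he, h]
    · by_cases h : i = j
      · simp [he, h, hr.ne', PowerSeries.coeff_one]
      · simp [he, h, hr.ne', hij.not_gt]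
  · intro i j hij
    ext r
    rcases Nat.eq_zero_or_pos r with rfl | hr
    · by_cases h : i = j <;>
        simp [hf, h]
    · by_cases h : i = j
      · simp [hf, h, hr.ne', PowerSeries.coeff_one]
      · simp [hf, h, hr.ne', hij.not_gt]
  · intro i j hij
    have hne : i ≠ j := fun h => hij.ne (h ▸ rfl)
    simp [he, hne]
  · intro i j hij
    have hne : i ≠ j := fun h => hij.ne (h ▸ rfl)
    simp [hf, hne]

namespace IsBlockGauss

theorem coeff_zero {b : ι → β} {M F D E : Matrix ι ι (PowerSeries R)} (hM : matCoeff M 0 = 1)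
    (h : IsBlockGauss b M F D E) :
    matCoeff F 0 = 1 ∧ matCoeff D 0 = 1 ∧ matCoeff E 0 = 1 := by
  have hF : matCoeff F 0 = 1 := by
    ext i j
    rcases le_or_gt (b i) (b j) with hij | hij
    · by_cases e : i = j
      · subst e
        simp [matCoeff, h.lower i i hij]
      · simp [matCoeff, h.lower i j hij, e]
    · have hne : i ≠ j := fun e => hij.ne (e ▸ rfl)
      simp [matCoeff, h.lower_const i j hij, hne]
  have hE : matCoeff E 0 = 1 := by
    ext i j
    rcases le_or_gt (b j) (b i) with hij | hij
    · by_cases e : i = j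
      · subst e
        simp [matCoeff, h.upper i i hij]
      · simp [matCoeff, h.upper i j hij, e]
    · have hne : i ≠ j := fun e => hij.ne (e ▸ rfl)
      simp [matCoeff, h.upper_const i j hij, hne]
  refine ⟨hF, ?_, hE⟩
  have hm := congrArg (fun N => PowerSeries.coeff 0 (PowerSeries.mk (matCoeff N))) h.factor
  simp only [mk_matCoeff_mul, PowerSeries.coeff_mk] at hm
  simpa [hF, hE, hM] using hm.symm

/-- Uniqueness of the block Gauss factorization. -/
theorem unique {b : ι → β} {M F D E F' D' E' : Matrix ι ι (PowerSeries R)}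
    (hM : matCoeff M 0 = 1) (h : IsBlockGauss b M F D E) (h' : IsBlockGauss b M F' D' E') :
    F = F' ∧ D = D' ∧ E = E' := by
  obtain ⟨f0, d0, e0⟩ := h.coeff_zero hM
  obtain ⟨f0', d0', e0'⟩ := h'.coeff_zero hM
  have main : ∀ r, matCoeff F r = matCoeff F' r ∧ matCoeff D r = matCoeff D' r ∧
      matCoeff E r = matCoeff E' r := by
    intro r
    induction r using Nat.strong_induction_on with
    | _ r ih =>
      rcases Nat.eq_zero_or_pos r with rfl | hr
      · exact ⟨f0.trans f0'.symm, d0.trans d0'.symm, e0.trans e0'.symm⟩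
      have tF : truncBelow r (matCoeff F) = truncBelow r (matCoeff F') := by
        funext p
        by_cases hp : p < r
        · simp [truncBelow, hp, (ih p hp).1]
        · simp [truncBelow, hp]
      have tD : truncBelow r (matCoeff D) = truncBelow r (matCoeff D') := by
        funext p
        by_cases hp : p < r
        · simp [truncBelow, hp, (ih p hp).2.1]
        · simp [truncBelow, hp]
      have tE : truncBelow r (matCoeff E) = truncBelow r (matCoeff E') := by
        funext p
        by_cases hp : p < r
        · simp [truncBelow, hp, (ih p hp).2.2]
        · simp [truncBelow, hp]
      have hm := congrArg (fun N => PowerSeries.coeff r (PowerSeries.mk (matCoeff N)))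
        (h.factor.symm.trans h'.factor)
      simp only [mk_matCoeff_mul] at hm
      rw [coeff_mul3 _ _ _ f0 d0 e0 r hr, coeff_mul3 _ _ _ f0' d0' e0' r hr, tF, tD, tE] at hm
      have hs := add_right_cancel hm
      have entry : ∀ i j, matCoeff F r i j + matCoeff D r i j + matCoeff E r i j =
          matCoeff F' r i j + matCoeff D' r i j + matCoeff E' r i j := fun i j =>
        congrFun (congrFun hs i) j
      refine ⟨?_, ?_, ?_⟩ <;> ext i j <;> have en := entry i j <;>
        rcases lt_trichotomy (b i) (b j) with hij | hij | hij
      all_goals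
        first
        | simpa [matCoeff, h.lower i j hij.le, h'.lower i j hij.le, h.diag i j hij.ne,
            h'.diag i j hij.ne] using en
        | simpa [matCoeff, h.lower i j hij.le, h'.lower i j hij.le, h.upper i j hij.ge,
            h'.upper i j hij.ge] using en
        | simpa [matCoeff, h.upper i j hij.le, h'.upper i j hij.le, h.diag i j hij.ne',
            h'.diag i j hij.ne'] using en
  have fin : ∀ N N' : Matrix ι ι (PowerSeries R), (∀ r, matCoeff N r = matCoeff N' r) →
      N = N' := by
    intro N N' hN
    ext i j r
    exact congrFun (congrFun (hN r) i) j
  exact ⟨fin _ _ fun r => (main r).1, fin _ _ fun r => (main r).2.1, fin _ _ fun r => (main r).2.2⟩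

end IsBlockGauss

end Gauss

/-! ### Block generators

A tuple `(ν_1, …, ν_m)` of positive integers summing to `n` is a `ν : Composition n`, with
`m = ν.length` and `ν_a = ν.blocksFun a`; all indices start at `0`. -/

variable {n : ℕ}

/-- Positions `(a, i)` with `i` in the block `a`; the position `(a, i)` stands for the row or column
`ν_1 + ⋯ + ν_{a-1} + i` of an `n × n` matrix. -/
abbrev Pos (ν : Composition n) : Type := Σ a : Fin ν.length, Fin (ν.blocksFun a)

/-- The matrix `T(u)`, written in block form; the power series variable is `u⁻¹`. -/
def blockT (ν : Composition n) : Matrix (Pos ν) (Pos ν) (PowerSeries (Yangian n)) :=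
  Matrix.of fun x y => PowerSeries.mk fun r => T n (ν.embedding x.1 x.2) (ν.embedding y.1 y.2) r

theorem matCoeff_blockT_zero (ν : Composition n) : matCoeff (blockT ν) 0 = 1 := by
  ext x y
  have h : ν.embedding x.1 x.2 = ν.embedding y.1 y.2 ↔ x = y :=
    ν.blocksFinEquiv.injective.eq_iff (a := x) (b := y)
  simp only [matCoeff, blockT, Matrix.of_apply, PowerSeries.coeff_mk, T_zero, h, Matrix.one_apply]

/-- The block matrices `(F(u), D(u), E(u))` with `T(u) = F(u) D(u) E(u)`. -/
def gauss (ν : Composition n) : Matrix (Pos ν) (Pos ν) (PowerSeries (Yangian n)) ×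
    Matrix (Pos ν) (Pos ν) (PowerSeries (Yangian n)) ×
    Matrix (Pos ν) (Pos ν) (PowerSeries (Yangian n)) :=
  Classical.choose (exists_isBlockGauss Sigma.fst (blockT ν) (matCoeff_blockT_zero ν))

theorem isBlockGauss_gauss (ν : Composition n) :
    IsBlockGauss Sigma.fst (blockT ν) (gauss ν).1 (gauss ν).2.1 (gauss ν).2.2 :=
  Classical.choose_spec (exists_isBlockGauss Sigma.fst (blockT ν) (matCoeff_blockT_zero ν))

/-- `D_{a;i,j}^{(r)}`. -/
def D (ν : Composition n) (a : Fin ν.length) (i j : Fin (ν.blocksFun a)) (r : ℕ) : Yangian n :=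
  PowerSeries.coeff r ((gauss ν).2.1 ⟨a, i⟩ ⟨a, j⟩)

/-- `E_{a;i,j}^{(r)}`, the coefficients of the block of `E(u)` in position `(a, a + 1)`. -/
def E (ν : Composition n) (a : ℕ) (ha : a + 1 < ν.length)
    (i : Fin (ν.blocksFun ⟨a, a.lt_succ_self.trans ha⟩)) (j : Fin (ν.blocksFun ⟨a + 1, ha⟩))
    (r : ℕ) : Yangian n :=
  PowerSeries.coeff r ((gauss ν).2.2 ⟨⟨a, a.lt_succ_self.trans ha⟩, i⟩ ⟨⟨a + 1, ha⟩, j⟩)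

/-- `F_{a;i,j}^{(r)}`, the coefficients of the block of `F(u)` in position `(a + 1, a)`. -/
def F (ν : Composition n) (a : ℕ) (ha : a + 1 < ν.length)
    (i : Fin (ν.blocksFun ⟨a + 1, ha⟩)) (j : Fin (ν.blocksFun ⟨a, a.lt_succ_self.trans ha⟩))
    (r : ℕ) : Yangian n :=
  PowerSeries.coeff r ((gauss ν).1 ⟨⟨a + 1, ha⟩, i⟩ ⟨⟨a, a.lt_succ_self.trans ha⟩, j⟩)

/-- The first index of a block. -/
def firstIdx (ν : Composition n) (a : Fin ν.length) : Fin (ν.blocksFun a) :=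
  ⟨0, ν.one_le_blocksFun a⟩

/-- `E_{a,b;i,j}^{(r)}` for `a < b` (and `0` for `b ≤ a`), by recursion on `b`:
`E_{a,a+1;i,j}^{(r)} = E_{a;i,j}^{(r)}` and, for `a < b`,
`E_{a,b+1;i,j}^{(r)} = [E_{a,b;i,k}^{(r)}, E_{b;k,j}^{(1)}]`, where `k` is the first index of the
block `b`. -/
def EE (ν : Composition n) (a : ℕ) (ha : a < ν.length) (i : Fin (ν.blocksFun ⟨a, ha⟩)) (r : ℕ) :
    (b : ℕ) → (hb : b < ν.length) → Fin (ν.blocksFun ⟨b, hb⟩) → Yangian n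
  | 0, _, _ => 0
  | b + 1, hb, j =>
    if h : a = b then E ν b hb (Fin.cast (by subst h; rfl) i) j r
    else
      ⁅EE ν a ha i r b (b.lt_succ_self.trans hb) (firstIdx ν _), E ν b hb (firstIdx ν _) j 1⁆

/-- `F_{a,b;j,i}^{(r)}` for `a < b` (and `0` for `b ≤ a`), by recursion on `b`:
`F_{a,a+1;j,i}^{(r)} = F_{a;j,i}^{(r)}` and, for `a < b`,
`F_{a,b+1;j,i}^{(r)} = [F_{b;j,k}^{(1)}, F_{a,b;k,i}^{(r)}]`, where `k` is the first index of the
block `b`. The arguments of `FF` are in the order `a, i, r, b, j`. -/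
def FF (ν : Composition n) (a : ℕ) (ha : a < ν.length) (i : Fin (ν.blocksFun ⟨a, ha⟩)) (r : ℕ) :
    (b : ℕ) → (hb : b < ν.length) → Fin (ν.blocksFun ⟨b, hb⟩) → Yangian n
  | 0, _, _ => 0
  | b + 1, hb, j =>
    if h : a = b then F ν b hb j (Fin.cast (by subst h; rfl) i) r
    else
      ⁅F ν b hb j (firstIdx ν _) 1, FF ν a ha i r b (b.lt_succ_self.trans hb) (firstIdx ν _)⁆

/-! ### The subalgebras -/

/-- `Y_ν`, generated by all `D_{a;i,j}^{(r)}`. -/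
def levi (ν : Composition n) : Subalgebra ℂ (Yangian n) :=
  Algebra.adjoin ℂ {x | ∃ a i j r, x = D ν a i j r}

/-- `Y_ν^+`, generated by all `E_{a;i,j}^{(r)}` with `r ≥ 1`. -/
def plus (ν : Composition n) : Subalgebra ℂ (Yangian n) :=
  Algebra.adjoin ℂ {x | ∃ a ha i j, ∃ r ≥ 1, x = E ν a ha i j r}

/-- `Y_ν^-`, generated by all `F_{a;i,j}^{(r)}` with `r ≥ 1`. -/
def minus (ν : Composition n) : Subalgebra ℂ (Yangian n) :=
  Algebra.adjoin ℂ {x | ∃ a ha i j, ∃ r ≥ 1, x = F ν a ha i j r}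

/-! ### Families of root elements -/

/-- Index set of the elements `D_{a;i,j}^{(r)}` with `r ≥ 1`. -/
structure DIndex (ν : Composition n) where
  a : Fin ν.length
  i : Fin (ν.blocksFun a)
  j : Fin (ν.blocksFun a)
  r : ℕ+

/-- Index set of the elements `E_{a,b;i,j}^{(r)}` with `a < b` and `r ≥ 1`. -/
structure EIndex (ν : Composition n) where
  a : Fin ν.length
  b : Fin ν.length
  lt : a < b
  i : Fin (ν.blocksFun a)
  j : Fin (ν.blocksFun b)
  r : ℕ+

/-- Index set of the elements `F_{a,b;i,j}^{(r)}` with `a < b` and `r ≥ 1`. -/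
structure FIndex (ν : Composition n) where
  a : Fin ν.length
  b : Fin ν.length
  lt : a < b
  i : Fin (ν.blocksFun b)
  j : Fin (ν.blocksFun a)
  r : ℕ+

def DFamily (ν : Composition n) (x : DIndex ν) : Yangian n := D ν x.a x.i x.j x.r

def EFamily (ν : Composition n) (x : EIndex ν) : Yangian n :=
  EE ν x.a x.a.isLt x.i x.r x.b x.b.isLt x.j

def FFamily (ν : Composition n) (x : FIndex ν) : Yangian n :=
  FF ν x.a x.a.isLt x.j x.r x.b x.b.isLt x.i

/-- The union of the three families. -/
def allFamily (ν : Composition n) : DIndex ν ⊕ EIndex ν ⊕ FIndex ν → Yangian n :=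
  Sum.elim (DFamily ν) (Sum.elim (EFamily ν) (FFamily ν))

/-! ### Ordered monomials and the multiplication map -/

/-- The monomial `x_{i_1} x_{i_2} ⋯ x_{i_k}` with `i_1 ≤ i_2 ≤ ⋯ ≤ i_k`, indexed by the multiset
`{i_1, …, i_k}`. -/
def orderedMonomial {I A : Type*} [Monoid A] (lo : LinearOrder I) (x : I → A) (s : Multiset I) : A :=
  ((s.sort (fun i j => i ≤ j)).map x).prod

/-- The ordered monomials in the family `x`, indexed by multisets, form a basis of `S`. -/
def IsPBWBasis {I A : Type*} [Ring A] [Algebra ℂ A] (lo : LinearOrder I) (x : I → A)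
    (S : Subalgebra ℂ A) : Prop :=
  LinearIndependent ℂ (orderedMonomial lo x) ∧
    Submodule.span ℂ (Set.range (orderedMonomial lo x)) = Subalgebra.toSubmodule S

/-- The multiplication map `x ⊗ y ⊗ z ↦ x y z`. -/
def mulMap3 {A : Type*} [Ring A] [Algebra ℂ A] (P Q S : Subalgebra ℂ A) :
    (P ⊗[ℂ] Q) ⊗[ℂ] S →ₗ[ℂ] A :=
  LinearMap.mul' ℂ A ∘ₗ
    TensorProduct.map
      (LinearMap.mul' ℂ A ∘ₗ TensorProduct.map P.val.toLinearMap Q.val.toLinearMap)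
      S.val.toLinearMap

end Yang

end

/-! With `x = u⁻¹` and `y = v⁻¹` the defining relation reads `(y - x)[T i j (x), T h l (y)] = xy (T
h j (x) T i l (y) - T h j (y) T i l (x))`. The argument has three independent ingredients.

Relations for the block generators. The inverse `N` of `T` satisfies the same relation with the
opposite sign (`RTT.inv`). Since `E N = (F D)⁻¹` is block lower triangular, the row `h` of `E`
beyond its own block is `-N_{h,J} N_{J,J}⁻¹`, where `J` is the set of positions in later blocks
(`inverse_row`); and `D_a` is the first block of the inverse of the corner of `N` on the blocks from
`a` on. The relations for `N` therefore become commutator formulas for `E` that involve only `E` and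
`E⁻¹` (`upper_rel_same`, `upper_rel_of_lt`), the RTT relation for each `D_a` (`rtt_diag`), and the
commutation of different diagonal blocks (`commute_diag`). A low coefficient of `upper_rel_of_lt`
shows that the iterated commutators are the coefficients of the entries of `E`, through whatever
index `k` they are formed (`upper_recursion`). Transposition into the opposite ring carries
everything over to `F`.

Spanning. Give a generator with superscript `r` the weight `r`. By the relations above, a commutator
of generators of weights `r` and `s` is a combination of words of weight less than `r + s` in the
same family, so words can be sorted by induction on the weight (`Straightens.span_orderedMonomial`).
For the union of the families this is deduced from the `T`'s: these straighten by the RTT relation,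
and the `T`'s and the block generators are combinations of words in each other of no larger weight.

Independence. Multiplying `k` evaluation matrices at the points `p t²`, built from matrix units `∂ +
t z`, gives representations `rep n k` over polynomials in `t`. There `T_{i,j}^{(r+1)}` has degree at
most `2r + 1` in `t`, and its coefficient in that degree is multiplication by `∑ p^r z_{p,i,j}`. For
`r < k` these sums are independent variables up to a Vandermonde substitution. Every product of two
factors of positive weight loses a degree, so a block generator has the same leading coefficient as
the entry of `T` at its position, and the ordered monomials have independent leading coefficients
(`linearIndependent_orderedMonomial`).

The triangular decomposition follows by ordering the generators as `F`, then `D`, then `E`: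
multiplication takes a product basis to a basis. -/

namespace Yang

/-! ### Exchange relations in an algebra with two commuting scalars -/

section Exchange

variable {k B ι : Type*} [CommRing k] [Ring B] [Algebra k B]

/-- The exchange relation between the entries of two matrices. -/
def Exchange (z w : k) (T T' : Matrix ι ι B) : Prop :=
  ∀ i j h l, z • (T i j * T' h l - T' h l * T i j) = w • (T h j * T' i l - T' h j * T i l)

variable [Fintype ι]

/-- This is the derivation rule `[c, N] = -N [c, T] N`; the commutator with `c` is taken entrywise
by placing `c` on a diagonal matrix. -/
theorem smul_comm_mul_inv [DecidableEq ι] {z : k} {T' N' : Matrix ι ι B} (hTN : T' * N' = 1) (hNT : N' * T' = 1)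
    (c : B) (h l : ι) :
    z • (c * N' h l - N' h l * c) =
      -((N' * (Matrix.of fun a b => z • (c * T' a b - T' a b * c)) * N') h l) := by
  set S : Matrix ι ι B := Matrix.diagonal fun _ => c with hS
  have e1 : (Matrix.of fun a b => z • (c * T' a b - T' a b * c)) = z • (S * T' - T' * S) := by
    ext a b
    simp [hS]
  have e2 : N' * (z • (S * T' - T' * S)) * N' = z • (N' * S - S * N') := by
    rw [Matrix.mul_smul, Matrix.smul_mul]
    congr 1
    have : N' * (S * T' - T' * S) * N' = N' * S * (T' * N') - (N' * T') * S * N' := by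
      noncomm_ring
    rw [this, hTN, hNT]
    simp
  rw [e1, e2]
  simp only [hS, Matrix.smul_apply, Matrix.sub_apply, Matrix.mul_diagonal, Matrix.diagonal_mul]
  rw [← smul_neg, neg_sub]

/-- In the derivation rule with `c = T i j`, the exchange relation makes `z [c, T']` a difference of
two rank-one matrices, and `N'` turns one factor of each into a unit vector. -/
theorem Exchange.comm_inv [DecidableEq ι] {z w : k} {T T' N' : Matrix ι ι B} (hTN : T' * N' = 1)
    (hNT : N' * T' = 1) (H : Exchange z w T T') (i j h l : ι) :
    z • (T i j * N' h l - N' h l * T i j) =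
      w • ((1 : Matrix ι ι B) h j * (T * N') i l - (N' * T) h j * (1 : Matrix ι ι B) i l) := by
  rw [smul_comm_mul_inv hTN hNT]
  have e : (Matrix.of fun a b => z • (T i j * T' a b - T' a b * T i j)) =
      w • (Matrix.vecMulVec (fun a => T a j) (fun b => T' i b) -
        Matrix.vecMulVec (fun a => T' a j) (fun b => T i b)) := by
    ext a b
    simp only [Matrix.of_apply, H i j a b, Matrix.smul_apply, Matrix.sub_apply,
      Matrix.vecMulVec_apply]
  rw [e, Matrix.mul_smul, Matrix.smul_mul, Matrix.mul_sub, Matrix.sub_mul, Matrix.mul_vecMulVec,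
    Matrix.mul_vecMulVec, Matrix.vecMulVec_mul, Matrix.vecMulVec_mul, Matrix.smul_apply,
    ← smul_neg, Matrix.sub_apply, neg_sub]
  simp only [Matrix.vecMulVec_apply]
  have a1 : N'.mulVec (fun a => T' a j) h = (1 : Matrix ι ι B) h j := by rw [← hNT]; rfl
  have a2 : Matrix.vecMul (fun b => T' i b) N' l = (1 : Matrix ι ι B) i l := by rw [← hTN]; rfl
  rw [a1, a2]
  rfl

/-- The inverses of two matrices satisfying the exchange relation. -/
theorem Exchange.inv [DecidableEq ι] {z w : k} {T T' N N' : Matrix ι ι B} (hTN : T * N = 1) (hNT : N * T = 1)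
    (hTN' : T' * N' = 1) (hNT' : N' * T' = 1) (H : Exchange z w T T') (i j h l : ι) :
    z • (N i j * N' h l - N' h l * N i j) = w • (N i l * N' h j - N' i l * N h j) := by
  -- The derivation rule is used a second time, now for `N`: the commutators of `N' h l` with the
  -- entries of `T` are known from `comm_inv` and again form a difference of rank-one matrices.
  have H1 := smul_comm_mul_inv (z := z) hTN hNT (N' h l) i j
  have e : (Matrix.of fun a b => z • (N' h l * T a b - T a b * N' h l)) =
      w • (Matrix.vecMulVec (fun a => (1 : Matrix ι ι B) a l) (fun b => (N' * T) h b) -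
        Matrix.vecMulVec (fun a => (T * N') a l) (fun b => (1 : Matrix ι ι B) h b)) := by
    ext a b
    have := H.comm_inv hTN' hNT' a b h l
    rw [← neg_inj, ← smul_neg, neg_sub] at this
    rw [Matrix.of_apply, this, ← smul_neg, neg_sub]
    simp only [Matrix.smul_apply, Matrix.sub_apply, Matrix.vecMulVec_apply]
    congr 2
    · by_cases hal : a = l
      · subst hal; rw [Matrix.one_apply_eq, one_mul, mul_one]
      · rw [Matrix.one_apply_ne hal, zero_mul, mul_zero]
    · by_cases hal : h = b
      · subst hal; rw [Matrix.one_apply_eq, one_mul, mul_one]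
      · rw [Matrix.one_apply_ne hal, zero_mul, mul_zero]
  rw [e, Matrix.mul_smul, Matrix.smul_mul, Matrix.mul_sub, Matrix.sub_mul, Matrix.mul_vecMulVec,
    Matrix.mul_vecMulVec, Matrix.vecMulVec_mul, Matrix.vecMulVec_mul, Matrix.smul_apply,
    Matrix.sub_apply] at H1
  simp only [Matrix.vecMulVec_apply] at H1
  have a1 : N.mulVec (fun a => (1 : Matrix ι ι B) a l) i = N i l := by
    have : (N * (1 : Matrix ι ι B)) i l = N i l := by rw [mul_one]
    exact this
  have a2 : Matrix.vecMul (fun b => (1 : Matrix ι ι B) h b) N j = N h j := by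
    have : ((1 : Matrix ι ι B) * N) h j = N h j := by rw [one_mul]
    exact this
  have a3 : N.mulVec (fun a => (T * N') a l) i = N' i l := by
    have : (N * (T * N')) i l = N' i l := by rw [← mul_assoc, hNT, one_mul]
    exact this
  have a4 : Matrix.vecMul (fun b => (N' * T) h b) N j = N' h j := by
    have : (N' * T * N) h j = N' h j := by rw [mul_assoc, hTN, mul_one]
    exact this
  rw [a1, a2, a3, a4] at H1
  rw [← neg_inj, ← smul_neg, neg_sub, H1]

/-- A product of two matrices whose entries commute with each other. -/
theorem Exchange.mul {z w : k} {T T' S S' : Matrix ι ι B} (hT : Exchange z w T T')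
    (hS : Exchange z w S S') (h₁ : ∀ a b c d, Commute (T a b) (S' c d))
    (h₂ : ∀ a b c d, Commute (T' a b) (S c d)) : Exchange z w (T * S) (T' * S') := by
  intro i j h l
  have e : ∀ {P Q P' Q' : Matrix ι ι B} (_ : ∀ a b c d, Commute (Q a b) (P' c d)) (i j h l : ι),
      (P * Q) i j * (P' * Q') h l =
        ∑ a, ∑ b, (P i a * P' h b) * (Q a j * Q' b l) := by
    intro P Q P' Q' hc i j h l
    simp only [Matrix.mul_apply, Finset.sum_mul, Finset.mul_sum]
    rw [Finset.sum_comm]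
    refine Finset.sum_congr rfl fun a _ => Finset.sum_congr rfl fun b _ => ?_
    rw [mul_assoc, ← mul_assoc (Q a j), (hc a j h b).eq]
    simp only [mul_assoc]
  have hc₁ : ∀ a b c d, Commute (S a b) (T' c d) := fun a b c d => (h₂ c d a b).symm
  have hc₂ : ∀ a b c d, Commute (S' a b) (T c d) := fun a b c d => (h₁ c d a b).symm
  rw [e hc₁, e hc₂, e hc₁, e hc₂]
  have s1 : ∑ a, ∑ b, T' h a * T i b * (S' a l * S b j) =
      ∑ a, ∑ b, T' h b * T i a * (S' b l * S a j) := Finset.sum_comm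
  have s2 : ∑ a, ∑ b, T' h a * T i b * (S' a j * S b l) =
      ∑ a, ∑ b, T' h b * T i a * (S' b j * S a l) := Finset.sum_comm
  have s3 : ∑ a, ∑ b, T' h a * T i b * (S a j * S' b l) =
      ∑ a, ∑ b, T' h b * T i a * (S b j * S' a l) := Finset.sum_comm
  -- First `T` is exchanged with `T'`, then `S` with `S'`. The mixed sum of products `T' T S S'`
  -- subtracted in both steps is the same after renaming the summation indices by `s3`.
  have p1 : ∀ a b, z • ((T i a * T' h b) * (S a j * S' b l)) - w • ((T h a * T' i b) *
      (S a j * S' b l)) = z • ((T' h b * T i a) * (S a j * S' b l)) -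
        w • ((T' h a * T i b) * (S a j * S' b l)) := by
    intro a b
    have := congrArg (· * (S a j * S' b l)) (hT i a h b)
    simp only [smul_mul_assoc, sub_mul] at this
    linear_combination (norm := module) this
  have p2 : ∀ a b, z • ((T' h b * T i a) * (S a j * S' b l)) - w • ((T' h b * T i a) *
      (S b j * S' a l)) = z • ((T' h b * T i a) * (S' b l * S a j)) -
        w • ((T' h b * T i a) * (S' b j * S a l)) := by
    intro a b
    have := congrArg ((T' h b * T i a) * ·) (hS a j b l)
    simp only [mul_smul_comm, mul_sub] at this
    linear_combination (norm := module) this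
  have q1 := Finset.sum_congr (s₁ := Finset.univ) rfl fun a _ =>
    Finset.sum_congr (s₁ := Finset.univ) rfl fun b _ => p1 a b
  have q2 := Finset.sum_congr (s₁ := Finset.univ) rfl fun a _ =>
    Finset.sum_congr (s₁ := Finset.univ) rfl fun b _ => p2 a b
  simp only [Finset.sum_sub_distrib, ← Finset.smul_sum] at q1 q2
  rw [s3] at q1
  rw [s1, s2, smul_sub, smul_sub]
  rw [q2] at q1
  rw [sub_eq_sub_iff_add_eq_add] at q1 ⊢
  rw [q1, add_comm]

/-! ### Relations between rows of the upper unitriangular factor -/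

end Exchange

section Rows

variable {k B ι J : Type*} [CommRing k] [Ring B] [Algebra k B]

/-- Right multiplication by a right inverse solves a linear system. Below, the matrix of the system
is a corner of `n` or `n'` and the unknowns are commutators. -/
theorem eq_sum_of_sum_mul_eq [Fintype J] [DecidableEq J] {m V : J → J → B}
    (hV : ∀ s p, ∑ l, m s l * V l p = if s = p then 1 else 0) {f g : J → B}
    (h : ∀ l, ∑ s, f s * m s l = g l) (p : J) : f p = ∑ l, g l * V l p := by
  simp only [← h, Finset.sum_mul, mul_assoc]
  rw [Finset.sum_comm]
  simp [← Finset.mul_sum, hV]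

theorem smul_comm_mul (z : k) (a b c : B) : (z • (a * b - b * a)) * c =
    z • ((a * c) * b - b * (a * c)) - a * (z • (c * b - b * c)) := by
  rw [smul_mul_assoc, mul_smul_comm, ← smul_sub]
  congr 1
  noncomm_ring

/-- Let `n`, `n'` be the columns with indices in `J` of two matrices satisfying the (inverse)
exchange relation, and suppose that the row `h` is a combination of the rows in `J`, with
coefficients `-ε`, `-ε'`. -/
theorem comm_row_sum [Fintype J] (c : J → ι) {z w : k} {n n' : ι → J → B}
    (H : ∀ i h (j l : J), z • (n i j * n' h l - n' h l * n i j) =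
      -(w • (n h j * n' i l - n' h j * n i l)))
    {ε ε' : J → B} {h : ι} (hε : ∀ l, n h l = -∑ s, ε s * n (c s) l)
    (hε' : ∀ l, n' h l = -∑ s, ε' s * n' (c s) l) (i : ι) (j l : J) :
    ∑ s, (z • (n i j * ε' s - ε' s * n i j)) * n' (c s) l =
      -(w • ((∑ s, (ε s - ε' s) * n (c s) j) * n' i l)) := by
  -- The Leibniz rule `[n, ε'] n' = [n, ε' n'] - ε' [n, n']`; summed over `s`, the products `ε' n'`
  -- give back the row `h`.
  have a : ∀ s, (z • (n i j * ε' s - ε' s * n i j)) * n' (c s) l =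
      z • (n i j * (ε' s * n' (c s) l)) - z • ((ε' s * n' (c s) l) * n i j) -
        ε' s * (z • (n i j * n' (c s) l - n' (c s) l * n i j)) := by
    intro s
    rw [smul_mul_assoc, mul_smul_comm, ← smul_sub, ← smul_sub]
    congr 1
    noncomm_ring
  have e1 : ∑ s, ε' s * n' (c s) l = - n' h l := by rw [hε' l, neg_neg]
  have e2 : ∑ s, ε' s * n' (c s) j = - n' h j := by rw [hε' j, neg_neg]
  have e3 : ∑ s, ε s * n (c s) j = - n h j := by rw [hε j, neg_neg]
  simp only [a, H, Finset.sum_sub_distrib, ← Finset.smul_sum, ← Finset.mul_sum, ← Finset.sum_mul,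
    e1, sub_mul]
  simp only [mul_neg, mul_smul_comm, Finset.sum_sub_distrib, ← Finset.smul_sum,
    ← Finset.sum_mul, Finset.sum_neg_distrib, mul_sub, ← mul_assoc]
  rw [e2, e3]
  have := H i h j l
  simp only [neg_mul] at this ⊢
  linear_combination (norm := module) -this

/-- `comm_row_sum` is a linear system for the commutators with `ε'`; `V'` inverts its matrix. -/
theorem comm_row [Fintype J] [DecidableEq J] (c : J → ι) {z w : k} {n n' : ι → J → B}
    (H : ∀ i h (j l : J), z • (n i j * n' h l - n' h l * n i j) =
      -(w • (n h j * n' i l - n' h j * n i l)))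
    {ε ε' : J → B} {h : ι} (hε : ∀ l, n h l = -∑ s, ε s * n (c s) l)
    (hε' : ∀ l, n' h l = -∑ s, ε' s * n' (c s) l) {V' : J → J → B}
    (hV : ∀ s p, ∑ l, n' (c s) l * V' l p = if s = p then 1 else 0) (i : ι) (j p : J) :
    z • (n i j * ε' p - ε' p * n i j) =
      -(w • ((∑ s, (ε s - ε' s) * n (c s) j) * ∑ l, n' i l * V' l p)) := by
  have := eq_sum_of_sum_mul_eq hV (f := fun p => z • (n i j * ε' p - ε' p * n i j))
    (comm_row_sum c H hε hε' i j) p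
  rw [this]
  simp only [neg_mul, smul_mul_assoc, Finset.sum_neg_distrib, ← Finset.smul_sum, mul_assoc,
    ← Finset.mul_sum]

/-- Commutation of a row with a row below it. -/
theorem comm_row_of_lt [DecidableEq J] {J' : Type*} [Fintype J'] [DecidableEq J'] (c : J → ι)
    (c' : J' → J) {z w : k} {n : ι → J → B} {Y ε' : J → B}
    (H : ∀ s j p : J, z • (n (c s) j * ε' p - ε' p * n (c s) j) =
      -(w • (Y j * if s = p then 1 else 0)))
    {e : J' → B} {i : J} (he : ∀ l, n (c i) (c' l) = -∑ s, e s * n (c (c' s)) (c' l))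
    {V : J' → J' → B}
    (hV : ∀ s p, ∑ l, n (c (c' s)) (c' l) * V l p = if s = p then 1 else 0) (q : J') (p : J) :
    z • (e q * ε' p - ε' p * e q) =
      w • (((if i = p then 1 else 0) + ∑ s, if c' s = p then e s else 0) *
        ∑ l, Y (c' l) * V l q) := by
  have := eq_sum_of_sum_mul_eq hV (f := fun q => z • (e q * ε' p - ε' p * e q))
    (g := fun l => w • (((if i = p then 1 else 0) + ∑ s, if c' s = p then e s else 0) *
        Y (c' l))) (fun l => ?_) q
  · rw [this]
    simp only [smul_mul_assoc, ← Finset.smul_sum, mul_assoc, ← Finset.mul_sum]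
  -- The sum of the `e n` is minus the row `i` of `n`, whose index also lies in `J`, so `H` supplies
  -- every commutator with `ε'` that the Leibniz rule produces.
  · have e1 : ∑ s, e s * n (c (c' s)) (c' l) = -n (c i) (c' l) := by rw [he l, neg_neg]
    simp only [smul_comm_mul, Finset.sum_sub_distrib, ← Finset.smul_sum, ← Finset.mul_sum,
      ← Finset.sum_mul, e1, H]
    have e2 : ∀ s, e s * -(w • (Y (c' l) * if c' s = p then 1 else 0)) =
        -(w • ((if c' s = p then e s else 0) * Y (c' l))) := by
      intro s
      split_ifs <;> simp
    have e3 := H i (c' l) p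
    simp only [e2, Finset.sum_neg_distrib, ← Finset.smul_sum, ← Finset.sum_mul, add_mul, neg_mul,
      mul_neg]
    have e4 : (if i = p then (1 : B) else 0) * Y (c' l) = Y (c' l) * if i = p then 1 else 0 := by
      split_ifs <;> simp
    rw [e4]
    linear_combination (norm := module) -e3

/-- Commutation of two rows of the same block. -/
theorem comm_row_same [Fintype J] [DecidableEq J] (c : J → ι) {z w : k} {n n' : ι → J → B}
    (H : ∀ i h (j l : J), z • (n i j * n' h l - n' h l * n i j) =
      -(w • (n h j * n' i l - n' h j * n i l)))
    {ε ε' η η' : J → B} {h i : ι} (hε : ∀ l, n h l = -∑ s, ε s * n (c s) l)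
    (hε' : ∀ l, n' h l = -∑ s, ε' s * n' (c s) l) (hη : ∀ l, n i l = -∑ s, η s * n (c s) l)
    (hη' : ∀ l, n' i l = -∑ s, η' s * n' (c s) l) {V V' : J → J → B}
    (hV : ∀ s p, ∑ l, n (c s) l * V l p = if s = p then 1 else 0)
    (hV' : ∀ s p, ∑ l, n' (c s) l * V' l p = if s = p then 1 else 0) (q p : J) :
    z • z • (η q * ε' p - ε' p * η q) =
      w • (z • (η p * (ε q - ε' q) - (ε q - ε' q) * η' p) +
        w • ((ε p - ε' p) * (η q - η' q))) := by
  have := eq_sum_of_sum_mul_eq hV (f := fun q => z • z • (η q * ε' p - ε' p * η q))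
    (g := fun l => ∑ t, w • (z • (η p * (ε t - ε' t) - (ε t - ε' t) * η' p) +
        w • ((ε p - ε' p) * (η t - η' t))) * n (c t) l) (fun l => ?_) q
  · rw [this]
    simp only [Finset.sum_mul]
    rw [Finset.sum_comm]
    simp [mul_assoc, ← Finset.mul_sum, hV]
  · set Y : J → B := fun l => ∑ s, (ε s - ε' s) * n (c s) l with hY
    set Z : J → B := fun l => ∑ s, (η s - η' s) * n (c s) l with hZ
    have A : ∀ s j p : J, z • (n (c s) j * ε' p - ε' p * n (c s) j) =
        -(w • (Y j * if s = p then 1 else 0)) := by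
      intro s j p
      rw [comm_row c H hε hε' hV', hV']
    have A' : ∀ s j p : J, z • (n (c s) j * η' p - η' p * n (c s) j) =
        -(w • (Z j * if s = p then 1 else 0)) := by
      intro s j p
      rw [comm_row c H hη hη' hV', hV']
    -- Writing the row `i` of `n'` through `η'` removes `V'` from the formula of `comm_row`.
    have C : z • (n i l * ε' p - ε' p * n i l) = w • (Y l * η' p) := by
      rw [comm_row c H hε hε' hV']
      have : ∑ m, n' i m * V' m p = -η' p := by
        simp only [hη', neg_mul, Finset.sum_neg_distrib, Finset.sum_mul, mul_assoc]
        rw [Finset.sum_comm]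
        simp [← Finset.mul_sum, hV']
      rw [this, mul_neg, smul_neg, neg_neg]
    have e1 : ∑ s, η s * n (c s) l = -n i l := by rw [hη l, neg_neg]
    have S1 : ∑ s, (z • (η s * ε' p - ε' p * η s)) * n (c s) l =
        w • (η p * Y l) - w • (Y l * η' p) := by
      simp only [smul_comm_mul, Finset.sum_sub_distrib, ← Finset.smul_sum, ← Finset.mul_sum,
        ← Finset.sum_mul, e1, A]
      have : ∀ s, η s * -(w • (Y l * if s = p then 1 else 0)) =
          if s = p then -(w • (η p * Y l)) else 0 := by
        intro s
        split_ifs with hs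
        · subst hs; simp
        · simp
      simp only [this, Finset.sum_ite_eq', Finset.mem_univ, if_true, neg_mul, mul_neg]
      linear_combination (norm := module) -C
    -- The term `Y l * η' p` left by `S1` is not a combination of the `n (c t) l` with coefficients
    -- on the left. Moving `η'` to the left of `n` costs a second factor `z`, whence `z • z` in the
    -- statement.
    have S2 : z • (Y l * η' p) = ∑ t, z • (((ε t - ε' t) * η' p) * n (c t) l) -
        w • ((ε p - ε' p) * Z l) := by
      have : ∀ t, z • ((ε t - ε' t) * n (c t) l * η' p) =
          z • (((ε t - ε' t) * η' p) * n (c t) l) -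
            w • (if t = p then (ε p - ε' p) * Z l else 0) := by
        intro t
        have := congrArg ((ε t - ε' t) * ·) (A' t l p)
        simp only [mul_smul_comm, mul_sub, mul_neg] at this
        rw [mul_assoc, mul_assoc]
        have h2 : (ε t - ε' t) * (Z l * if t = p then (1 : B) else 0) =
            if t = p then (ε p - ε' p) * Z l else 0 := by
          split_ifs with hs
          · subst hs; simp
          · simp
        rw [h2] at this
        linear_combination (norm := module) this
      simp only [hY, Finset.sum_mul, Finset.smul_sum, this, Finset.sum_sub_distrib]
      simp
    have : ∑ s, (z • z • (η s * ε' p - ε' p * η s)) * n (c s) l =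
        z • (w • (η p * Y l) - w • (Y l * η' p)) := by
      rw [← S1, Finset.smul_sum]
      simp only [smul_mul_assoc]
    rw [this]
    have e5 : ∑ t, w • (z • (η p * (ε t - ε' t) - (ε t - ε' t) * η' p) +
        w • ((ε p - ε' p) * (η t - η' t))) * n (c t) l =
        w • (z • (η p * Y l) - ∑ t, z • (((ε t - ε' t) * η' p) * n (c t) l) +
          w • ((ε p - ε' p) * Z l)) := by
      simp only [hY, hZ, Finset.mul_sum, Finset.smul_sum, ← Finset.sum_sub_distrib,
        ← Finset.sum_add_distrib]
      refine Finset.sum_congr rfl fun t _ => ?_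
      simp only [smul_mul_assoc, add_mul, sub_mul (_ : B) _ (n (c t) l), mul_assoc]
      module
    rw [e5]
    linear_combination (norm := module) (-w) • S2

end Rows
end Yang

noncomputable section

namespace Yang

/-! ### Power series in two variables -/

section TwoVariables

variable {A : Type*} [Ring A]

/-- Series in two variables `x` (outer) and `y` (inner). -/
abbrev Series₂ (A : Type*) [Ring A] : Type _ := PowerSeries (PowerSeries A)

/-- A series in `x`. -/
def inX : PowerSeries A →+* Series₂ A := PowerSeries.map PowerSeries.C

/-- A series in `y`. -/
def inY : PowerSeries A →+* Series₂ A := PowerSeries.C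

/-- The coefficient of `x ^ r * y ^ s`. -/
def coeff₂ (r s : ℕ) : Series₂ A →+ A :=
  (PowerSeries.coeff s).toAddMonoidHom.comp (PowerSeries.coeff r).toAddMonoidHom

theorem coeff₂_apply (r s : ℕ) (f : Series₂ A) :
    coeff₂ r s f = PowerSeries.coeff s (PowerSeries.coeff r f) := rfl

theorem ext₂ {f g : Series₂ A} (h : ∀ r s, coeff₂ r s f = coeff₂ r s g) : f = g := by
  ext r s
  exact h r s

theorem coeff₂_inX_mul_inY (f g : PowerSeries A) (r s : ℕ) :
    coeff₂ r s (inX f * inY g) = PowerSeries.coeff r f * PowerSeries.coeff s g := by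
  simp [coeff₂_apply, inX, inY, PowerSeries.coeff_mul_C, PowerSeries.coeff_C_mul]

theorem coeff₂_inY_mul_inX (f g : PowerSeries A) (r s : ℕ) :
    coeff₂ r s (inY g * inX f) = PowerSeries.coeff s g * PowerSeries.coeff r f := by
  simp [coeff₂_apply, inX, inY, PowerSeries.coeff_mul_C, PowerSeries.coeff_C_mul]

theorem coeff₂_mul (f g : Series₂ A) (r s : ℕ) : coeff₂ r s (f * g) =
    ∑ p ∈ Finset.HasAntidiagonal.antidiagonal r, ∑ q ∈ Finset.HasAntidiagonal.antidiagonal s,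
      coeff₂ p.1 q.1 f * coeff₂ p.2 q.2 g := by
  simp [coeff₂_apply, PowerSeries.coeff_mul]

variable (A) in
/-- The variable `x`. -/
def varX : Series₂ A := PowerSeries.X

variable (A) in
/-- The variable `y`. -/
def varY : Series₂ A := PowerSeries.C PowerSeries.X

theorem varX_mem_center : varX A ∈ Subring.center (Series₂ A) := by
  rw [Subring.mem_center_iff]
  exact fun f => (PowerSeries.commute_X f).eq

theorem varY_mem_center : varY A ∈ Subring.center (Series₂ A) := by
  rw [Subring.mem_center_iff]
  intro f
  ext r : 1
  simp [varY, PowerSeries.coeff_mul_C, PowerSeries.coeff_C_mul, (PowerSeries.commute_X _).eq]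

variable (A) in
/-- The scalar `y - x`. -/
def diffYX : Subring.center (Series₂ A) := ⟨varY A - varX A, sub_mem varY_mem_center varX_mem_center⟩

variable (A) in
/-- The scalar `x * y`. -/
def prodXY : Subring.center (Series₂ A) := ⟨varX A * varY A, mul_mem varX_mem_center varY_mem_center⟩

theorem coeff₂_diffYX_smul_zero_zero (f : Series₂ A) : coeff₂ 0 0 (diffYX A • f) = 0 := by
  change coeff₂ 0 0 ((varY A - varX A) * f) = 0
  simp [sub_mul, coeff₂_apply, varX, varY]

theorem coeff₂_diffYX_smul_zero_succ (f : Series₂ A) (s : ℕ) :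
    coeff₂ 0 (s + 1) (diffYX A • f) = coeff₂ 0 s f := by
  change coeff₂ 0 (s + 1) ((varY A - varX A) * f) = _
  rw [sub_mul, map_sub]
  simp [coeff₂_apply, varX, varY, PowerSeries.coeff_succ_X_mul]

theorem coeff₂_diffYX_smul_succ_zero (f : Series₂ A) (r : ℕ) :
    coeff₂ (r + 1) 0 (diffYX A • f) = -coeff₂ r 0 f := by
  change coeff₂ (r + 1) 0 ((varY A - varX A) * f) = _
  rw [sub_mul, map_sub]
  simp [coeff₂_apply, varX, varY, PowerSeries.coeff_succ_X_mul, PowerSeries.coeff_C_mul]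

theorem coeff₂_diffYX_smul_succ_succ (f : Series₂ A) (r s : ℕ) :
    coeff₂ (r + 1) (s + 1) (diffYX A • f) = coeff₂ (r + 1) s f - coeff₂ r (s + 1) f := by
  change coeff₂ (r + 1) (s + 1) ((varY A - varX A) * f) = _
  rw [sub_mul, map_sub]
  simp [coeff₂_apply, varX, varY, PowerSeries.coeff_succ_X_mul, PowerSeries.coeff_C_mul]

theorem coeff₂_prodXY_smul_zero_left (f : Series₂ A) (s : ℕ) :
    coeff₂ 0 s (prodXY A • f) = 0 := by
  change coeff₂ 0 s ((varX A * varY A) * f) = 0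
  rw [mul_assoc]
  simp [coeff₂_apply, varX]

theorem coeff₂_prodXY_smul_zero_right (f : Series₂ A) (r : ℕ) :
    coeff₂ r 0 (prodXY A • f) = 0 := by
  change coeff₂ r 0 ((varX A * varY A) * f) = 0
  rw [mul_assoc]
  cases r <;>
  simp [coeff₂_apply, varX, varY, PowerSeries.coeff_succ_X_mul, PowerSeries.coeff_C_mul]

theorem coeff₂_prodXY_smul_succ_succ (f : Series₂ A) (r s : ℕ) :
    coeff₂ (r + 1) (s + 1) (prodXY A • f) = coeff₂ r s f := by
  change coeff₂ (r + 1) (s + 1) ((varX A * varY A) * f) = _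
  rw [mul_assoc]
  simp [coeff₂_apply, varX, varY, PowerSeries.coeff_succ_X_mul, PowerSeries.coeff_C_mul]

/-- Division by `y - x`. -/
theorem coeff₂_of_diffYX_smul_eq {f g : Series₂ A} (h : diffYX A • f = prodXY A • g) (r s : ℕ) :
    coeff₂ r s f = ∑ i ∈ Finset.range r, coeff₂ i (r + s - 1 - i) g := by
  induction r generalizing s with
  | zero => rw [← coeff₂_diffYX_smul_zero_succ, h, coeff₂_prodXY_smul_zero_left]; simp
  | succ r ih =>
    have := coeff₂_diffYX_smul_succ_succ f r s
    rw [h, coeff₂_prodXY_smul_succ_succ, eq_sub_iff_add_eq] at this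
    rw [← this, ih, Finset.sum_range_succ, add_comm]
    congr 1
    · exact Finset.sum_congr rfl fun i _ => by congr 2; omega
    · congr 2; omega

/-- The scalar `y - x` is not a zero divisor: multiplication by it determines the coefficients one
power of `x` after the other. -/
theorem eq_of_diffYX_smul_eq {f g : Series₂ A} (h : diffYX A • f = diffYX A • g) : f = g := by
  have : diffYX A • (f - g) = prodXY A • (0 : Series₂ A) := by rw [smul_sub, h]; simp
  refine sub_eq_zero.mp (ext₂ fun r s => ?_)
  rw [coeff₂_of_diffYX_smul_eq this]
  simp

/-! ### The RTT relation for matrices of power series -/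

variable {ι : Type*}

/-- The relation `(u - v) [M_{ij}(u), M_{hl}(v)] = ħ (M_{hj}(u) M_{il}(v) - M_{hj}(v) M_{il}(u))`,
with `x = u⁻¹` and `y = v⁻¹`. -/
def RTT (ħ : ℤ) (M : Matrix ι ι (PowerSeries A)) : Prop :=
  Exchange (diffYX A) (ħ • prodXY A) (M.map inX) (M.map inY)

theorem RTT.submatrix {ħ : ℤ} {M : Matrix ι ι (PowerSeries A)} (h : RTT ħ M) {κ : Type*}
    (c : κ → ι) : RTT ħ (M.submatrix c c) :=
  fun i j k l => h (c i) (c j) (c k) (c l)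

theorem coeff₂_zsmul_prodXY_smul (ħ : ℤ) (f : Series₂ A) (r s : ℕ) :
    coeff₂ r s ((ħ • prodXY A) • f) = ħ • coeff₂ r s (prodXY A • f) := by
  rw [smul_assoc, map_zsmul]

theorem RTT.coeff_rel {ħ : ℤ} {M : Matrix ι ι (PowerSeries A)} (H : RTT ħ M) (i j h l : ι) (r s : ℕ) :
    ⁅PowerSeries.coeff (r + 1) (M i j), PowerSeries.coeff s (M h l)⁆ - ⁅PowerSeries.coeff r (M i j), PowerSeries.coeff (s + 1) (M h l)⁆ =
      ħ • (PowerSeries.coeff r (M h j) * PowerSeries.coeff s (M i l) - PowerSeries.coeff s (M h j) * PowerSeries.coeff r (M i l)) := by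
  have := congrArg (coeff₂ (r + 1) (s + 1)) (H i j h l)
  rw [coeff₂_diffYX_smul_succ_succ, coeff₂_zsmul_prodXY_smul, coeff₂_prodXY_smul_succ_succ] at this
  simpa only [Matrix.map_apply, map_sub, coeff₂_inX_mul_inY, coeff₂_inY_mul_inX,
    Ring.lie_def] using this

theorem RTT.of_coeff {ħ : ℤ} {M : Matrix ι ι (PowerSeries A)}
    (h0 : ∀ i j h l s, ⁅PowerSeries.coeff 0 (M i j), PowerSeries.coeff s (M h l)⁆ = 0)
    (H : ∀ i j h l r s,
      ⁅PowerSeries.coeff (r + 1) (M i j), PowerSeries.coeff s (M h l)⁆ - ⁅PowerSeries.coeff r (M i j), PowerSeries.coeff (s + 1) (M h l)⁆ =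
      ħ • (PowerSeries.coeff r (M h j) * PowerSeries.coeff s (M i l) - PowerSeries.coeff s (M h j) * PowerSeries.coeff r (M i l))) : RTT ħ M := by
  intro i j h l
  refine ext₂ fun r s => ?_
  rw [coeff₂_zsmul_prodXY_smul]
  rcases r with _ | r <;> rcases s with _ | s
  · rw [coeff₂_diffYX_smul_zero_zero, coeff₂_prodXY_smul_zero_left, smul_zero]
  · rw [coeff₂_diffYX_smul_zero_succ, coeff₂_prodXY_smul_zero_left, smul_zero]
    simpa only [Matrix.map_apply, map_sub, coeff₂_inX_mul_inY, coeff₂_inY_mul_inX,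
      Ring.lie_def] using h0 i j h l s
  · rw [coeff₂_diffYX_smul_succ_zero, coeff₂_prodXY_smul_zero_right, smul_zero, neg_eq_zero]
    have := h0 h l i j r
    rw [Ring.lie_def] at this
    rw [← neg_eq_zero, ← map_neg, neg_sub]
    simpa only [Matrix.map_apply, map_sub, coeff₂_inX_mul_inY, coeff₂_inY_mul_inX] using this
  · rw [coeff₂_diffYX_smul_succ_succ, coeff₂_prodXY_smul_succ_succ]
    simpa only [Matrix.map_apply, map_sub, coeff₂_inX_mul_inY, coeff₂_inY_mul_inX,
      Ring.lie_def] using H i j h l r s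

variable [Fintype ι]

theorem map_mul_eq_one [DecidableEq ι] {R S : Type*} [Ring R] [Ring S] (f : R →+* S) {P Q : Matrix ι ι R}
    (h : P * Q = 1) : P.map f * Q.map f = 1 := by
  rw [← Matrix.map_mul, h]
  exact Matrix.map_one f (map_zero f) (map_one f)

/-- `Exchange.inv` yields the index pairs `(i, l)` and `(h, j)` in the opposite order; restoring the
order of the RTT relation costs the sign. -/
theorem RTT.inv [DecidableEq ι] {ħ : ℤ} {M N : Matrix ι ι (PowerSeries A)} (H : RTT ħ M) (hMN : M * N = 1)
    (hNM : N * M = 1) : RTT (-ħ) N := by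
  have a1 := map_mul_eq_one inX hMN
  have a2 := map_mul_eq_one inX hNM
  have a3 := map_mul_eq_one inY hMN
  have a4 := map_mul_eq_one inY hNM
  have H0 := Exchange.inv a1 a2 a3 a4 H
  -- Exchanging `(i, j, x)` with `(h, l, y)` negates both the commutator and `y - x`, so the
  -- left-hand side of `H0` is symmetric; hence so is its right-hand side.
  have key : ∀ i j h l, (ħ • prodXY A) • (inX (N i l) * inY (N h j) - inY (N i l) * inX (N h j)) =
      -((ħ • prodXY A) • (inX (N h j) * inY (N i l) - inY (N h j) * inX (N i l))) := by
    intro i j h l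
    refine ext₂ fun r s => ?_
    rw [map_neg]
    simp only [coeff₂_zsmul_prodXY_smul]
    rcases r with _ | r <;> rcases s with _ | s
    · simp only [coeff₂_prodXY_smul_zero_left, smul_zero, neg_zero]
    · simp only [coeff₂_prodXY_smul_zero_left, smul_zero, neg_zero]
    · simp only [coeff₂_prodXY_smul_zero_right, smul_zero, neg_zero]
    · have b1 := congrArg (coeff₂ (r + 1) (s + 1)) (H0 i j h l)
      have b2 := congrArg (coeff₂ (s + 1) (r + 1)) (H0 h l i j)
      simp only [coeff₂_zsmul_prodXY_smul, coeff₂_prodXY_smul_succ_succ,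
        coeff₂_diffYX_smul_succ_succ, Matrix.map_apply, map_sub, coeff₂_inX_mul_inY,
        coeff₂_inY_mul_inX] at b1 b2 ⊢
      rw [← b1, ← smul_neg, neg_sub, ← b2]
      abel
  intro i j h l
  have := H0 i j h l
  simp only [Matrix.map_apply] at this ⊢
  rw [this, key, neg_smul, neg_smul]

/-- Both Kronecker symbols in `Exchange.comm_inv` vanish, and `y - x` can be cancelled. -/
theorem RTT.comm_inv [DecidableEq ι] {ħ : ℤ} {M N : Matrix ι ι (PowerSeries A)} (H : RTT ħ M) (hMN : M * N = 1)
    (hNM : N * M = 1) {i j h l : ι} (hj : h ≠ j) (hl : i ≠ l) :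
    Commute (inX (M i j)) (inY (N h l)) := by
  have H' : Exchange (diffYX A) (ħ • prodXY A) (M.map inX) (M.map inY) := H
  have a := map_mul_eq_one inY hMN
  have b := map_mul_eq_one inY hNM
  have := H'.comm_inv a b i j h l
  rw [Matrix.one_apply_ne hj, Matrix.one_apply_ne hl, zero_mul, mul_zero, sub_zero] at this
  have e : diffYX A • (inX (M i j) * inY (N h l)) = diffYX A • (inY (N h l) * inX (M i j)) := by
    rw [smul_zero, smul_sub] at this
    exact sub_eq_zero.mp this
  exact eq_of_diffYX_smul_eq e

/-- This is the comultiplication of the Yangian in matrix form; it is what allows evaluation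
matrices to be multiplied. -/
theorem RTT.mul {ħ : ℤ} {M N : Matrix ι ι (PowerSeries A)} (hM : RTT ħ M) (hN : RTT ħ N)
    (hc : ∀ i j h l r s, Commute (PowerSeries.coeff r (M i j)) (PowerSeries.coeff s (N h l))) : RTT ħ (M * N) := by
  have e : ∀ i j h l, Commute (inX (M i j)) (inY (N h l)) := fun i j h l => ext₂ fun r s => by
    rw [coeff₂_inX_mul_inY, coeff₂_inY_mul_inX, (hc i j h l r s).eq]
  have e' : ∀ i j h l, Commute (inY (M i j)) (inX (N h l)) := fun i j h l => ext₂ fun r s => by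
    rw [coeff₂_inX_mul_inY, coeff₂_inY_mul_inX, (hc i j h l s r).eq]
  unfold RTT
  rw [Matrix.map_mul, Matrix.map_mul]
  exact Exchange.mul hM hN e e'

end TwoVariables
end Yang
end

noncomputable section

namespace Yang

/-! ### Coefficients of matrices of power series -/

section MatrixSeries

variable {ι A : Type*} [Ring A]

theorem matCoeff_mul [Fintype ι] (M N : Matrix ι ι (PowerSeries A)) (r : ℕ) :
    matCoeff (M * N) r =
      ∑ p ∈ Finset.HasAntidiagonal.antidiagonal r, matCoeff M p.1 * matCoeff N p.2 := by
  classical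
  have := congrArg (PowerSeries.coeff r) (mk_matCoeff_mul M N)
  simpa [PowerSeries.coeff_mul] using this

theorem ext_matCoeff {M N : Matrix ι ι (PowerSeries A)} (h : ∀ r, matCoeff M r = matCoeff N r) :
    M = N := by
  ext i j r
  exact congrFun (congrFun (h r) i) j

theorem matCoeff_one [DecidableEq ι] (r : ℕ) :
    matCoeff (1 : Matrix ι ι (PowerSeries A)) r = if r = 0 then 1 else 0 := by
  ext i j
  rcases eq_or_ne r 0 with rfl | hr <;> by_cases h : i = j
  · subst h; simp [matCoeff]
  · simp [matCoeff, h]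
  · subst h; simp [matCoeff, PowerSeries.coeff_one, hr]
  · simp [matCoeff, h, hr]

/-- A matrix of power series is a power series of matrices, here with invertible constant term. -/
theorem exists_inverse [Fintype ι] [DecidableEq ι] (M : Matrix ι ι (PowerSeries A)) (h0 : matCoeff M 0 = 1) :
    ∃ N : Matrix ι ι (PowerSeries A), M * N = 1 ∧ N * M = 1 := by
  set φ : PowerSeries (Matrix ι ι A) := PowerSeries.mk (matCoeff M)
  have hφ : PowerSeries.constantCoeff φ = ((1 : (Matrix ι ι A)ˣ) : Matrix ι ι A) := by
    simp [φ, h0]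
  set ψ := φ.invOfUnit 1
  set N : Matrix ι ι (PowerSeries A) :=
    Matrix.of fun i j => PowerSeries.mk fun r => PowerSeries.coeff r ψ i j with hN
  have hψ : PowerSeries.mk (matCoeff N) = ψ := by
    ext r i j
    simp [hN, matCoeff]
  have one : PowerSeries.mk (matCoeff (1 : Matrix ι ι (PowerSeries A))) = 1 := by
    ext r : 1
    simp [matCoeff_one, PowerSeries.coeff_one]
  have inj : ∀ P Q : Matrix ι ι (PowerSeries A), PowerSeries.mk (matCoeff P) =
      PowerSeries.mk (matCoeff Q) → P = Q := fun P Q h => ext_matCoeff fun r => by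
    simpa using congrArg (PowerSeries.coeff r) h
  refine ⟨N, inj _ _ ?_, inj _ _ ?_⟩
  · rw [mk_matCoeff_mul, hψ, one]
    exact PowerSeries.mul_invOfUnit _ _ hφ
  · rw [mk_matCoeff_mul, hψ, one]
    exact PowerSeries.invOfUnit_mul _ _ hφ

/-- The coefficients of an inverse stay in a multiplicative family containing the coefficients. -/
theorem matCoeff_inverse_mem [Fintype ι] [DecidableEq ι] (S : ℕ → AddSubgroup (Matrix ι ι A))
    (one : 1 ∈ S 0) (mul : ∀ p q a b, a ∈ S p → b ∈ S q → a * b ∈ S (p + q))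
    {M N : Matrix ι ι (PowerSeries A)} (h0 : matCoeff M 0 = 1) (hM : ∀ r, matCoeff M r ∈ S r)
    (hMN : M * N = 1) (r : ℕ) : matCoeff N r ∈ S r := by
  induction r using Nat.strong_induction_on with
  | _ r ih =>
    have h := congrArg (fun K => matCoeff K r) hMN
    simp only [matCoeff_mul, matCoeff_one] at h
    rcases r with _ | r
    · simp [h0] at h
      rwa [h]
    -- The summand with `M` in degree `0` is the coefficient of `N` sought; the others involve
    -- earlier coefficients of `N`.
    · rw [Finset.Nat.antidiagonal_succ, Finset.sum_cons, h0, one_mul, if_neg (Nat.succ_ne_zero r),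
        ← eq_neg_iff_add_eq_zero] at h
      dsimp only at h
      rw [h]
      refine neg_mem (sum_mem fun p hp => ?_)
      obtain ⟨q, hq, rfl⟩ := Finset.mem_map.mp hp
      have hq' := Finset.HasAntidiagonal.mem_antidiagonal.mp hq
      have := mul _ _ _ _ (hM (q.1 + 1)) (ih q.2 (by omega))
      have e : q.1 + 1 + q.2 = r + 1 := by omega
      rw [e] at this
      simpa using this

theorem sum_eq_sum_subtype [Fintype ι] {M : Type*} [AddCommMonoid M] (p : ι → Prop) [DecidablePred p]
    {f : ι → M} (h : ∀ i, ¬p i → f i = 0) : ∑ i, f i = ∑ i : {i // p i}, f i := by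
  rw [← Finset.sum_subtype (Finset.univ.filter p) (by simp) f, Finset.sum_filter]
  exact Finset.sum_congr rfl fun i _ => by split_ifs with hi <;> simp_all

end MatrixSeries

/-! ### Corners of the inverse of a matrix with a Gauss factorization -/

section GaussInverse

variable {ι β A : Type*} [Fintype ι] [DecidableEq ι] [LinearOrder β] [Ring A]
  {b : ι → β} {M F D E N : Matrix ι ι (PowerSeries A)}

namespace IsBlockGauss

theorem lower_mul_diag (hG : IsBlockGauss b M F D E) {i j : ι} (h : b i < b j) :
    (F * D) i j = 0 := by
  rw [Matrix.mul_apply]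
  refine Finset.sum_eq_zero fun s _ => ?_
  by_cases hs : b s = b j
  · have his : i ≠ s := fun e => h.ne (e ▸ hs)
    rw [hG.lower i s (hs ▸ h.le), if_neg his, zero_mul]
  · rw [hG.diag s j hs, mul_zero]

theorem lower_mul_diag_self (hG : IsBlockGauss b M F D E) {i j : ι} (h : b i ≤ b j) :
    (F * D) i j = D i j := by
  rw [Matrix.mul_apply, Finset.sum_eq_single i]
  · rw [hG.lower i i le_rfl, if_pos rfl, one_mul]
  · intro s _ hs
    by_cases hsj : b s = b j
    · rw [hG.lower i s (hsj ▸ h), if_neg hs.symm, zero_mul]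
    · rw [hG.diag s j hsj, mul_zero]
  · simp

theorem matCoeff_lower_mul_diag (hG : IsBlockGauss b M F D E) (h0 : matCoeff M 0 = 1) :
    matCoeff (F * D) 0 = 1 := by
  obtain ⟨hF, hD, -⟩ := hG.coeff_zero h0
  simp [matCoeff_mul, hF, hD]

/-- From `(F D)(E N) = M N = 1`, the right inverse `E N` must be the two-sided inverse of `F D`. -/
theorem upper_mul_inverse (hG : IsBlockGauss b M F D E) (h0 : matCoeff M 0 = 1) (hMN : M * N = 1) :
    (F * D) * (E * N) = 1 ∧ (E * N) * (F * D) = 1 := by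
  obtain ⟨Q, hQ, hQ'⟩ := exists_inverse (F * D) (hG.matCoeff_lower_mul_diag h0)
  have h1 : (F * D) * (E * N) = 1 := by rw [← mul_assoc, ← hG.factor, hMN]
  have : E * N = Q := by
    rw [← one_mul (E * N), ← hQ', mul_assoc, h1, mul_one]
  exact ⟨h1, this ▸ hQ'⟩

/-- Block lower triangular matrices are closed under products and contain `1`, so, as a family
constant in the degree, they contain the coefficients of the inverse of `F * D`. -/
theorem upper_mul_inverse_apply (hG : IsBlockGauss b M F D E) (h0 : matCoeff M 0 = 1)
    (hMN : M * N = 1) {i j : ι} (h : b i < b j) : (E * N) i j = 0 := by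
  let S : ℕ → AddSubgroup (Matrix ι ι A) := fun _ =>
    { carrier := {K | ∀ i j, b i < b j → K i j = 0}
      add_mem' := fun hx hy i j hij => by rw [Matrix.add_apply, hx i j hij, hy i j hij, add_zero]
      zero_mem' := fun _ _ _ => rfl
      neg_mem' := fun hx i j hij => by rw [Matrix.neg_apply, hx i j hij, neg_zero] }
  have key := matCoeff_inverse_mem S
    (fun i j hij => Matrix.one_apply_ne fun e => hij.ne (e ▸ rfl))
    (fun p q x y hx hy i j hij => by
      rw [Matrix.mul_apply]
      refine Finset.sum_eq_zero fun s _ => ?_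
      rcases lt_or_ge (b i) (b s) with hs | hs
      · rw [hx i s hs, zero_mul]
      · rw [hy s j (hs.trans_lt hij), mul_zero])
    (hG.matCoeff_lower_mul_diag h0)
    (fun r i j hij => by
      change PowerSeries.coeff r ((F * D) i j) = 0
      rw [hG.lower_mul_diag hij, map_zero])
    (hG.upper_mul_inverse h0 hMN).1
  ext r
  exact key r i j h

/-- In what follows `N * (F * D)` plays the part of `E⁻¹`. -/
theorem upper_inverse (hG : IsBlockGauss b M F D E) (h0 : matCoeff M 0 = 1) (hMN : M * N = 1)
    (hNM : N * M = 1) : E * (N * (F * D)) = 1 ∧ (N * (F * D)) * E = 1 := by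
  refine ⟨by rw [← mul_assoc, (hG.upper_mul_inverse h0 hMN).2], ?_⟩
  rw [mul_assoc, ← hG.factor, hNM]

theorem upper_inverse_apply (hG : IsBlockGauss b M F D E) (h0 : matCoeff M 0 = 1) (hMN : M * N = 1)
    (hNM : N * M = 1) {i j : ι} (h : b j < b i) : (N * (F * D)) i j = 0 := by
  let S : ℕ → AddSubgroup (Matrix ι ι A) := fun _ =>
    { carrier := {K | ∀ i j, b j < b i → K i j = 0}
      add_mem' := fun hx hy i j hij => by rw [Matrix.add_apply, hx i j hij, hy i j hij, add_zero]
      zero_mem' := fun _ _ _ => rfl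
      neg_mem' := fun hx i j hij => by rw [Matrix.neg_apply, hx i j hij, neg_zero] }
  have key := matCoeff_inverse_mem S
    (fun i j hij => Matrix.one_apply_ne fun e => hij.ne (e ▸ rfl))
    (fun p q x y hx hy i j hij => by
      rw [Matrix.mul_apply]
      refine Finset.sum_eq_zero fun s _ => ?_
      rcases lt_or_ge (b s) (b i) with hs | hs
      · rw [hx i s hs, zero_mul]
      · rw [hy s j (hij.trans_le hs), mul_zero])
    (hG.coeff_zero h0).2.2
    (fun r i j hij => by
      change PowerSeries.coeff r (E i j) = 0
      have hne : i ≠ j := fun e => hij.ne (e ▸ rfl)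
      rw [hG.upper i j hij.le, if_neg hne, map_zero])
    (hG.upper_inverse h0 hMN hNM).1
  ext r
  exact key r i j h

end IsBlockGauss

/-- For an upper set `p` of blocks, the inverse of the corner of `M⁻¹` cut out by `p`. -/
def cornerInv (p : ι → Prop) [DecidablePred p] (F D E : Matrix ι ι (PowerSeries A)) (l q : ι) :
    PowerSeries A := ∑ t : {t // p t}, (F * D) l t * E t q

namespace IsBlockGauss

/-- A column of `F * D` with index in an upper set is supported on that set, so the sum over the
corner is a full matrix product. -/
theorem sum_inverse_mul_cornerInv (hG : IsBlockGauss b M F D E) (p : ι → Prop) [DecidablePred p]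
    (hp : ∀ i j, b i ≤ b j → p i → p j) (i q : ι) :
    ∑ l : {l // p l}, N i l * cornerInv p F D E l q =
      ∑ t : {t // p t}, (N * (F * D)) i t * E t q := by
  simp only [cornerInv, Finset.mul_sum]
  rw [Finset.sum_comm]
  refine Finset.sum_congr rfl fun t _ => ?_
  rw [Matrix.mul_apply, sum_eq_sum_subtype p, Finset.sum_mul]
  · exact Finset.sum_congr rfl fun l _ => (mul_assoc _ _ _).symm
  intro l hl
  rw [hG.lower_mul_diag, mul_zero]
  by_contra hlt
  exact hl (hp _ _ (not_lt.mp hlt) t.2)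

/-- A row of `E⁻¹` with index in the upper set is supported there, so the remaining sum is an entry
of `E⁻¹ E`. -/
theorem sum_corner_mul_cornerInv (hG : IsBlockGauss b M F D E) (h0 : matCoeff M 0 = 1)
    (hMN : M * N = 1) (hNM : N * M = 1) (p : ι → Prop) [DecidablePred p]
    (hp : ∀ i j, b i ≤ b j → p i → p j) (s q : {l // p l}) :
    ∑ l : {l // p l}, N s l * cornerInv p F D E l q = if s = q then 1 else 0 := by
  rw [hG.sum_inverse_mul_cornerInv p hp]
  have : ∑ t : {t // p t}, (N * (F * D)) s t * E t q = ((N * (F * D)) * E) s q := by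
    rw [Matrix.mul_apply, sum_eq_sum_subtype p]
    intro t ht
    rw [hG.upper_inverse_apply h0 hMN hNM, zero_mul]
    by_contra hlt
    exact ht (hp _ _ (not_lt.mp hlt) s.2)
  rw [this, (hG.upper_inverse h0 hMN hNM).2, Matrix.one_apply]
  simp only [Subtype.ext_iff]

/-- The entry `(h, l)` of the lower triangular matrix `E * N` is zero, while the row `h` of `E`
consists of a `1` at `h` and entries in later blocks. -/
theorem inverse_row (hG : IsBlockGauss b M F D E) (h0 : matCoeff M 0 = 1) (hMN : M * N = 1)
    (h : ι) (l : {l // b h < b l}) :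
    N h l = -∑ s : {s // b h < b s}, E h s * N s l := by
  have key := hG.upper_mul_inverse_apply h0 hMN l.2
  rw [Matrix.mul_apply] at key
  have e : ∀ s, E h s * N s l = (if h = s then N h l else 0) +
      if b h < b s then E h s * N s l else 0 := by
    intro s
    by_cases hs : b h < b s
    · have : h ≠ s := fun e => hs.ne (e ▸ rfl)
      simp [hs, this]
    · rw [hG.upper h s (not_lt.mp hs)]
      by_cases e : h = s
      · subst e; simp
      · simp [e, hs]
  rw [Finset.sum_congr rfl fun s _ => e s, Finset.sum_add_distrib, Finset.sum_ite_eq,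
    if_pos (Finset.mem_univ _)] at key
  rw [eq_neg_of_add_eq_zero_left key, sum_eq_sum_subtype (fun s => b h < b s)]
  · congr 1
    exact Finset.sum_congr rfl fun s _ => if_pos s.2
  · intro s hs
    exact if_neg hs

end IsBlockGauss

end GaussInverse

end Yang
end

noncomputable section

namespace Yang

/-! ### Commutation relations for the upper unitriangular factor. -/

section UpperRelations

variable {ι β A : Type*} [Fintype ι] [DecidableEq ι] [LinearOrder β] [Ring A]
  {b : ι → β} {M F D E N : Matrix ι ι (PowerSeries A)}

theorem RTT.neg_one_rel {ι : Type*} {N : Matrix ι ι (PowerSeries A)} (H : RTT (-1) N) (i j h l : ι) :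
    diffYX A • (inX (N i j) * inY (N h l) - inY (N h l) * inX (N i j)) =
      -(prodXY A • (inX (N h j) * inY (N i l) - inY (N h j) * inX (N i l))) := by
  have := H i j h l
  rw [neg_smul, one_smul, neg_smul] at this
  exact this

namespace IsBlockGauss

theorem sum_map_corner_mul_cornerInv (hG : IsBlockGauss b M F D E) (h0 : matCoeff M 0 = 1)
    (hMN : M * N = 1) (hNM : N * M = 1) (a : β) {S : Type*} [Ring S] (f : PowerSeries A →+* S)
    (s q : {l // a < b l}) :
    ∑ l : {l // a < b l}, f (N s l) * f (cornerInv (fun i => a < b i) F D E l q) =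
      if s = q then 1 else 0 := by
  simp only [← map_mul, ← map_sum]
  rw [hG.sum_corner_mul_cornerInv h0 hMN hNM (fun i => a < b i) fun i j hij hi => hi.trans_le hij]
  split_ifs <;> simp

theorem map_inverse_row (hG : IsBlockGauss b M F D E) (h0 : matCoeff M 0 = 1) (hMN : M * N = 1)
    {S : Type*} [Ring S] (f : PowerSeries A →+* S) {a : β} (h : ι) (ha : b h = a)
    (l : {l // a < b l}) :
    f (N h l) = -∑ s : {s // a < b s}, f (E h s) * f (N s l) := by
  subst ha
  rw [hG.inverse_row h0 hMN, map_neg, map_sum]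
  simp only [map_mul]

/-- Relations between two rows of `E` in the same block. -/
theorem upper_rel_same (hG : IsBlockGauss b M F D E) (h0 : matCoeff M 0 = 1) (hMN : M * N = 1)
    (hNM : N * M = 1) (hN : RTT (-1) N) {i h p q : ι} (hi : b i = b h) (hp : b h < b p)
    (hq : b h < b q) :
    diffYX A • diffYX A • (inX (E i q) * inY (E h p) - inY (E h p) * inX (E i q)) =
      prodXY A • (diffYX A • (inX (E i p) * (inX (E h q) - inY (E h q)) -
          (inX (E h q) - inY (E h q)) * inY (E i p)) +
        prodXY A • ((inX (E h p) - inY (E h p)) * (inX (E i q) - inY (E i q)))) :=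
  comm_row_same (k := Subring.center (Series₂ A)) (J := {s // b h < b s}) Subtype.val
    (n := fun i l => inX (N i l)) (n' := fun i l => inY (N i l))
    (fun i h j l => hN.neg_one_rel i j h l)
    (ε := fun s => inX (E h s)) (ε' := fun s => inY (E h s))
    (η := fun s => inX (E i s)) (η' := fun s => inY (E i s))
    (hG.map_inverse_row h0 hMN inX h rfl) (hG.map_inverse_row h0 hMN inY h rfl)
    (hG.map_inverse_row h0 hMN inX i hi) (hG.map_inverse_row h0 hMN inY i hi)
    (hG.sum_map_corner_mul_cornerInv h0 hMN hNM (b h) inX)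
    (hG.sum_map_corner_mul_cornerInv h0 hMN hNM (b h) inY) ⟨q, hq⟩ ⟨p, hp⟩

/-- Relations between a row of `E` and a row in a later block. -/
theorem upper_rel_of_lt (hG : IsBlockGauss b M F D E) (h0 : matCoeff M 0 = 1) (hMN : M * N = 1)
    (hNM : N * M = 1) (hN : RTT (-1) N) {i h p q : ι} (hi : b h < b i) (hp : b h < b p)
    (hq : b i < b q) :
    diffYX A • (inX (E i q) * inY (E h p) - inY (E h p) * inX (E i q)) =
      prodXY A • (inX (E i p) * ∑ t : {t // b h < b t}, (inX (E h t) - inY (E h t)) *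
        inX (∑ s : {s // b i < b s}, (N * (F * D)) t s * E s q)) := by
  have key := comm_row_of_lt (k := Subring.center (Series₂ A)) (J := {s // b h < b s})
    (J' := {s // b i < b s}) Subtype.val
    (fun s => ⟨s, hi.trans s.2⟩) (n := fun i l => inX (N i l))
    (Y := fun j => ∑ t : {t // b h < b t}, (inX (E h t) - inY (E h t)) * inX (N t j))
    (ε' := fun s => inY (E h s)) (z := diffYX A) (w := prodXY A)
    (fun s j p => by
      have := comm_row (k := Subring.center (Series₂ A)) (J := {s // b h < b s}) Subtype.val
        (n := fun i l => inX (N i l)) (n' := fun i l => inY (N i l))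
        (fun i h j l => hN.neg_one_rel i j h l)
        (ε := fun s => inX (E h s)) (ε' := fun s => inY (E h s))
        (hG.map_inverse_row h0 hMN inX h rfl) (hG.map_inverse_row h0 hMN inY h rfl)
        (hG.sum_map_corner_mul_cornerInv h0 hMN hNM (b h) inY) s j p
      rw [hG.sum_map_corner_mul_cornerInv h0 hMN hNM (b h) inY] at this
      exact this)
    (e := fun s => inX (E i s)) (i := ⟨i, hi⟩)
    (hG.map_inverse_row h0 hMN inX i rfl)
    (hG.sum_map_corner_mul_cornerInv h0 hMN hNM (b i) inX) ⟨q, hq⟩ ⟨p, hp⟩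
  rw [key]
  congr 2
  -- The first Kronecker term accounts for `p = i`, the sum for `p` in a block after that of `i`; in
  -- all other cases both sides are zero.
  · simp only [Subtype.mk.injEq]
    by_cases hpi : b i < b p
    · have hne : i ≠ p := fun e => hpi.ne (e ▸ rfl)
      rw [if_neg hne, zero_add, Finset.sum_eq_single ⟨p, hpi⟩]
      · simp
      · intro s _ hs
        rw [if_neg fun e => hs (Subtype.ext e)]
      · simp
    · rw [hG.upper i p (not_lt.mp hpi), Finset.sum_eq_zero, add_zero]
      · split_ifs <;> simp
      · intro s _
        rw [if_neg]
        rintro rfl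
        exact hpi s.2
  · simp only [Finset.sum_mul]
    rw [Finset.sum_comm]
    refine Finset.sum_congr rfl fun t _ => ?_
    -- Multiplying the entries of `N` by the inverse of its corner leaves a partial sum of `E⁻¹ E`,
    -- in which `N` no longer occurs on its own.
    rw [← hG.sum_inverse_mul_cornerInv (fun s => b i < b s) (fun i j hij hi => hi.trans_le hij),
      map_sum, Finset.mul_sum]
    simp only [map_mul, mul_assoc]

end IsBlockGauss

end UpperRelations

/-! ### Filtrations -/

section Filtration

variable {A : Type*} [Ring A]

/-- An increasing multiplicative filtration; `P m` consists of the elements of degree `< m`. -/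
structure IsFiltration (P : ℕ → AddSubgroup A) : Prop where
  one_mem : 1 ∈ P 1
  mul_mem : ∀ m n x y, x ∈ P (m + 1) → y ∈ P (n + 1) → x * y ∈ P (m + n + 1)
  le_succ : ∀ m, P m ≤ P (m + 1)

namespace IsFiltration

variable {P : ℕ → AddSubgroup A}

theorem mono (hP : IsFiltration P) {m n : ℕ} (h : m ≤ n) : P m ≤ P n := monotone_nat_of_le_succ hP.le_succ h

theorem coeff₂_mem_mul (hP : IsFiltration P) {f g : Series₂ A} (hf : ∀ r s, coeff₂ r s f ∈ P (r + s + 1))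
    (hg : ∀ r s, coeff₂ r s g ∈ P (r + s + 1)) (r s : ℕ) : coeff₂ r s (f * g) ∈ P (r + s + 1) := by
  rw [coeff₂_mul]
  refine sum_mem fun p hp => sum_mem fun q hq => ?_
  have hp' := Finset.HasAntidiagonal.mem_antidiagonal.mp hp
  have hq' := Finset.HasAntidiagonal.mem_antidiagonal.mp hq
  have := hP.mul_mem _ _ _ _ (hf p.1 q.1) (hg p.2 q.2)
  have e : p.1 + q.1 + (p.2 + q.2) + 1 = r + s + 1 := by omega
  rwa [e] at this

theorem one_mem_succ (hP : IsFiltration P) (m : ℕ) : (1 : A) ∈ P (m + 1) := hP.mono (by omega) hP.one_mem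

theorem coeff₂_inX_mem (hP : IsFiltration P) {f : PowerSeries A} (hf : ∀ r, PowerSeries.coeff r f ∈ P (r + 1)) (r s : ℕ) :
    coeff₂ r s (inX f) ∈ P (r + s + 1) := by
  have e : inX f = inX f * inY 1 := by rw [map_one, mul_one]
  rw [e, coeff₂_inX_mul_inY, PowerSeries.coeff_one]
  split_ifs
  · rw [mul_one]; exact hP.mono (by omega) (hf r)
  · rw [mul_zero]; exact zero_mem _

theorem coeff₂_inY_mem (hP : IsFiltration P) {f : PowerSeries A} (hf : ∀ r, PowerSeries.coeff r f ∈ P (r + 1)) (r s : ℕ) :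
    coeff₂ r s (inY f) ∈ P (r + s + 1) := by
  have e : inY f = inX 1 * inY f := by rw [map_one, one_mul]
  rw [e, coeff₂_inX_mul_inY, PowerSeries.coeff_one]
  split_ifs
  · rw [one_mul]; exact hP.mono (by omega) (hf s)
  · rw [zero_mul]; exact zero_mem _

/-- Series whose coefficients lie in the filtration. -/
def seriesSubring (hP : IsFiltration P) : Subring (Series₂ A) where
  carrier := {f | ∀ r s, coeff₂ r s f ∈ P (r + s + 1)}
  mul_mem' := hP.coeff₂_mem_mul
  one_mem' := by
    have := hP.coeff₂_inX_mem (f := 1) (fun r => by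
      rw [PowerSeries.coeff_one]
      split_ifs
      · exact hP.one_mem_succ r
      · exact zero_mem _)
    rwa [map_one] at this
  add_mem' := fun hf hg r s => by rw [map_add]; exact add_mem (hf r s) (hg r s)
  zero_mem' := fun r s => by rw [map_zero]; exact zero_mem _
  neg_mem' := fun hf r s => by rw [map_neg]; exact neg_mem (hf r s)

theorem coeff₂_prodXY_smul_mem (hP : IsFiltration P) {k : ℕ} {g : Series₂ A} (hg : ∀ r s, coeff₂ r s g ∈ P (r + s + 1 - k))
    (r s : ℕ) : coeff₂ r s (prodXY A • g) ∈ P (r + s - 1 - k) := by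
  rcases r with _ | r
  · rw [coeff₂_prodXY_smul_zero_left]; exact zero_mem _
  rcases s with _ | s
  · rw [coeff₂_prodXY_smul_zero_right]; exact zero_mem _
  rw [coeff₂_prodXY_smul_succ_succ]
  exact hP.mono (by omega) (hg r s)

/-- A coefficient of `f` is, up to sign, a sum of coefficients of `(y - x) f` of total degree one
higher. -/
theorem coeff₂_mem_of_diffYX_smul (hP : IsFiltration P) (k : ℕ) {f : Series₂ A}
    (h : ∀ r s, coeff₂ r s (diffYX A • f) ∈ P (r + s - 1 - k)) (r s : ℕ) :
    coeff₂ r s f ∈ P (r + s - k) := by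
  induction r generalizing s with
  | zero =>
    rw [← coeff₂_diffYX_smul_zero_succ]
    exact hP.mono (by omega) (h 0 (s + 1))
  | succ r ih =>
    have e : coeff₂ (r + 1) s f = coeff₂ (r + 1) (s + 1) (diffYX A • f) + coeff₂ r (s + 1) f := by
      rw [coeff₂_diffYX_smul_succ_succ, sub_add_cancel]
    rw [e]
    exact add_mem (hP.mono (by omega) (h _ _)) (hP.mono (by omega) (ih (s + 1)))

/-- The factor `xy` shifts degrees by two and division by `y - x` shifts them back by one. The net
gain of one is the drop in weight of a commutator. -/
theorem coeff₂_mem_of_diffYX_smul_eq (hP : IsFiltration P) {f g : Series₂ A} (h : diffYX A • f = prodXY A • g)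
    (hg : g ∈ hP.seriesSubring) (r s : ℕ) : coeff₂ r s f ∈ P (r + s) :=
  hP.coeff₂_mem_of_diffYX_smul 0
    (fun r s => by rw [h]; exact hP.coeff₂_prodXY_smul_mem (k := 0) hg r s) r s

/-- Once `xy g₁` is subtracted from `(y - x) f`, a first division by `y - x` bounds the difference;
adding `xy g₁` back permits the second division. -/
theorem coeff₂_mem_of_diffYX_smul_smul_eq (hP : IsFiltration P) {f g₁ g₂ : Series₂ A}
    (h : diffYX A • diffYX A • f = prodXY A • (diffYX A • g₁ + prodXY A • g₂))
    (hg₁ : g₁ ∈ hP.seriesSubring) (hg₂ : g₂ ∈ hP.seriesSubring) (r s : ℕ) :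
    coeff₂ r s f ∈ P (r + s) := by
  have h1 : diffYX A • (diffYX A • f - prodXY A • g₁) = prodXY A • prodXY A • g₂ := by
    rw [smul_sub, h, smul_add, smul_comm (diffYX A) (prodXY A), add_sub_cancel_left]
  have h2 := hP.coeff₂_mem_of_diffYX_smul 2 (f := diffYX A • f - prodXY A • g₁) fun r s => by
    rw [h1]
    refine hP.coeff₂_prodXY_smul_mem (k := 2) (fun r s => ?_) r s
    exact hP.mono (by omega) (hP.coeff₂_prodXY_smul_mem (k := 0) hg₂ r s)
  refine hP.coeff₂_mem_of_diffYX_smul 0 (fun r s => ?_) r s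
  have e : diffYX A • f = (diffYX A • f - prodXY A • g₁) + prodXY A • g₁ := by
    rw [sub_add_cancel]
  rw [e, map_add]
  exact add_mem (hP.mono (by omega) (h2 r s)) (hP.coeff₂_prodXY_smul_mem (k := 0) hg₁ r s)

theorem coeff_sum_mem (hP : IsFiltration P) {ι : Type*} [Fintype ι] (f g : ι → PowerSeries A)
    (hf : ∀ i r, PowerSeries.coeff r (f i) ∈ P (r + 1))
    (hg : ∀ i r, PowerSeries.coeff r (g i) ∈ P (r + 1)) (r : ℕ) :
    PowerSeries.coeff r (∑ i, f i * g i) ∈ P (r + 1) := by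
  rw [map_sum]
  refine sum_mem fun i _ => ?_
  rw [PowerSeries.coeff_mul]
  refine sum_mem fun p hp => ?_
  have := hP.mul_mem _ _ _ _ (hf i p.1) (hg i p.2)
  rwa [Finset.HasAntidiagonal.mem_antidiagonal.mp hp] at this

variable {ι : Type*} [Fintype ι] [DecidableEq ι]

theorem coeff_inverse_mem (hP : IsFiltration P) {M N : Matrix ι ι (PowerSeries A)} (h0 : matCoeff M 0 = 1)
    (hM : ∀ r i j, PowerSeries.coeff r (M i j) ∈ P (r + 1)) (hMN : M * N = 1) (r : ℕ) (i j : ι) :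
    PowerSeries.coeff r (N i j) ∈ P (r + 1) := by
  let S : ℕ → AddSubgroup (Matrix ι ι A) := fun r =>
    { carrier := {K | ∀ i j, K i j ∈ P (r + 1)}
      add_mem' := fun hx hy i j => add_mem (hx i j) (hy i j)
      zero_mem' := fun _ _ => zero_mem _
      neg_mem' := fun hx i j => neg_mem (hx i j) }
  refine matCoeff_inverse_mem S (fun i j => ?_) (fun p q x y hx hy i j => ?_) h0 hM hMN r i j
  · by_cases h : i = j
    · subst h; rw [Matrix.one_apply_eq]; exact hP.one_mem
    · rw [Matrix.one_apply_ne h]; exact zero_mem _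
  · rw [Matrix.mul_apply]
    exact sum_mem fun s _ => hP.mul_mem _ _ _ _ (hx i s) (hy s j)

variable {β : Type*} [LinearOrder β] {b : ι → β} {M F D E N : Matrix ι ι (PowerSeries A)}

/-- Only the coefficients of `E` are required to lie in the filtration, since the relations involve
nothing but `E` and `E⁻¹`. This is what keeps straightening inside the subalgebra generated by the
`E`'s. -/
theorem comm_upper_mem (hP : IsFiltration P) (hG : IsBlockGauss b M F D E) (h0 : matCoeff M 0 = 1) (hM : RTT 1 M)
    (hE : ∀ r i j, PowerSeries.coeff r (E i j) ∈ P (r + 1)) {i j h l : ι} (hij : b i < b j)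
    (hhl : b h < b l) (r s : ℕ) :
    PowerSeries.coeff r (E i j) * PowerSeries.coeff s (E h l) -
      PowerSeries.coeff s (E h l) * PowerSeries.coeff r (E i j) ∈ P (r + s) := by
  obtain ⟨N, hMN, hNM⟩ := exists_inverse M h0
  have hN : RTT (-1) N := hM.inv hMN hNM
  have hX : ∀ i j, inX (E i j) ∈ hP.seriesSubring := fun i j => hP.coeff₂_inX_mem fun r => hE r i j
  have hY : ∀ i j, inY (E i j) ∈ hP.seriesSubring := fun i j => hP.coeff₂_inY_mem fun r => hE r i j
  have lt : ∀ {i j h l : ι}, b i < b j → b h < b l → b h < b i → ∀ r s,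
      PowerSeries.coeff r (E i j) * PowerSeries.coeff s (E h l) -
      PowerSeries.coeff s (E h l) * PowerSeries.coeff r (E i j) ∈ P (r + s) := by
    intro i j h l hij hhl hlt r s
    have := hP.coeff₂_mem_of_diffYX_smul_eq (hG.upper_rel_of_lt h0 hMN hNM hN hlt hhl hij) (by
      refine MulMemClass.mul_mem (hX _ _) (sum_mem fun t _ => MulMemClass.mul_mem (sub_mem (hX _ _) (hY _ _)) ?_)
      refine hP.coeff₂_inX_mem fun r => hP.coeff_sum_mem _ _ (fun s r => ?_) (fun s r => hE r _ _) r
      exact hP.coeff_inverse_mem (hG.coeff_zero h0).2.2 hE (hG.upper_inverse h0 hMN hNM).1 r _ _)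
      r s
    rwa [map_sub, coeff₂_inX_mul_inY, coeff₂_inY_mul_inX] at this
  rcases lt_trichotomy (b i) (b h) with hih | hih | hih
  · rw [← neg_sub, add_comm]
    exact neg_mem (lt hhl hij hih s r)
  · have := hP.coeff₂_mem_of_diffYX_smul_smul_eq
      (hG.upper_rel_same h0 hMN hNM hN hih hhl (hih ▸ hij))
      (sub_mem (MulMemClass.mul_mem (hX _ _) (sub_mem (hX _ _) (hY _ _)))
        (MulMemClass.mul_mem (sub_mem (hX _ _) (hY _ _)) (hY _ _)))
      (MulMemClass.mul_mem (sub_mem (hX _ _) (hY _ _)) (sub_mem (hX _ _) (hY _ _))) r s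
    rwa [map_sub, coeff₂_inX_mul_inY, coeff₂_inY_mul_inX] at this
  · exact lt hij hhl hih r s

end IsFiltration

end Filtration

/-! ### The commutator recursion for the entries of `E`. -/

section Recursion

variable {ι β A : Type*} [Fintype ι] [DecidableEq ι] [LinearOrder β] [Ring A]
  {b : ι → β} {M F D E : Matrix ι ι (PowerSeries A)}

theorem coeff₂_zero_left_mul (f g : Series₂ A) (s : ℕ) : coeff₂ 0 s (f * g) =
    PowerSeries.coeff s (PowerSeries.coeff 0 f * PowerSeries.coeff 0 g) := by
  simp [coeff₂_apply]

theorem coeff_zero_inX (f : PowerSeries A) :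
    PowerSeries.coeff 0 (inX f) = PowerSeries.C (PowerSeries.constantCoeff f) := by
  rw [inX, PowerSeries.coeff_map, PowerSeries.coeff_zero_eq_constantCoeff_apply]

/-- The entries of `E` in a row are iterated commutators. -/
theorem IsBlockGauss.upper_recursion (hG : IsBlockGauss b M F D E) (h0 : matCoeff M 0 = 1)
    (hM : RTT 1 M) {h i q : ι} (hi : b h < b i) (hq : b i < b q) (r : ℕ) :
    PowerSeries.coeff r (E h q) =
      ⁅PowerSeries.coeff r (E h i), PowerSeries.coeff 1 (E i q)⁆ := by
  obtain ⟨N, hMN, hNM⟩ := exists_inverse M h0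
  have hN : RTT (-1) N := hM.inv hMN hNM
  -- The coefficient of `x y^(r+1)` is taken with `p = i`, so that the prefactor `E i p` is `1`; `E
  -- i q` has no constant term, which leaves a single commutator on the left.
  have key := congrArg (coeff₂ 1 (r + 1)) (hG.upper_rel_of_lt h0 hMN hNM hN hi hi hq)
  rw [coeff₂_diffYX_smul_succ_succ, coeff₂_prodXY_smul_succ_succ, map_sub, map_sub,
    coeff₂_inX_mul_inY, coeff₂_inY_mul_inX, coeff₂_inX_mul_inY, coeff₂_inY_mul_inX,
    PowerSeries.coeff_zero_eq_constantCoeff_apply, hG.upper_const i q hq, zero_mul, mul_zero,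
    sub_zero, sub_zero, hG.upper i i le_rfl, if_pos rfl, map_one, one_mul, map_sum] at key
  have e0 : ∀ i j, PowerSeries.constantCoeff (E i j) = if i = j then 1 else 0 := fun i j => by
    have := congrFun (congrFun (hG.coeff_zero h0).2.2 i) j
    simpa [matCoeff, Matrix.one_apply] using this
  have u0 : ∀ i j, PowerSeries.constantCoeff ((N * (F * D)) i j) = if i = j then 1 else 0 := by
    intro i j
    have h1 := congrArg (fun K => matCoeff K 0) (hG.upper_inverse h0 hMN hNM).1
    simp only [matCoeff_one, if_true] at h1
    rw [matCoeff_mul, Finset.HasAntidiagonal.antidiagonal_zero, Finset.sum_singleton,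
      (hG.coeff_zero h0).2.2, one_mul] at h1
    have := congrFun (congrFun h1 i) j
    simpa [matCoeff, Matrix.one_apply] using this
  have e1 : ∀ t : {t // b h < b t}, coeff₂ 0 r ((inX (E h t) - inY (E h t)) *
      inX (∑ s : {s // b i < b s}, (N * (F * D)) t s * E s q)) =
      if t = ⟨q, hi.trans hq⟩ then -PowerSeries.coeff r (E h q) else 0 := by
    intro t
    -- At `x = 0` the difference becomes `-E h t (y)` and the factor from `E⁻¹ E` becomes a
    -- Kronecker symbol, so only `t = q` survives.
    have c1 : PowerSeries.coeff 0 (inX (E h t) - inY (E h t)) = -E h t := by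
      rw [map_sub, coeff_zero_inX, hG.upper_const h t t.2]
      simp [inY]
    have c2 : PowerSeries.coeff 0 (inX (∑ s : {s // b i < b s}, (N * (F * D)) t s * E s q)) =
        if t = ⟨q, hi.trans hq⟩ then 1 else 0 := by
      rw [coeff_zero_inX, map_sum]
      simp only [map_mul, u0, e0]
      rw [Finset.sum_eq_single ⟨q, hq⟩]
      · simp only [Subtype.ext_iff, if_true, mul_one]
        split_ifs <;> simp
      · intro s _ hs
        have : (s : ι) ≠ q := fun e => hs (Subtype.ext e)
        simp [this]
      · simp
    rw [coeff₂_zero_left_mul, c1, c2]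
    split_ifs with ht
    · subst ht; simp
    · simp
  rw [Finset.sum_congr rfl fun t _ => e1 t, Finset.sum_ite_eq', if_pos (Finset.mem_univ _)] at key
  rw [Ring.lie_def, ← neg_sub, key, neg_neg]

end Recursion

end Yang
end

noncomputable section

namespace Yang

/-! ### The coefficients of the Gauss factors -/

section GaussCoeff

variable {ι β A : Type*} [Fintype ι] [DecidableEq ι] [LinearOrder β] [Ring A]
  {b : ι → β} {M F D E : Matrix ι ι (PowerSeries A)}

/-- As all constant terms are `1`, the terms in which one factor carries the whole degree `r` add up
to the three coefficients; in the others every factor has degree below `r`. -/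
theorem coeff_add_sub_mul_mem {F D E : Matrix ι ι (PowerSeries A)} (f0 : matCoeff F 0 = 1)
    (d0 : matCoeff D 0 = 1) (e0 : matCoeff E 0 = 1) (Q : AddSubgroup A) {r : ℕ} (hr : 0 < r)
    (h : ∀ p q s, p < r → q < r → s < r → p + q + s = r → ∀ i k l j,
      PowerSeries.coeff p (F i k) * PowerSeries.coeff q (D k l) * PowerSeries.coeff s (E l j) ∈ Q)
    (i j : ι) : PowerSeries.coeff r (F i j) + PowerSeries.coeff r (D i j) +
      PowerSeries.coeff r (E i j) - PowerSeries.coeff r ((F * D * E) i j) ∈ Q := by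
  have key := coeff_mul3 (matCoeff F) (matCoeff D) (matCoeff E) f0 d0 e0 r hr
  rw [← mk_matCoeff_mul, ← mk_matCoeff_mul, PowerSeries.coeff_mk] at key
  have key' := congrFun (congrFun key i) j
  rw [Matrix.add_apply, Matrix.add_apply, Matrix.add_apply] at key'
  change PowerSeries.coeff r ((F * D * E) i j) = PowerSeries.coeff r (F i j) + PowerSeries.coeff r (D i j) +
    PowerSeries.coeff r (E i j) + _ at key'
  rw [key', sub_add_cancel_left]
  refine neg_mem ?_
  rw [PowerSeries.coeff_mul, Matrix.sum_apply]
  refine sum_mem fun x hx => ?_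
  rw [PowerSeries.coeff_mul, Finset.sum_mul, Matrix.sum_apply]
  refine sum_mem fun y hy => ?_
  have hx' := Finset.HasAntidiagonal.mem_antidiagonal.mp hx
  have hy' := Finset.HasAntidiagonal.mem_antidiagonal.mp hy
  simp only [PowerSeries.coeff_mk, truncBelow]
  split_ifs with h1 h2 h3
  · rw [Matrix.mul_apply]
    refine sum_mem fun l _ => ?_
    rw [Matrix.mul_apply, Finset.sum_mul]
    exact sum_mem fun k _ => h _ _ _ h1 h2 h3 (by omega) i k l j
  all_goals simp

namespace IsBlockGauss

theorem coeff_sub_mem (hG : IsBlockGauss b M F D E) (h0 : matCoeff M 0 = 1) (Q : AddSubgroup A)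
    {r : ℕ} (hr : 0 < r)
    (h : ∀ p q s, p < r → q < r → s < r → p + q + s = r → ∀ i k l j,
      PowerSeries.coeff p (F i k) * PowerSeries.coeff q (D k l) * PowerSeries.coeff s (E l j) ∈ Q)
    (i j : ι) : PowerSeries.coeff r (F i j) + PowerSeries.coeff r (D i j) +
      PowerSeries.coeff r (E i j) - PowerSeries.coeff r (M i j) ∈ Q := by
  obtain ⟨f0, d0, e0⟩ := hG.coeff_zero h0
  rw [hG.factor]
  exact coeff_add_sub_mul_mem f0 d0 e0 Q hr h i j

theorem coeff_lower_eq_zero (hG : IsBlockGauss b M F D E) {r : ℕ} (hr : 0 < r) {i j : ι}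
    (h : b i ≤ b j) : PowerSeries.coeff r (F i j) = 0 := by
  rw [hG.lower i j h]
  split_ifs <;> simp [PowerSeries.coeff_one, hr.ne']

theorem coeff_upper_eq_zero (hG : IsBlockGauss b M F D E) {r : ℕ} (hr : 0 < r) {i j : ι}
    (h : b j ≤ b i) : PowerSeries.coeff r (E i j) = 0 := by
  rw [hG.upper i j h]
  split_ifs <;> simp [PowerSeries.coeff_one, hr.ne']

/-- The sum of the three factors, from which each of them can be read off. -/
theorem coeff_lower_mem_of_sum (hG : IsBlockGauss b M F D E) {Q : AddSubgroup A} {r : ℕ}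
    (hr : 0 < r) {i j : ι} {x : A} (hx : x ∈ Q)
    (h : PowerSeries.coeff r (F i j) + PowerSeries.coeff r (D i j) +
      PowerSeries.coeff r (E i j) - x ∈ Q) :
    PowerSeries.coeff r (F i j) ∈ Q ∧ PowerSeries.coeff r (D i j) ∈ Q ∧
      PowerSeries.coeff r (E i j) ∈ Q := by
  have h' := add_mem h hx
  rw [sub_add_cancel] at h'
  rcases lt_trichotomy (b i) (b j) with hij | hij | hij
  · rw [hG.coeff_lower_eq_zero hr hij.le, hG.diag i j hij.ne, map_zero] at h' ⊢
    simpa using h'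
  · rw [hG.coeff_lower_eq_zero hr hij.le, hG.coeff_upper_eq_zero hr hij.ge] at h' ⊢
    simpa using h'
  · rw [hG.coeff_upper_eq_zero hr hij.le, hG.diag i j hij.ne', map_zero] at h' ⊢
    simpa using h'

end IsBlockGauss

/-- By induction `F_r + D_r + E_r` is `M_r` up to products of earlier coefficients. For `r > 0` the
three summands have disjoint supports, so each can be read off. -/
theorem IsFiltration.coeff_gauss_mem {P : ℕ → AddSubgroup A} (hP : IsFiltration P)
    (hG : IsBlockGauss b M F D E) (h0 : matCoeff M 0 = 1)
    (hM : ∀ r i j, PowerSeries.coeff r (M i j) ∈ P (r + 1)) (r : ℕ) (i j : ι) :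
    PowerSeries.coeff r (F i j) ∈ P (r + 1) ∧ PowerSeries.coeff r (D i j) ∈ P (r + 1) ∧
      PowerSeries.coeff r (E i j) ∈ P (r + 1) := by
  induction r using Nat.strong_induction_on generalizing i j with
  | _ r ih =>
    rcases Nat.eq_zero_or_pos r with rfl | hr
    · obtain ⟨f0, d0, e0⟩ := hG.coeff_zero h0
      have one : ∀ i j, (1 : Matrix ι ι A) i j ∈ P 1 := fun i j => by
        rw [Matrix.one_apply]
        split_ifs
        · exact hP.one_mem
        · exact zero_mem _
      refine ⟨?_, ?_, ?_⟩
      · have := one i j; rw [← f0] at this; exact this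
      · have := one i j; rw [← d0] at this; exact this
      · have := one i j; rw [← e0] at this; exact this
    · refine hG.coeff_lower_mem_of_sum hr (hM r i j) (hG.coeff_sub_mem h0 _ hr ?_ i j)
      intro p q s hp hq hs hpqs i k l j
      have := hP.mul_mem _ _ _ _ (hP.mul_mem _ _ _ _ (ih p hp i k).1 (ih q hq k l).2.1)
        (ih s hs l j).2.2
      rwa [hpqs] at this

/-- As a constant filtration, a centralizer can be fed to the lemmas on inverses and Gauss factors,
which then propagate commutation. -/
theorem isFiltration_centralizer (x : A) :
    IsFiltration fun _ => (Subring.centralizer {x}).toAddSubgroup where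
  one_mem := one_mem (Subring.centralizer {x})
  mul_mem := fun _ _ _ _ hx hy => (Subring.centralizer {x}).mul_mem hx hy
  le_succ := fun _ => le_rfl

theorem mem_centralizer_singleton {x y : A} : y ∈ Subring.centralizer {x} ↔ Commute x y := by
  rw [Subring.mem_centralizer_iff]
  simp [Commute, SemiconjBy]

/-! ### The block diagonal factor -/

namespace IsBlockGauss

/-- For a lower set of blocks the triangular shape of `F` and `E` confines the intermediate indices
to the set. -/
theorem corner (hG : IsBlockGauss b M F D E) (p : ι → Prop) [DecidablePred p]
    (hp : ∀ i j, b i ≤ b j → p j → p i) :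
    IsBlockGauss (fun i : {i // p i} => b i) (M.submatrix Subtype.val Subtype.val)
      (F.submatrix Subtype.val Subtype.val) (D.submatrix Subtype.val Subtype.val)
      (E.submatrix Subtype.val Subtype.val) where
  factor := by
    refine Matrix.ext fun i j => ?_
    rw [Matrix.submatrix_apply, hG.factor, Matrix.mul_apply, Matrix.mul_apply,
      sum_eq_sum_subtype p]
    · refine Finset.sum_congr rfl fun t _ => ?_
      rw [Matrix.mul_apply, Matrix.mul_apply, sum_eq_sum_subtype p]
      · rfl
      · intro s hs
        have hlt : b i < b s := not_le.mp fun h => hs (hp _ _ h i.2)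
        have hne : (i : ι) ≠ s := fun e => hlt.ne (e ▸ rfl)
        rw [hG.lower i s hlt.le, if_neg hne, zero_mul]
    · intro t ht
      have hlt : b j < b t := not_le.mp fun h => ht (hp _ _ h j.2)
      have hne : t ≠ (j : ι) := fun e => hlt.ne (e ▸ rfl)
      rw [hG.upper t j hlt.le, if_neg hne, mul_zero]
  diag := fun i j h => hG.diag i j h
  upper := fun i j h => by
    rw [Matrix.submatrix_apply, hG.upper i j h]; simp only [Subtype.ext_iff]
  lower := fun i j h => by
    rw [Matrix.submatrix_apply, hG.lower i j h]; simp only [Subtype.ext_iff]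
  upper_const := fun i j h => hG.upper_const i j h
  lower_const := fun i j h => hG.lower_const i j h

theorem matCoeff_submatrix_zero {ι κ : Type*} [DecidableEq ι] [DecidableEq κ] {N : Matrix ι ι (PowerSeries A)}
    (h0 : matCoeff N 0 = 1) {c : κ → ι} (hc : Function.Injective c) :
    matCoeff (N.submatrix c c) 0 = 1 := by
  ext i j
  have := congrFun (congrFun h0 (c i)) (c j)
  rw [Matrix.one_apply] at this ⊢
  simp only [hc.eq_iff] at this
  exact this

theorem matCoeff_inverse_zero {N : Matrix ι ι (PowerSeries A)} (h0 : matCoeff M 0 = 1)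
    (hMN : M * N = 1) : matCoeff N 0 = 1 := by
  have h1 := congrArg (fun K => matCoeff K 0) hMN
  simp only [matCoeff_one, if_true] at h1
  rwa [matCoeff_mul, Finset.HasAntidiagonal.antidiagonal_zero, Finset.sum_singleton, h0,
    one_mul] at h1

variable {N : Matrix ι ι (PowerSeries A)}

/-- The right inverse is two-sided because the corner has constant term `1` and is therefore
invertible. -/
theorem corner_mul_cornerInv (hG : IsBlockGauss b M F D E) (h0 : matCoeff M 0 = 1)
    (hMN : M * N = 1) (hNM : N * M = 1) (p : ι → Prop) [DecidablePred p]
    (hp : ∀ i j, b i ≤ b j → p i → p j) :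
    N.submatrix Subtype.val Subtype.val *
        (Matrix.of fun l q : {i // p i} => cornerInv p F D E l q) = 1 ∧
      (Matrix.of fun l q : {i // p i} => cornerInv p F D E l q) *
        N.submatrix Subtype.val Subtype.val = 1 := by
  set V : Matrix {i // p i} {i // p i} (PowerSeries A) :=
    Matrix.of fun l q : {i // p i} => cornerInv p F D E l q
  have h1 : N.submatrix Subtype.val Subtype.val * V = 1 := by
    refine Matrix.ext fun s q => ?_
    rw [Matrix.mul_apply, Matrix.one_apply]
    exact hG.sum_corner_mul_cornerInv h0 hMN hNM p hp s q
  obtain ⟨W, hW, hW'⟩ := exists_inverse (N.submatrix (Subtype.val : {i // p i} → ι) Subtype.val)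
    (matCoeff_submatrix_zero (matCoeff_inverse_zero h0 hMN) Subtype.val_injective)
  have : V = W := by rw [← one_mul V, ← hW', mul_assoc, h1, mul_one]
  exact ⟨h1, this ▸ hW'⟩

/-- In the product of the corners of `F D` and `E` on the blocks from `b i` on, both unitriangular
factors act trivially on the first diagonal block. -/
theorem cornerInv_apply (hG : IsBlockGauss b M F D E) {i j : ι} (hij : b i = b j) :
    cornerInv (fun l => b i ≤ b l) F D E i j = D i j := by
  rw [cornerInv, Finset.sum_eq_single ⟨j, hij.le⟩]
  · rw [hG.upper j j le_rfl, if_pos rfl, mul_one]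
    exact hG.lower_mul_diag_self hij.le
  · intro t _ ht
    have hne : (t : ι) ≠ j := fun e => ht (Subtype.ext e)
    rw [hG.upper t j (hij ▸ t.2), if_neg hne, mul_zero]
  · simp

/-- Each diagonal block satisfies the RTT relation. -/
theorem rtt_diag (hG : IsBlockGauss b M F D E) (h0 : matCoeff M 0 = 1) (hM : RTT 1 M) (a : β) :
    RTT 1 (D.submatrix (Subtype.val : {i // b i = a} → ι) Subtype.val) := by
  obtain ⟨N, hMN, hNM⟩ := exists_inverse M h0
  obtain ⟨h1, h2⟩ := hG.corner_mul_cornerInv h0 hMN hNM (fun l => a ≤ b l)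
    fun i j hij hi => hi.trans hij
  -- The corner of `N` has sign `-1` and its inverse again `+1`; restriction to the first block then
  -- gives the block `a` of `D`.
  have hV := (((hM.inv hMN hNM).submatrix (Subtype.val : {i // a ≤ b i} → ι)).inv h1 h2).submatrix
    (fun i : {i // b i = a} => (⟨i, i.2.ge⟩ : {i // a ≤ b i}))
  rw [neg_neg] at hV
  convert hV using 1
  refine Matrix.ext fun i j => ?_
  obtain ⟨i, rfl⟩ := i
  exact (hG.cornerInv_apply j.2.symm).symm

theorem commute_coeff {P Q : PowerSeries A} (h : Commute (inX P) (inY Q)) (r s : ℕ) :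
    Commute (PowerSeries.coeff r P) (PowerSeries.coeff s Q) := by
  have := congrArg (coeff₂ r s) h.eq
  rwa [coeff₂_inX_mul_inY, coeff₂_inY_mul_inX] at this

/-- Different diagonal blocks commute. -/
theorem commute_diag (hG : IsBlockGauss b M F D E) (h0 : matCoeff M 0 = 1) (hM : RTT 1 M)
    {i j h l : ι} (hij : b i = b j) (hhl : b h = b l) (hlt : b i < b h) (r s : ℕ) :
    Commute (PowerSeries.coeff r (D i j)) (PowerSeries.coeff s (D h l)) := by
  obtain ⟨N, hMN, hNM⟩ := exists_inverse M h0
  obtain ⟨h1, h2⟩ := hG.corner_mul_cornerInv h0 hMN hNM (fun l => b h ≤ b l)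
    fun i j hij hi => hi.trans hij
  -- Entries of `M` before the block of `h` commute with the entries of `N` from that block on,
  -- hence with the entries of the inverse of that corner, of which `D h l` is one.
  have c1 : ∀ (i j : {i // b i < b h}) r,
      Commute (PowerSeries.coeff r (M i j)) (PowerSeries.coeff s (D h l)) := by
    intro i j r
    rw [← hG.cornerInv_apply hhl, ← mem_centralizer_singleton]
    refine (isFiltration_centralizer _).coeff_inverse_mem
      (matCoeff_submatrix_zero (matCoeff_inverse_zero h0 hMN) Subtype.val_injective)
      (fun r' i' j' => ?_) h1 s ⟨h, le_rfl⟩ ⟨l, hhl.le⟩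
    refine mem_centralizer_singleton.mpr (commute_coeff (hM.comm_inv hMN hNM ?_ ?_) r r')
    · intro e
      exact (j.2.trans_le (e ▸ i'.2)).false
    · intro e
      exact (i.2.trans_le (e ▸ j'.2)).false
  -- `D i j` is an entry of a Gauss factor of the leading corner of `M`, so it inherits the
  -- commutation from the entries of that corner.
  have hK := hG.corner (fun i => b i < b h) fun i j hij hj => hij.trans_lt hj
  have := ((isFiltration_centralizer (PowerSeries.coeff s (D h l))).coeff_gauss_mem hK
    (matCoeff_submatrix_zero h0 Subtype.val_injective)
    (fun r i j => mem_centralizer_singleton.mpr (c1 i j r).symm) r ⟨i, hlt⟩ ⟨j, hij ▸ hlt⟩).2.1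
  exact (mem_centralizer_singleton.mp this).symm

end IsBlockGauss

theorem IsFiltration.comm_rtt_mem {P : ℕ → AddSubgroup A} (hP : IsFiltration P) {κ : Type*}
    {T : Matrix κ κ (PowerSeries A)} (H : RTT 1 T)
    (hT : ∀ r i j, PowerSeries.coeff r (T i j) ∈ P (r + 1)) (i j h l : κ) (r s : ℕ) :
    PowerSeries.coeff r (T i j) * PowerSeries.coeff s (T h l) -
      PowerSeries.coeff s (T h l) * PowerSeries.coeff r (T i j) ∈ P (r + s) := by
  have hX : ∀ i j, inX (T i j) ∈ hP.seriesSubring := fun i j => hP.coeff₂_inX_mem fun r => hT r i j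
  have hY : ∀ i j, inY (T i j) ∈ hP.seriesSubring := fun i j => hP.coeff₂_inY_mem fun r => hT r i j
  have H' := H i j h l
  rw [one_smul] at H'
  have := hP.coeff₂_mem_of_diffYX_smul_eq H'
    (sub_mem (MulMemClass.mul_mem (hX _ _) (hY _ _)) (MulMemClass.mul_mem (hY _ _) (hX _ _))) r s
  simp only [Matrix.map_apply] at this
  rwa [map_sub, coeff₂_inX_mul_inY, coeff₂_inY_mul_inX] at this

theorem IsFiltration.comm_diag_mem {P : ℕ → AddSubgroup A} (hP : IsFiltration P)
    (hG : IsBlockGauss b M F D E) (h0 : matCoeff M 0 = 1) (hM : RTT 1 M)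
    (hD : ∀ r i j, b i = b j → PowerSeries.coeff r (D i j) ∈ P (r + 1)) {i j h l : ι}
    (hij : b i = b j) (hhl : b h = b l) (r s : ℕ) :
    PowerSeries.coeff r (D i j) * PowerSeries.coeff s (D h l) -
      PowerSeries.coeff s (D h l) * PowerSeries.coeff r (D i j) ∈ P (r + s) := by
  rcases lt_trichotomy (b i) (b h) with hih | hih | hih
  · rw [(hG.commute_diag h0 hM hij hhl hih r s).eq, sub_self]
    exact zero_mem _
  · exact hP.comm_rtt_mem (hG.rtt_diag h0 hM (b h))
      (fun r i j => hD r i j (i.2.trans j.2.symm)) ⟨i, hih⟩ ⟨j, hij ▸ hih⟩ ⟨h, rfl⟩ ⟨l, hhl.symm⟩ r s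
  · rw [(hG.commute_diag h0 hM hhl hij hih s r).eq, sub_self]
    exact zero_mem _

/-! ### Transposition -/

section Transpose

open MulOpposite

/-- A power series with coefficients moved to the opposite ring. -/
def opSeries (f : PowerSeries A) : PowerSeries Aᵐᵒᵖ :=
  PowerSeries.mk fun r => op (PowerSeries.coeff r f)

theorem coeff_opSeries (f : PowerSeries A) (r : ℕ) :
    PowerSeries.coeff r (opSeries f) = op (PowerSeries.coeff r f) := PowerSeries.coeff_mk _ _

theorem opSeries_mul (f g : PowerSeries A) : opSeries (f * g) = opSeries g * opSeries f := by
  ext r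
  rw [coeff_opSeries, PowerSeries.coeff_mul, PowerSeries.coeff_mul,
    ← Finset.Nat.sum_antidiagonal_swap, Finset.op_sum]
  exact Finset.sum_congr rfl fun p _ => by
    simp only [coeff_opSeries, op_mul, Prod.fst_swap, Prod.snd_swap]

theorem opSeries_sum {κ : Type*} (s : Finset κ) (f : κ → PowerSeries A) :
    opSeries (∑ i ∈ s, f i) = ∑ i ∈ s, opSeries (f i) := by
  ext r
  simp [coeff_opSeries]

/-- The transposed matrix over the opposite ring. -/
def opTranspose {κ : Type*} (M : Matrix κ κ (PowerSeries A)) : Matrix κ κ (PowerSeries Aᵐᵒᵖ) :=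
  Matrix.of fun i j => opSeries (M j i)

theorem coeff_opTranspose {κ : Type*} (M : Matrix κ κ (PowerSeries A)) (i j : κ) (r : ℕ) :
    PowerSeries.coeff r (opTranspose M i j) = op (PowerSeries.coeff r (M j i)) :=
  coeff_opSeries _ _

theorem opTranspose_mul {κ : Type*} [Fintype κ] (M N : Matrix κ κ (PowerSeries A)) :
    opTranspose (M * N) = opTranspose N * opTranspose M := by
  refine Matrix.ext fun i j => ?_
  simp only [opTranspose, Matrix.of_apply, Matrix.mul_apply, opSeries_sum, opSeries_mul]

theorem matCoeff_opTranspose_zero {κ : Type*} [DecidableEq κ]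
    {M : Matrix κ κ (PowerSeries A)} (h0 : matCoeff M 0 = 1) : matCoeff (opTranspose M) 0 = 1 := by
  ext i j
  have := congrFun (congrFun h0 j) i
  change PowerSeries.coeff 0 (opTranspose M i j) = _
  rw [coeff_opTranspose]
  change PowerSeries.coeff 0 (M j i) = _ at this
  rw [this, Matrix.one_apply, Matrix.one_apply]
  by_cases h : i = j
  · simp [h]
  · simp [h, Ne.symm h]

theorem RTT.opTranspose {κ : Type*} [DecidableEq κ] {M : Matrix κ κ (PowerSeries A)}
    (h0 : matCoeff M 0 = 1) (hM : RTT 1 M) : RTT 1 (opTranspose M) := by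
  have c0 := matCoeff_opTranspose_zero h0
  refine RTT.of_coeff (fun i j h l s => ?_) fun i j h l r s => ?_
  · have : PowerSeries.coeff 0 (Yang.opTranspose M i j) = (1 : Matrix κ κ Aᵐᵒᵖ) i j :=
      congrFun (congrFun c0 i) j
    rw [this, Matrix.one_apply, Ring.lie_def]
    split_ifs <;> simp
  · have := congrArg op (hM.coeff_rel j i l h r s)
    rw [one_smul] at this ⊢
    simp only [Ring.lie_def, coeff_opTranspose, op_sub, op_mul] at this ⊢
    -- Reversing products negates the commutators and exchanges the two terms on the right, so the
    -- relation reappears with both sides negated.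
    rw [← neg_inj]
    calc _ = _ := by abel
      _ = _ := this
      _ = _ := by abel

theorem IsBlockGauss.opTranspose (hG : IsBlockGauss b M F D E) :
    IsBlockGauss b (opTranspose M) (opTranspose E) (opTranspose D) (opTranspose F) where
  factor := by rw [hG.factor, opTranspose_mul, opTranspose_mul, mul_assoc]
  diag := fun i j h => by
    ext r
    rw [coeff_opTranspose, hG.diag j i h.symm]
    simp
  upper := fun i j h => by
    ext r
    rw [coeff_opTranspose, hG.lower j i h]
    by_cases e : i = j
    · simp [e, PowerSeries.coeff_one, apply_ite op]
    · simp [e, Ne.symm e]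
  lower := fun i j h => by
    ext r
    rw [coeff_opTranspose, hG.upper j i h]
    by_cases e : i = j
    · simp [e, PowerSeries.coeff_one, apply_ite op]
    · simp [e, Ne.symm e]
  upper_const := fun i j h => by
    rw [← PowerSeries.coeff_zero_eq_constantCoeff_apply, coeff_opTranspose,
      PowerSeries.coeff_zero_eq_constantCoeff_apply, hG.lower_const j i h, op_zero]
  lower_const := fun i j h => by
    rw [← PowerSeries.coeff_zero_eq_constantCoeff_apply, coeff_opTranspose,
      PowerSeries.coeff_zero_eq_constantCoeff_apply, hG.upper_const j i h, op_zero]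

theorem IsBlockGauss.lower_recursion (hG : IsBlockGauss b M F D E) (h0 : matCoeff M 0 = 1)
    (hM : RTT 1 M) {h i q : ι} (hi : b h < b i) (hq : b i < b q) (r : ℕ) :
    PowerSeries.coeff r (F q h) =
      ⁅PowerSeries.coeff 1 (F q i), PowerSeries.coeff r (F i h)⁆ := by
  have := hG.opTranspose.upper_recursion (matCoeff_opTranspose_zero h0) (hM.opTranspose h0) hi hq r
  simp only [coeff_opTranspose, Ring.lie_def, ← op_mul, ← op_sub] at this
  rw [Ring.lie_def]
  exact op_injective this

theorem IsFiltration.op {P : ℕ → AddSubgroup A} (hP : IsFiltration P) :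
    IsFiltration fun m => (P m).comap (opAddEquiv (α := A)).symm.toAddMonoidHom where
  one_mem := hP.one_mem
  mul_mem := fun m n x y hx hy => by
    have := hP.mul_mem n m _ _ hy hx
    rw [add_comm n m] at this
    exact this
  le_succ := fun m _ hx => hP.le_succ m hx

theorem IsFiltration.comm_lower_mem {P : ℕ → AddSubgroup A} (hP : IsFiltration P)
    (hG : IsBlockGauss b M F D E) (h0 : matCoeff M 0 = 1) (hM : RTT 1 M)
    (hF : ∀ r i j, PowerSeries.coeff r (F i j) ∈ P (r + 1)) {i j h l : ι} (hij : b j < b i)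
    (hhl : b l < b h) (r s : ℕ) :
    PowerSeries.coeff r (F i j) * PowerSeries.coeff s (F h l) -
      PowerSeries.coeff s (F h l) * PowerSeries.coeff r (F i j) ∈ P (r + s) := by
  have := hP.op.comm_upper_mem hG.opTranspose (matCoeff_opTranspose_zero h0) (hM.opTranspose h0)
    (fun r i j => by rw [coeff_opTranspose]; exact hF r j i) hhl hij s r
  rw [coeff_opTranspose, coeff_opTranspose, add_comm] at this
  exact this

end Transpose

end GaussCoeff

end Yang
end

noncomputable section

namespace Yang

/-! ### Spans of words and straightening -/

section Words

variable {I A : Type*} [Ring A] [Algebra ℂ A]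

/-- The span of the words of weight `< m` in a family of elements with weights. -/
def wordSpan (x : I → A) (w : I → ℕ) (m : ℕ) : Submodule ℂ A :=
  Submodule.span ℂ {y | ∃ l : List I, (l.map w).sum < m ∧ y = (l.map x).prod}

variable {x : I → A} {w : I → ℕ}

theorem prod_mem_wordSpan (l : List I) {m : ℕ} (h : (l.map w).sum < m) :
    (l.map x).prod ∈ wordSpan x w m := Submodule.subset_span ⟨l, h, rfl⟩

theorem mem_wordSpan (i : I) : x i ∈ wordSpan x w (w i + 1) := by
  have := prod_mem_wordSpan (x := x) (w := w) [i] (m := w i + 1) (by simp)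
  simpa using this

theorem wordSpan_mono {m n : ℕ} (h : m ≤ n) : wordSpan x w m ≤ wordSpan x w n :=
  Submodule.span_mono fun _ ⟨l, hl, e⟩ => ⟨l, hl.trans_le h, e⟩

theorem isFiltration_wordSpan : IsFiltration fun m => (wordSpan x w m).toAddSubgroup where
  one_mem := by simpa using prod_mem_wordSpan (x := x) (w := w) [] (m := 1) (by simp)
  mul_mem := fun m n y z hy hz => by
    have h := Submodule.mul_mem_mul (R := ℂ) (M := wordSpan x w (m + 1)) (N := wordSpan x w (n + 1))
      hy hz
    rw [wordSpan, wordSpan, Submodule.span_mul_span] at h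
    refine Submodule.span_mono ?_ h
    rintro _ ⟨_, ⟨l, hl, rfl⟩, _, ⟨l', hl', rfl⟩, rfl⟩
    refine ⟨l ++ l', ?_, by simp⟩
    simp only [List.map_append, List.sum_append]
    omega
  le_succ := fun m => wordSpan_mono m.le_succ

theorem mul_mem_wordSpan_left (i : I) {m : ℕ} {y : A} (hy : y ∈ wordSpan x w m) :
    x i * y ∈ wordSpan x w (w i + m) := by
  induction hy using Submodule.span_induction with
  | mem y h =>
    obtain ⟨l, hl, rfl⟩ := h
    have := prod_mem_wordSpan (x := x) (w := w) (i :: l) (m := w i + m) (by simpa using hl)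
    simpa using this
  | zero => simp
  | add y z _ _ h h' => rw [mul_add]; exact add_mem h h'
  | smul c y _ h => rw [mul_smul_comm]; exact Submodule.smul_mem _ _ h

theorem mul_mem_wordSpan_right (l : List I) {m : ℕ} {y : A} (hy : y ∈ wordSpan x w m) :
    y * (l.map x).prod ∈ wordSpan x w (m + (l.map w).sum) := by
  induction hy using Submodule.span_induction with
  | mem y h =>
    obtain ⟨l', hl, rfl⟩ := h
    have := prod_mem_wordSpan (x := x) (w := w) (l' ++ l) (m := m + (l.map w).sum)
      (by simpa using hl)
    simpa using this
  | zero => simp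
  | add y z _ _ h h' => rw [add_mul]; exact add_mem h h'
  | smul c y _ h => rw [smul_mul_assoc]; exact Submodule.smul_mem _ _ h

/-- Commutators of letters are combinations of words of smaller weight. -/
def Straightens (x : I → A) (w : I → ℕ) : Prop :=
  ∀ i j, x i * x j - x j * x i ∈ wordSpan x w (w i + w j)

/-- Swapping two neighbouring letters changes a word by words of smaller weight, and such swaps
generate all permutations. -/
theorem Straightens.perm (hx : Straightens x w) {l l' : List I} (h : l.Perm l') :
    (l.map x).prod - (l'.map x).prod ∈ wordSpan x w (l.map w).sum := by
  induction h with
  | nil => simp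
  | cons a _ ih =>
    simp only [List.map_cons, List.prod_cons, List.sum_cons, ← mul_sub]
    exact mul_mem_wordSpan_left a ih
  | swap a b l =>
    simp only [List.map_cons, List.prod_cons, List.sum_cons, ← mul_assoc, ← sub_mul, ← add_assoc]
    exact mul_mem_wordSpan_right l (hx b a)
  | trans h₁ _ ih₁ ih₂ =>
    rw [← sub_add_sub_cancel]
    rw [← (h₁.map w).sum_eq] at ih₂
    exact add_mem ih₁ ih₂

/-- For two words this is the permutation from `l ++ l'` to `l' ++ l`. It allows straightening to be
transferred between families. -/
theorem Straightens.comm_mem (hx : Straightens x w) {m n : ℕ} {y z : A}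
    (hy : y ∈ wordSpan x w (m + 1)) (hz : z ∈ wordSpan x w (n + 1)) :
    y * z - z * y ∈ wordSpan x w (m + n) := by
  induction hy using Submodule.span_induction with
  | mem y h =>
    obtain ⟨l, hl, rfl⟩ := h
    induction hz using Submodule.span_induction with
    | mem z h =>
      obtain ⟨l', hl', rfl⟩ := h
      have := hx.perm (List.perm_append_comm (l₁ := l) (l₂ := l'))
      simp only [List.map_append, List.prod_append, List.sum_append] at this
      exact wordSpan_mono (by omega) this
    | zero => simp
    | add y z _ _ h h' =>
      rw [mul_add, add_mul, add_sub_add_comm]; exact add_mem h h'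
    | smul c y _ h =>
      rw [mul_smul_comm, smul_mul_assoc, ← smul_sub]; exact Submodule.smul_mem _ _ h
  | zero => simp
  | add y z _ _ h h' => rw [mul_add, add_mul, add_sub_add_comm]; exact add_mem h h'
  | smul c y _ h =>
    rw [mul_smul_comm, smul_mul_assoc, ← smul_sub]; exact Submodule.smul_mem _ _ h

theorem wordSpan_le {J : Type*} {y : J → A} {v : J → ℕ}
    (h : ∀ i, x i ∈ wordSpan y v (w i + 1)) (m : ℕ) : wordSpan x w m ≤ wordSpan y v m := by
  refine Submodule.span_le.mpr ?_
  rintro _ ⟨l, hl, rfl⟩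
  have hP : IsFiltration fun m => (wordSpan y v m).toAddSubgroup := isFiltration_wordSpan
  have : ∀ l : List I, (l.map x).prod ∈ wordSpan y v ((l.map w).sum + 1) := by
    intro l
    induction l with
    | nil => exact hP.one_mem
    | cons i l ih =>
      simp only [List.map_cons, List.prod_cons, List.sum_cons]
      exact hP.mul_mem _ _ _ _ (h i) ih
  exact wordSpan_mono hl (this l)

/-- Induction on the weight: sorting a word costs only words of smaller weight. -/
theorem Straightens.wordSpan_le_span (hx : Straightens x w) (lo : LinearOrder I) (m : ℕ) :
    wordSpan x w m ≤ Submodule.span ℂ (Set.range (orderedMonomial lo x)) := by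
  induction m using Nat.strong_induction_on with
  | _ m ih =>
    refine Submodule.span_le.mpr ?_
    rintro _ ⟨l, hl, rfl⟩
    have h1 : (l.map x).prod - orderedMonomial lo x (l : Multiset I) ∈
        wordSpan x w (l.map w).sum := by
      refine hx.perm ?_
      rw [← Multiset.coe_eq_coe]
      exact (Multiset.sort_eq _ _).symm
    have h2 := add_mem (ih _ hl h1) (Submodule.subset_span ⟨(l : Multiset I), rfl⟩)
    rwa [sub_add_cancel] at h2

theorem Straightens.span_orderedMonomial (hx : Straightens x w) (lo : LinearOrder I) :
    Submodule.span ℂ (Set.range (orderedMonomial lo x)) =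
      Subalgebra.toSubmodule (Algebra.adjoin ℂ (Set.range x)) := by
  apply le_antisymm
  · refine Submodule.span_le.mpr ?_
    rintro _ ⟨s, rfl⟩
    change _ ∈ Algebra.adjoin ℂ (Set.range x)
    refine list_prod_mem fun y hy => ?_
    obtain ⟨i, -, rfl⟩ := List.mem_map.mp hy
    exact Algebra.subset_adjoin ⟨i, rfl⟩
  · rw [Algebra.adjoin_eq_span]
    refine Submodule.span_le.mpr fun y hy => ?_
    obtain ⟨l, hl, rfl⟩ := Submonoid.exists_list_of_mem_closure hy
    have e : l ∈ Set.range (List.map x) := by rw [Set.range_list_map]; exact hl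
    obtain ⟨l, rfl⟩ := e
    exact hx.wordSpan_le_span lo _ (prod_mem_wordSpan _ (Nat.lt_succ_self _))

end Words

end Yang
end

noncomputable section

namespace Yang

/-! ### A family of representations of the Yangian -/

section Model

open Polynomial in
theorem linear_mul_linear {R : Type*} [Ring R] (a a' c c' : R) :
    (C a + C a' * X) * (C c + C c' * X) =
      C (a * c) + C (a * c' + a' * c) * X + C (a' * c') * X ^ 2 := by
  simp only [add_mul, mul_add, C_mul, C_add, pow_two, mul_assoc, X_mul_C]
  rw [← mul_assoc X (C c') X, X_mul_C]
  simp only [mul_assoc]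
  abel

variable {n : ℕ}

/-- Polynomials in countably many `n × n` matrices of variables. -/
abbrev Sym (n : ℕ) : Type := MvPolynomial (ℕ × Fin n × Fin n) ℂ

/-- The operators on `Sym n`. -/
abbrev Op (n : ℕ) : Type := Module.End ℂ (Sym n)

/-- The derivation induced by the matrix unit `e_{ij}` acting on the matrix of variables number `p`
by left multiplication. -/
def rowDer (p : ℕ) (i j : Fin n) : Derivation ℂ (Sym n) (Sym n) :=
  MvPolynomial.mkDerivation ℂ fun v =>
    if v.1 = p ∧ v.2.1 = j then MvPolynomial.X (p, i, v.2.2) else 0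

theorem rowDer_X (p : ℕ) (i j : Fin n) (v : ℕ × Fin n × Fin n) :
    rowDer p i j (MvPolynomial.X v) =
      if v.1 = p ∧ v.2.1 = j then MvPolynomial.X (p, i, v.2.2) else 0 :=
  MvPolynomial.mkDerivation_X _ _ _

/-- Two derivations agree once they agree on the variables, where these act as matrix units on the
row index. -/
theorem lie_rowDer (p q : ℕ) (i j h l : Fin n) :
    ⁅rowDer p i j, rowDer q h l⁆ =
      if p = q then (if h = j then rowDer p i l else 0) - (if i = l then rowDer p h j else 0)
      else 0 := by
  refine MvPolynomial.derivation_ext fun v => ?_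
  obtain ⟨a, b, c⟩ := v
  rw [Derivation.commutator_apply, rowDer_X, rowDer_X, apply_ite (rowDer p i j),
    apply_ite (rowDer q h l), map_zero, map_zero, rowDer_X, rowDer_X]
  rcases eq_or_ne p q with rfl | hpq
  · by_cases hhj : h = j <;> by_cases hil : i = l <;>
      simp only [hhj, hil, if_true, if_false, Derivation.sub_apply, Derivation.zero_apply,
        rowDer_X, and_true, and_false] <;> split_ifs <;> simp_all
  · simp [hpq, hpq.symm]

/-- Multiplication operators. -/
def mulOp : Sym n →ₐ[ℂ] Op n := Algebra.lmul ℂ (Sym n)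

/-- The derivation as an operator. -/
def derOp (p : ℕ) (i j : Fin n) : Op n := (rowDer p i j : Sym n →ₗ[ℂ] Sym n)

theorem derOp_mul_mulOp (p : ℕ) (i j : Fin n) (f : Sym n) :
    derOp p i j * mulOp f - mulOp f * derOp p i j = mulOp (rowDer p i j f) := by
  refine LinearMap.ext fun g => ?_
  change rowDer p i j (f * g) - f * rowDer p i j g = rowDer p i j f * g
  rw [Derivation.leibniz, smul_eq_mul, smul_eq_mul, add_sub_cancel_left, mul_comm]

theorem derOp_mul_derOp (p q : ℕ) (i j h l : Fin n) :
    derOp p i j * derOp q h l - derOp q h l * derOp p i j =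
      if p = q then (if h = j then derOp p i l else 0) - (if i = l then derOp p h j else 0)
      else 0 := by
  refine LinearMap.ext fun f => ?_
  have := DFunLike.congr_fun (lie_rowDer p q i j h l) f
  rw [Derivation.commutator_apply] at this
  change rowDer p i j (rowDer q h l f) - rowDer q h l (rowDer p i j f) = _
  rw [this]
  split_ifs <;> rfl

/-- Operators `e_{ij} = ∂_{ij} + t z_{ij}` satisfying the relations of `gl_n`. -/
def matUnit (p : ℕ) (i j : Fin n) : Polynomial (Op n) :=
  Polynomial.C (derOp p i j) + Polynomial.C (mulOp (MvPolynomial.X (p, i, j))) * Polynomial.X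

/-- The derivations satisfy the relations of `gl_n` and act on the multiplications by `z` in the
same pattern. The multiplications commute, so no `t²` term remains, yet the leading coefficients in
`t` are commuting variables. -/
theorem matUnit_comm (p q : ℕ) (i j h l : Fin n) :
    matUnit p i j * matUnit q h l - matUnit q h l * matUnit p i j =
      if p = q then (if h = j then matUnit p i l else 0) - (if i = l then matUnit p h j else 0)
      else 0 := by
  have e1 := derOp_mul_derOp p q i j h l
  have e2 := derOp_mul_mulOp p i j (MvPolynomial.X (q, h, l))
  have e3 := derOp_mul_mulOp q h l (MvPolynomial.X (p, i, j))
  have e4 : mulOp (MvPolynomial.X (p, i, j) : Sym n) * mulOp (MvPolynomial.X (q, h, l)) =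
      mulOp (MvPolynomial.X (q, h, l)) * mulOp (MvPolynomial.X (p, i, j)) := by
    rw [← map_mul, ← map_mul, mul_comm]
  rw [rowDer_X] at e2 e3
  rw [matUnit, matUnit, linear_mul_linear, linear_mul_linear, e4]
  have : ∀ a b c d e : Polynomial (Op n), a + b + e - (c + d + e) = (a - c) + (b - d) := by
    intros; abel
  rw [this, ← Polynomial.C_sub, ← sub_mul (Polynomial.C _), ← Polynomial.C_sub, e1]
  have e5 : ∀ a b c d : Op n, a + b - (c + d) = (a - d) - (c - b) := by intros; abel
  rw [e5, e2, e3]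
  rcases eq_or_ne p q with rfl | hpq
  · by_cases h1 : h = j <;> by_cases h2 : i = l <;> simp [h1, h2, matUnit, sub_mul] <;> abel
  · simp [hpq, hpq.symm]

end Model
end Yang
end

noncomputable section

namespace Yang

/-! ### Evaluation matrices and their products. -/

section Evaluation

variable {n : ℕ} {B : Type*} [Ring B]

theorem lie_one_apply (i j : Fin n) (f : B) :
    ⁅(1 : Matrix (Fin n) (Fin n) B) i j, f⁆ = 0 := by
  rw [Matrix.one_apply, Ring.lie_def]
  split_ifs <;> simp

theorem lie_one_apply_right (i j : Fin n) (f : B) :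
    ⁅f, (1 : Matrix (Fin n) (Fin n) B) i j⁆ = 0 := by
  rw [Matrix.one_apply, Ring.lie_def]
  split_ifs <;> simp

/-- The evaluation matrix `1 + (u - c)⁻¹ e`. -/
def evalMatrix (c : B) (e : Fin n → Fin n → B) : Matrix (Fin n) (Fin n) (PowerSeries B) :=
  Matrix.of fun i j => PowerSeries.mk fun r =>
    r.casesOn ((1 : Matrix (Fin n) (Fin n) B) i j) fun r => c ^ r * e i j

theorem coeff_evalMatrix_zero (c : B) (e : Fin n → Fin n → B) (i j : Fin n) :
    PowerSeries.coeff 0 (evalMatrix c e i j) = (1 : Matrix (Fin n) (Fin n) B) i j := by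
  rw [evalMatrix, Matrix.of_apply, PowerSeries.coeff_mk]; rfl

theorem coeff_evalMatrix_succ (c : B) (e : Fin n → Fin n → B) (r : ℕ) (i j : Fin n) :
    PowerSeries.coeff (r + 1) (evalMatrix c e i j) = c ^ r * e i j := by
  rw [evalMatrix, Matrix.of_apply, PowerSeries.coeff_mk]

theorem mul_sub_mul_of_commute {c d a b : B} (ha : Commute d a)
    (hb : Commute c b) (hcd : Commute c d) :
    (c * a) * (d * b) - (d * b) * (c * a) = (c * d) * (a * b - b * a) := by
  have e1 : (c * a) * (d * b) = (c * d) * (a * b) := by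
    rw [mul_assoc, ← mul_assoc a d b, ← ha.eq]
    simp only [mul_assoc]
  have e2 : (d * b) * (c * a) = (c * d) * (b * a) := by
    rw [mul_assoc, ← mul_assoc b c a, ← hb.eq, hcd.eq]
    simp only [mul_assoc]
  rw [e1, e2, mul_sub]

theorem lie_coeff_evalMatrix {c d : B} (hc : ∀ x, Commute c x) (hd : ∀ x, Commute d x)
    (e f : Fin n → Fin n → B) (i j h l : Fin n) (r s : ℕ) :
    ⁅PowerSeries.coeff (r + 1) (evalMatrix c e i j),
        PowerSeries.coeff (s + 1) (evalMatrix d f h l)⁆ =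
      (c ^ r * d ^ s) * (e i j * f h l - f h l * e i j) := by
  rw [Ring.lie_def, coeff_evalMatrix_succ, coeff_evalMatrix_succ]
  exact mul_sub_mul_of_commute ((hd _).pow_left s) ((hc _).pow_left r)
    (((hc _).pow_left r).pow_right s)

/-- As `c` is central, both sides vanish unless exactly one of `r`, `s` is zero, and then the
relation is that of `gl_n` times a power of `c`. -/
theorem rtt_evalMatrix {c : B} (hc : ∀ x, Commute c x) {e : Fin n → Fin n → B}
    (he : ∀ i j h l, e i j * e h l - e h l * e i j =
      (if h = j then e i l else 0) - (if i = l then e h j else 0)) : RTT 1 (evalMatrix c e) := by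
  refine RTT.of_coeff (fun i j h l s => ?_) fun i j h l r s => ?_
  · rw [coeff_evalMatrix_zero, lie_one_apply]
  · rw [one_smul]
    rcases r with _ | r <;> rcases s with _ | s
    · simp only [coeff_evalMatrix_zero, lie_one_apply, lie_one_apply_right, sub_self]
    · rw [lie_coeff_evalMatrix hc hc, coeff_evalMatrix_zero, lie_one_apply, he,
        coeff_evalMatrix_succ, coeff_evalMatrix_zero, coeff_evalMatrix_zero, coeff_evalMatrix_succ,
        Matrix.one_apply, Matrix.one_apply, pow_zero, one_mul, sub_zero, mul_sub]
      congr 1 <;> split_ifs <;> simp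
    · rw [coeff_evalMatrix_zero, lie_one_apply_right, lie_coeff_evalMatrix hc hc, he,
        coeff_evalMatrix_succ, coeff_evalMatrix_zero, coeff_evalMatrix_zero,
        coeff_evalMatrix_succ, Matrix.one_apply, Matrix.one_apply, pow_zero, mul_one, zero_sub,
        ← mul_neg, neg_sub, mul_sub]
      congr 1 <;> split_ifs <;> simp
    · rw [lie_coeff_evalMatrix hc hc, lie_coeff_evalMatrix hc hc]
      simp only [coeff_evalMatrix_succ]
      have e : ∀ a b : ℕ, c ^ a * e h j * (c ^ b * e i l) = c ^ (a + b) * (e h j * e i l) := by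
        intro a b
        rw [mul_assoc, ← mul_assoc (e h j), ← ((hc _).pow_left b).eq, pow_add]
        simp only [mul_assoc]
      rw [e, e, ← pow_add, ← pow_add, add_comm s r, add_right_comm, add_assoc, sub_self, sub_self]

theorem commute_evalMatrix {c d : B} (hc : ∀ x, Commute c x) (hd : ∀ x, Commute d x)
    {e f : Fin n → Fin n → B} (hef : ∀ i j h l, Commute (e i j) (f h l)) (i j h l : Fin n)
    (r s : ℕ) : Commute (PowerSeries.coeff r (evalMatrix c e i j))
      (PowerSeries.coeff s (evalMatrix d f h l)) := by
  refine sub_eq_zero.mp ?_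
  rw [← Ring.lie_def]
  rcases r with _ | r
  · rw [coeff_evalMatrix_zero, lie_one_apply]
  rcases s with _ | s
  · rw [coeff_evalMatrix_zero, lie_one_apply_right]
  rw [lie_coeff_evalMatrix hc hd, (hef i j h l).eq, sub_self, mul_zero]

/-- The product of the first `k` evaluation matrices. -/
def evalProd (c : ℕ → B) (e : ℕ → Fin n → Fin n → B) : ℕ → Matrix (Fin n) (Fin n) (PowerSeries B)
  | 0 => 1
  | k + 1 => evalProd c e k * evalMatrix (c k) (e k)

theorem coeff_one_apply (r : ℕ) (i j : Fin n) :
    PowerSeries.coeff r ((1 : Matrix (Fin n) (Fin n) (PowerSeries B)) i j) =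
      if r = 0 then (1 : Matrix (Fin n) (Fin n) B) i j else 0 := by
  have := congrFun (congrFun (matCoeff_one (ι := Fin n) (A := B) r) i) j
  refine Eq.trans this ?_
  split_ifs <;> rfl

theorem rtt_one : RTT 1 (1 : Matrix (Fin n) (Fin n) (PowerSeries B)) := by
  refine RTT.of_coeff (fun i j h l s => ?_) fun i j h l r s => ?_
  · rw [coeff_one_apply, if_pos rfl, lie_one_apply]
  · simp only [coeff_one_apply]
    rcases r with _ | r <;> rcases s with _ | s <;> simp [Ring.lie_def]

variable {c : ℕ → B} {e : ℕ → Fin n → Fin n → B}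

theorem commute_evalProd (hc : ∀ p x, Commute (c p) x)
    (he : ∀ p q i j h l, p ≠ q → Commute (e p i j) (e q h l)) {k q : ℕ} (hkq : k ≤ q)
    (i j h l : Fin n) (r s : ℕ) :
    Commute (PowerSeries.coeff r (evalProd c e k i j))
      (PowerSeries.coeff s (evalMatrix (c q) (e q) h l)) := by
  induction k generalizing i j r with
  | zero =>
    refine sub_eq_zero.mp ?_
    rw [← Ring.lie_def, evalProd, coeff_one_apply]
    split_ifs
    · rw [lie_one_apply]
    · simp [Ring.lie_def]
  | succ k ih =>
    rw [evalProd, Matrix.mul_apply, map_sum]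
    refine Commute.sum_left _ _ _ fun a _ => ?_
    rw [PowerSeries.coeff_mul]
    exact Commute.sum_left _ _ _ fun x _ => Commute.mul_left (ih (by omega) _ _ _)
      (commute_evalMatrix (hc k) (hc q) (fun _ _ _ _ => he _ _ _ _ _ _ (by omega)) _ _ _ _ _ _)

theorem rtt_evalProd (hc : ∀ p x, Commute (c p) x)
    (he : ∀ p q i j h l, e p i j * e q h l - e q h l * e p i j =
      if p = q then (if h = j then e p i l else 0) - (if i = l then e p h j else 0) else 0)
    (k : ℕ) : RTT 1 (evalProd c e k) := by
  induction k with
  | zero => exact rtt_one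
  | succ k ih =>
    refine ih.mul (rtt_evalMatrix (hc k) fun i j h l => by rw [he, if_pos rfl])
      fun i j h l r s => commute_evalProd hc (fun p q i j h l hpq => ?_) le_rfl _ _ _ _ _ _
    exact sub_eq_zero.mp (by rw [he, if_neg hpq])

theorem matCoeff_evalMatrix_zero (c : B) (e : Fin n → Fin n → B) :
    matCoeff (evalMatrix c e) 0 = 1 :=
  Matrix.ext fun i j => coeff_evalMatrix_zero c e i j

theorem matCoeff_evalProd_zero (c : ℕ → B) (e : ℕ → Fin n → Fin n → B) (k : ℕ) :
    matCoeff (evalProd c e k) 0 = 1 := by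
  induction k with
  | zero => rw [evalProd, matCoeff_one, if_pos rfl]
  | succ k ih =>
    rw [evalProd, matCoeff_mul, Finset.HasAntidiagonal.antidiagonal_zero, Finset.sum_singleton, ih,
      matCoeff_evalMatrix_zero, one_mul]

theorem coeff_evalProd_zero (c : ℕ → B) (e : ℕ → Fin n → Fin n → B) (k : ℕ) (i j : Fin n) :
    PowerSeries.coeff 0 (evalProd c e k i j) = (1 : Matrix (Fin n) (Fin n) B) i j :=
  congrFun (congrFun (matCoeff_evalProd_zero c e k) i) j

end Evaluation

/-! ### Degrees and leading coefficients -/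

section Degree

variable {n : ℕ} {R : Type*} [Ring R]

variable (R) in
/-- Polynomials of degree at most `d`. -/
def degLE (d : ℕ) : AddSubgroup (Polynomial R) where
  carrier := {f | f.natDegree ≤ d}
  add_mem' := fun hf hg => (Polynomial.natDegree_add_le _ _).trans (max_le hf hg)
  zero_mem' := by simp
  neg_mem' := fun {f} hf => by simpa using hf

theorem mul_mem_degLE {c d m : ℕ} {f g : Polynomial R} (hf : f ∈ degLE R c)
    (hg : g ∈ degLE R d) (h : c + d ≤ m) : f * g ∈ degLE R m :=
  (Polynomial.natDegree_mul_le_of_le hf hg).trans h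

theorem degLE_mono {c d : ℕ} (h : c ≤ d) : degLE R c ≤ degLE R d :=
  fun f hf => le_trans (show f.natDegree ≤ c from hf) h

theorem one_apply_mem_degLE (i j : Fin n) (d : ℕ) :
    (1 : Matrix (Fin n) (Fin n) (Polynomial R)) i j ∈ degLE R d := by
  rw [Matrix.one_apply]
  split_ifs
  · change (1 : Polynomial R).natDegree ≤ d
    simp
  · exact zero_mem _

/-- The truncated bound `2 * r - 1` is `0` for `r = 0`, where the entries are constants; for
positive `r` it is the degree `2 * (r - 1) + 1` of `c ^ (r - 1) * e`. -/
theorem evalMatrix_mem_degLE {c : Polynomial R} (hc : c.natDegree ≤ 2)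
    {e : Fin n → Fin n → Polynomial R} (he : ∀ i j, (e i j).natDegree ≤ 1) (r : ℕ) (i j : Fin n) :
    PowerSeries.coeff r (evalMatrix c e i j) ∈ degLE R (2 * r - 1) := by
  rcases r with _ | r
  · rw [coeff_evalMatrix_zero]; exact one_apply_mem_degLE _ _ _
  · rw [coeff_evalMatrix_succ]
    exact mul_mem_degLE (Polynomial.natDegree_pow_le_of_le r hc) (he i j) (by omega)

theorem coeff_coeff_evalMatrix {c : Polynomial R} (hc : c.natDegree ≤ 2)
    {e : Fin n → Fin n → Polynomial R} (he : ∀ i j, (e i j).natDegree ≤ 1) (r : ℕ) (i j : Fin n) :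
    Polynomial.coeff (PowerSeries.coeff (r + 1) (evalMatrix c e i j)) (2 * r + 1) =
      c.coeff 2 ^ r * (e i j).coeff 1 := by
  rw [coeff_evalMatrix_succ, mul_comm 2 r, Polynomial.coeff_mul_add_eq_of_natDegree_le
    (Polynomial.natDegree_pow_le_of_le r hc) (he i j), Polynomial.coeff_pow_of_natDegree_le hc]

/-- For positive `p` and `q` with `p + q = r`, the bounds add up to `(2p - 1) + (2q - 1) = 2r - 2`,
so mixed products lose a degree. The estimate for three factors is used with the third equal to `1`.
-/
theorem mul_coeff_sub_mem_degLE
    {M N : Matrix (Fin n) (Fin n) (PowerSeries (Polynomial R))} (hM0 : matCoeff M 0 = 1)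
    (hN0 : matCoeff N 0 = 1) (hM : ∀ r i j, PowerSeries.coeff r (M i j) ∈ degLE R (2 * r - 1))
    (hN : ∀ r i j, PowerSeries.coeff r (N i j) ∈ degLE R (2 * r - 1)) {r : ℕ} (hr : 0 < r)
    (i j : Fin n) :
    PowerSeries.coeff r (M i j) + PowerSeries.coeff r (N i j) - PowerSeries.coeff r ((M * N) i j) ∈
      degLE R (2 * r - 2) := by
  have := coeff_add_sub_mul_mem hM0 hN0
    ((matCoeff_one 0).trans (if_pos rfl) :
      matCoeff (1 : Matrix (Fin n) (Fin n) (PowerSeries (Polynomial R))) 0 = 1)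
    (degLE R (2 * r - 2)) hr
    (fun p q s hp hq hs hpqs i k l j => by
      refine mul_mem_degLE (mul_mem_degLE (hM p i k) (hN q k l) le_rfl) (d := 2 * s - 1) ?_
        (by omega)
      rw [coeff_one_apply]
      split_ifs
      · exact one_apply_mem_degLE _ _ _
      · exact zero_mem _) i j
  rwa [mul_one, coeff_one_apply, if_neg hr.ne', add_zero] at this

variable {c : ℕ → Polynomial R} {e : ℕ → Fin n → Fin n → Polynomial R}

theorem evalProd_mem_degLE (hc : ∀ p, (c p).natDegree ≤ 2) (he : ∀ p i j, (e p i j).natDegree ≤ 1)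
    (k r : ℕ) (i j : Fin n) :
    PowerSeries.coeff r (evalProd c e k i j) ∈ degLE R (2 * r - 1) := by
  induction k generalizing r i j with
  | zero =>
    rw [evalProd, coeff_one_apply]
    split_ifs
    · exact one_apply_mem_degLE _ _ _
    · exact zero_mem _
  | succ k ih =>
    rcases Nat.eq_zero_or_pos r with rfl | hr
    · rw [coeff_evalProd_zero]
      exact one_apply_mem_degLE _ _ _
    · have := mul_coeff_sub_mem_degLE (matCoeff_evalProd_zero c e k)
        (matCoeff_evalMatrix_zero (c k) (e k)) ih (evalMatrix_mem_degLE (hc k) (he k)) hr i j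
      have h2 := sub_mem (add_mem (ih r i j) (evalMatrix_mem_degLE (hc k) (he k) r i j))
        (degLE_mono (by omega) this)
      rwa [sub_sub_cancel] at h2

/-- Mixed products have degree at most `2 * r`, so in degree `2 * r + 1` the product of the matrices
behaves like a sum. -/
theorem coeff_coeff_evalProd (hc : ∀ p, (c p).natDegree ≤ 2)
    (he : ∀ p i j, (e p i j).natDegree ≤ 1) (k r : ℕ) (i j : Fin n) :
    Polynomial.coeff (PowerSeries.coeff (r + 1) (evalProd c e k i j)) (2 * r + 1) =
      ∑ p ∈ Finset.range k, (c p).coeff 2 ^ r * (e p i j).coeff 1 := by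
  induction k generalizing r i j with
  | zero => rw [evalProd, coeff_one_apply, if_neg r.succ_ne_zero]; simp
  | succ k ih =>
    have := mul_coeff_sub_mem_degLE (matCoeff_evalProd_zero c e k)
        (matCoeff_evalMatrix_zero (c k) (e k)) (evalProd_mem_degLE hc he k)
        (evalMatrix_mem_degLE (hc k) (he k)) r.succ_pos i j
    have h2 := Polynomial.coeff_eq_zero_of_natDegree_lt (n := 2 * r + 1)
      (lt_of_le_of_lt (show Polynomial.natDegree _ ≤ _ from this) (by omega))
    rw [Polynomial.coeff_sub, Polynomial.coeff_add, sub_eq_zero, ih,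
      coeff_coeff_evalMatrix (hc k) (he k)] at h2
    rw [evalProd, ← h2, Finset.sum_range_succ]

end Degree

end Yang
end

noncomputable section

namespace Yang

/-! ### The representations and the symbols of the generators. -/

section Representation

variable {n : ℕ}

/-- The central element `p t ^ 2`. -/
def evalPoint (n p : ℕ) : Polynomial (Op n) :=
  Polynomial.C (algebraMap ℂ (Op n) p) * Polynomial.X ^ 2

theorem commute_evalPoint (p : ℕ) (f : Polynomial (Op n)) : Commute (evalPoint n p) f :=
  Commute.mul_left (Algebra.commutes (p : ℂ) f) (Polynomial.commute_X_pow f 2)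

theorem natDegree_evalPoint_le (p : ℕ) : (evalPoint n p).natDegree ≤ 2 :=
  Polynomial.natDegree_C_mul_X_pow_le _ _

theorem natDegree_matUnit_le (p : ℕ) (i j : Fin n) : (matUnit p i j).natDegree ≤ 1 := by
  rw [matUnit, add_comm]; exact Polynomial.natDegree_linear_le

/-- The image of the matrix `T(u)`. -/
def evalT (n k : ℕ) : Matrix (Fin n) (Fin n) (PowerSeries (Polynomial (Op n))) :=
  evalProd (evalPoint n) matUnit k

theorem rtt_evalT (k : ℕ) : RTT 1 (evalT n k) :=
  rtt_evalProd commute_evalPoint matUnit_comm k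

theorem coeff_evalT_zero (k : ℕ) (i j : Fin n) :
    PowerSeries.coeff 0 (evalT n k i j) = if i = j then 1 else 0 := by
  refine (coeff_evalProd_zero _ _ k i j).trans ?_
  rw [Matrix.one_apply]

theorem evalT_mem_degLE (k r : ℕ) (i j : Fin n) :
    PowerSeries.coeff r (evalT n k i j) ∈ degLE (Op n) (2 * r - 1) :=
  evalProd_mem_degLE natDegree_evalPoint_le natDegree_matUnit_le k r i j

/-- The symbol of `T_{i,j}^{(r+1)}`. -/
def symb (k r : ℕ) (i j : Fin n) : Sym n :=
  ∑ p ∈ Finset.range k, MvPolynomial.C ((p : ℂ) ^ r) * MvPolynomial.X (p, i, j)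

theorem coeff_coeff_evalT (k r : ℕ) (i j : Fin n) :
    Polynomial.coeff (PowerSeries.coeff (r + 1) (evalT n k i j)) (2 * r + 1) =
      mulOp (symb k r i j) := by
  refine (coeff_coeff_evalProd natDegree_evalPoint_le natDegree_matUnit_le k r i j).trans ?_
  rw [symb, map_sum]
  refine Finset.sum_congr rfl fun p _ => ?_
  have e1 : (evalPoint n p).coeff 2 = algebraMap ℂ (Op n) p := by
    rw [evalPoint, Polynomial.coeff_C_mul_X_pow, if_pos rfl]
  have e2 : (matUnit p i j).coeff 1 = mulOp (MvPolynomial.X (p, i, j)) := by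
    rw [matUnit, Polynomial.coeff_add, Polynomial.coeff_C_mul_X, if_pos rfl,
      Polynomial.coeff_C_succ, zero_add]
  rw [e1, e2, ← map_pow, map_mul]
  congr 1
  exact (AlgHom.commutes mulOp _).symm

/-- The representations of the Yangian on polynomials in `k` matrices of variables. -/
def rep (n k : ℕ) : Yangian n →ₐ[ℂ] Polynomial (Op n) :=
  RingQuot.liftAlgHom ℂ ⟨FreeAlgebra.lift ℂ fun x : Fin n × Fin n × ℕ+ =>
    PowerSeries.coeff x.2.2 (evalT n k x.1 x.2.1), by
    have key : ∀ i j r, FreeAlgebra.lift ℂ (fun x : Fin n × Fin n × ℕ+ =>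
        PowerSeries.coeff (x.2.2 : ℕ) (evalT n k x.1 x.2.1)) (freeT n i j r) =
        PowerSeries.coeff r (evalT n k i j) := by
      intro i j r
      rcases Nat.eq_zero_or_pos r with rfl | hr
      · rw [freeT, dif_neg (lt_irrefl 0), apply_ite (FreeAlgebra.lift ℂ _), map_one, map_zero]
        exact (coeff_evalT_zero k i j).symm
      · rw [freeT, dif_pos hr, FreeAlgebra.lift_ι_apply]
        rfl
    rintro _ _ ⟨i, j, h, l, r, s⟩
    have := (rtt_evalT k).coeff_rel i j h l r s
    rw [one_smul] at this
    simp only [Ring.lie_def, map_sub, map_mul, key] at this ⊢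
    exact this⟩

theorem rep_T (k : ℕ) (i j : Fin n) (r : ℕ) :
    rep n k (T n i j r) = PowerSeries.coeff r (evalT n k i j) := by
  rcases Nat.eq_zero_or_pos r with rfl | hr
  · rw [T_zero, apply_ite (rep n k), map_one, map_zero]
    exact (coeff_evalT_zero k i j).symm
  · rw [T, freeT, dif_pos hr]
    refine (RingQuot.liftAlgHom_mkAlgHom_apply _ _ _ _).trans ?_
    rw [FreeAlgebra.lift_ι_apply]
    rfl

/-- An algebra homomorphism that maps the symbols to independent variables. -/
theorem exists_desymb (k : ℕ) : ∃ Φ : Sym n →ₐ[ℂ] Sym n, ∀ r < k, ∀ i j,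
    Φ (symb k r i j) = MvPolynomial.X (r, i, j) := by
  -- The symbols with `r < k` arise from the variables by the Vandermonde matrix of the distinct
  -- points `0, …, k - 1`; `Φ` substitutes its inverse.
  set V : Matrix (Fin k) (Fin k) ℂ := Matrix.vandermonde fun p => ((p : ℕ) : ℂ) with hV
  have hdet : IsUnit V.det := by
    rw [isUnit_iff_ne_zero, hV, Matrix.det_vandermonde_ne_zero_iff]
    exact fun p q h => Fin.ext (Nat.cast_injective h)
  have hinv := Matrix.nonsing_inv_mul V hdet
  refine ⟨MvPolynomial.aeval fun v => if hv : v.1 < k then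
    ∑ q : Fin k, MvPolynomial.C (V⁻¹ q ⟨v.1, hv⟩) * MvPolynomial.X ((q : ℕ), v.2.1, v.2.2) else 0,
    fun r hr i j => ?_⟩
  rw [symb, ← Fin.sum_univ_eq_sum_range
    (fun p => MvPolynomial.C ((p : ℂ) ^ r) * MvPolynomial.X (p, i, j)) k, map_sum]
  have : ∀ p : Fin k, (MvPolynomial.aeval fun v : ℕ × Fin n × Fin n => if hv : v.1 < k then
    ∑ q : Fin k, MvPolynomial.C (V⁻¹ q ⟨v.1, hv⟩) * MvPolynomial.X ((q : ℕ), v.2.1, v.2.2) else 0)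
      (MvPolynomial.C (((p : ℕ) : ℂ) ^ r) * MvPolynomial.X ((p : ℕ), i, j) : Sym n) =
      ∑ q : Fin k, MvPolynomial.C (V⁻¹ q p * V p ⟨r, hr⟩) * MvPolynomial.X ((q : ℕ), i, j) := by
    intro p
    rw [map_mul, MvPolynomial.aeval_X, dif_pos p.2, MvPolynomial.aeval_C, Finset.mul_sum]
    refine Finset.sum_congr rfl fun q _ => ?_
    rw [← mul_assoc, MvPolynomial.algebraMap_eq, ← map_mul, mul_comm (_ ^ r)]
    rfl
  rw [Finset.sum_congr rfl fun p _ => this p, Finset.sum_comm]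
  have e : ∀ q : Fin k, ∑ p, (MvPolynomial.C (V⁻¹ q p * V p ⟨r, hr⟩) *
      MvPolynomial.X ((q : ℕ), i, j) : Sym n) =
      if q = ⟨r, hr⟩ then MvPolynomial.X ((q : ℕ), i, j) else 0 := by
    intro q
    rw [← Finset.sum_mul, ← map_sum, ← Matrix.mul_apply, hinv, Matrix.one_apply]
    split_ifs <;> simp
  rw [Finset.sum_congr rfl fun q _ => e q, Finset.sum_ite_eq' , if_pos (Finset.mem_univ _)]

end Representation

end Yang
end

noncomputable section

namespace Yang

/-! ### Linear independence of ordered monomials. -/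

section Independence

variable {n : ℕ}

theorem prod_X_eq_monomial {σ : Type*} [DecidableEq σ] (s : Multiset σ) :
    (s.map (MvPolynomial.X (R := ℂ))).prod = MvPolynomial.monomial (Multiset.toFinsupp s) 1 := by
  induction s using Multiset.induction with
  | empty => simp
  | cons a s ih =>
    rw [Multiset.map_cons, Multiset.prod_cons, ih, ← Multiset.singleton_add, map_add,
      Multiset.toFinsupp_singleton, MvPolynomial.X, MvPolynomial.monomial_mul, one_mul]

theorem linearIndependent_prod_X {I σ : Type*} {lab : I → σ} (hlab : Function.Injective lab) :
    LinearIndependent ℂ fun s : Multiset I =>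
      (s.map fun i => (MvPolynomial.X (lab i) : MvPolynomial σ ℂ)).prod := by
  classical
  have h := (MvPolynomial.basisMonomials σ ℂ).linearIndependent.comp
    (fun s : Multiset I => Multiset.toFinsupp (s.map lab))
    (Multiset.toFinsupp.injective.comp (Multiset.map_injective hlab))
  have e : (fun s : Multiset I => (s.map fun i => (MvPolynomial.X (lab i) : MvPolynomial σ ℂ)).prod) =
      MvPolynomial.basisMonomials σ ℂ ∘ fun s => Multiset.toFinsupp (s.map lab) := by
    funext s
    rw [Function.comp_apply, MvPolynomial.coe_basisMonomials]
    refine Eq.trans ?_ (prod_X_eq_monomial (s.map lab))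
    rw [Multiset.map_map]
    rfl
  rw [e]
  exact h

variable {R : Type*} [Ring R] {I : Type*}

theorem natDegree_list_prod_le {d : I → ℕ} {y : I → Polynomial R} (hy : ∀ i, y i ∈ degLE R (d i))
    (l : List I) : (l.map y).prod ∈ degLE R (l.map d).sum := by
  induction l with
  | nil => exact Polynomial.natDegree_one.le
  | cons i l ih =>
    simp only [List.map_cons, List.prod_cons, List.sum_cons]
    exact mul_mem_degLE (hy i) ih le_rfl

theorem coeff_list_prod {d : I → ℕ} {y : I → Polynomial R} (hy : ∀ i, y i ∈ degLE R (d i))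
    (l : List I) : (l.map y).prod.coeff (l.map d).sum = (l.map fun i => (y i).coeff (d i)).prod := by
  induction l with
  | nil => simp
  | cons i l ih =>
    rw [List.map_cons, List.prod_cons, List.map_cons, List.sum_cons, List.map_cons, List.prod_cons,
      Polynomial.coeff_mul_add_eq_of_natDegree_le (hy i) (natDegree_list_prod_le hy l), ih]

theorem mulOp_injective : Function.Injective (mulOp (n := n)) := by
  intro f g h
  have := LinearMap.congr_fun h 1
  simpa [mulOp] using this

/-- Ordered monomials in elements of the Yangian with the same leading terms as distinct
generators `T_{i,j}^{(r+1)}` are linearly independent. -/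
theorem linearIndependent_orderedMonomial (lo : LinearOrder I) (x : I → Yangian n)
    (lab : I → ℕ × Fin n × Fin n) (hlab : Function.Injective lab)
    (hx : ∀ k i, rep n k (x i - T n (lab i).2.1 (lab i).2.2 ((lab i).1 + 1)) ∈
      degLE (Op n) (2 * (lab i).1)) :
    LinearIndependent ℂ (orderedMonomial lo x) := by
  classical
  set d : I → ℕ := fun i => 2 * (lab i).1 + 1 with hd
  have hdeg : ∀ k i, rep n k (x i) ∈ degLE (Op n) (d i) := by
    intro k i
    have h1 := degLE_mono (d := d i) (by simp [hd]) (hx k i)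
    have h2 := evalT_mem_degLE k ((lab i).1 + 1) (lab i).2.1 (lab i).2.2
    rw [← rep_T] at h2
    have h3 := add_mem h1 (degLE_mono (d := d i) (by simp [hd]; omega) h2)
    rwa [← map_add, sub_add_cancel] at h3
  have htop : ∀ k i, (rep n k (x i)).coeff (d i) =
      mulOp (symb k (lab i).1 (lab i).2.1 (lab i).2.2) := by
    intro k i
    have h1 := Polynomial.coeff_eq_zero_of_natDegree_lt
      (lt_of_le_of_lt (show Polynomial.natDegree _ ≤ _ from hx k i) (Nat.lt_succ_self _))
    rw [map_sub, Polynomial.coeff_sub, sub_eq_zero, rep_T] at h1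
    exact h1.trans (coeff_coeff_evalT _ _ _ _)
  have hmon : ∀ k s, rep n k (orderedMonomial lo x s) =
      ((s.sort (fun i j => i ≤ j)).map fun i => rep n k (x i)).prod := by
    intro k s
    rw [orderedMonomial, map_list_prod, List.map_map]
    rfl
  set wt : Multiset I → ℕ := fun s => (s.map d).sum with hwt
  have hsort : ∀ s : Multiset I, ((s.sort (fun i j => i ≤ j)).map d).sum = wt s := by
    intro s
    rw [hwt, ← Multiset.sum_coe, ← Multiset.map_coe, Multiset.sort_eq]
  have hmdeg : ∀ k s, (rep n k (orderedMonomial lo x s)).natDegree ≤ wt s := by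
    intro k s
    rw [hmon, ← hsort]
    exact natDegree_list_prod_le (hdeg k) _
  have hmtop : ∀ k s, (rep n k (orderedMonomial lo x s)).coeff (wt s) =
      mulOp (s.map fun i => symb k (lab i).1 (lab i).2.1 (lab i).2.2).prod := by
    intro k s
    rw [hmon, ← hsort, coeff_list_prod (hdeg k), List.map_congr_left fun i _ => htop k i]
    conv_rhs => rw [← Multiset.sort_eq s (fun i j => i ≤ j)]
    rw [Multiset.map_coe, Multiset.prod_coe, map_list_prod, List.map_map]
    rfl
  rw [linearIndependent_iff']
  intro S g hg t ht
  by_contra hgt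
  -- The coefficient of `t ^ wt m` is examined for a monomial `m` of largest weight among those that
  -- occur, so lighter monomials do not contribute.
  obtain ⟨m, hm, hmax⟩ := (S.filter fun s => g s ≠ 0).exists_max_image wt
    ⟨t, Finset.mem_filter.mpr ⟨ht, hgt⟩⟩
  obtain ⟨hmS, hgm⟩ := Finset.mem_filter.mp hm
  -- This `k` exceeds the first label component of every letter in `S`, so `Φ` sends each symbol
  -- that occurs to a variable.
  set k := S.sup fun s => (s.map fun i => (lab i).1 + 1).sum with hk
  have hlt : ∀ s ∈ S, ∀ i ∈ s, (lab i).1 < k := by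
    intro s hs i hi
    have h1 := Multiset.single_le_sum (s := s.map fun i => (lab i).1 + 1)
      (fun _ _ => Nat.zero_le _) _ (Multiset.mem_map_of_mem (fun i => (lab i).1 + 1) hi)
    have h2 := Finset.le_sup (f := fun s : Multiset I => (s.map fun i => (lab i).1 + 1).sum) hs
    exact lt_of_lt_of_le (Nat.lt_succ_self _) (h1.trans h2)
  obtain ⟨Φ, hΦ⟩ := exists_desymb (n := n) k
  have h1 := congrArg (fun f => Polynomial.coeff (rep n k f) (wt m)) hg
  simp only [map_sum, map_smul, map_zero, Polynomial.finsetSum_coeff, Polynomial.coeff_smul,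
    Polynomial.coeff_zero] at h1
  have h2 : ∀ s ∈ S, g s • (rep n k (orderedMonomial lo x s)).coeff (wt m) =
      mulOp ((if wt s = wt m then g s else 0) •
        (s.map fun i => symb k (lab i).1 (lab i).2.1 (lab i).2.2).prod) := by
    intro s hs
    by_cases hgs : g s = 0
    · simp [hgs]
    rcases (hmax s (Finset.mem_filter.mpr ⟨hs, hgs⟩)).lt_or_eq with h | h
    · rw [if_neg h.ne, zero_smul, map_zero,
        Polynomial.coeff_eq_zero_of_natDegree_lt (lt_of_le_of_lt (hmdeg k s) h), smul_zero]
    · rw [if_pos h, ← h, hmtop, map_smul]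
  rw [Finset.sum_congr rfl h2, ← map_sum, map_eq_zero_iff _ mulOp_injective] at h1
  have h3 := congrArg Φ h1
  rw [map_sum, map_zero] at h3
  have h4 : ∀ s ∈ S, Φ ((if wt s = wt m then g s else 0) •
        (s.map fun i => symb k (lab i).1 (lab i).2.1 (lab i).2.2).prod) =
      (if wt s = wt m then g s else 0) • (s.map fun i => MvPolynomial.X (lab i)).prod := by
    intro s hs
    rw [map_smul, map_multiset_prod, Multiset.map_map]
    congr 2
    exact Multiset.map_congr rfl fun i hi => hΦ _ (hlt s hs i hi) _ _
  rw [Finset.sum_congr rfl h4] at h3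
  have h5 := linearIndependent_iff'.mp (linearIndependent_prod_X hlab) S _ h3 m hmS
  rw [if_pos rfl] at h5
  exact hgm h5

end Independence

end Yang
end

noncomputable section

namespace Yang

/-! ### Block generators as coefficients of the Gauss factors. -/

section BlockGenerators

variable {n : ℕ}

theorem T_rel (i j h l : Fin n) (r s : ℕ) :
    ⁅T n i j (r + 1), T n h l s⁆ - ⁅T n i j r, T n h l (s + 1)⁆ =
      T n h j r * T n i l s - T n h j s * T n i l r := by
  have := RingQuot.mkAlgHom_rel ℂ (Rel.rtt (n := n) i j h l r s)
  change proj n _ = proj n _ at this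
  simp only [Ring.lie_def, map_sub, map_mul] at this ⊢
  exact this

variable (ν : Composition n)

theorem coeff_blockT (x y : Pos ν) (r : ℕ) : PowerSeries.coeff r (blockT ν x y) =
    T n (ν.embedding x.1 x.2) (ν.embedding y.1 y.2) r := by
  rw [blockT, Matrix.of_apply, PowerSeries.coeff_mk]

theorem rtt_blockT : RTT 1 (blockT ν) := by
  refine RTT.of_coeff (fun i j h l s => ?_) fun i j h l r s => ?_
  · rw [coeff_blockT, T_zero, Ring.lie_def]
    split_ifs <;> simp
  · simp only [coeff_blockT, one_smul]
    exact T_rel _ _ _ _ _ _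

/-- `upper_recursion` holds through any index of the intermediate block, in particular through the
first one, which `EE` uses. -/
theorem EE_eq (a : ℕ) (ha : a < ν.length) (i : Fin (ν.blocksFun ⟨a, ha⟩)) (r b : ℕ)
    (hb : b < ν.length) (j : Fin (ν.blocksFun ⟨b, hb⟩)) (hab : a < b) :
    EE ν a ha i r b hb j = PowerSeries.coeff r ((gauss ν).2.2 ⟨⟨a, ha⟩, i⟩ ⟨⟨b, hb⟩, j⟩) := by
  induction b with
  | zero => omega
  | succ b ih =>
    rw [EE]
    split_ifs with h
    · subst h; rfl
    · rw [ih _ _ (by omega)]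
      exact ((isBlockGauss_gauss ν).upper_recursion (matCoeff_blockT_zero ν) (rtt_blockT ν)
        (h := ⟨⟨a, ha⟩, i⟩) (i := ⟨⟨b, b.lt_succ_self.trans hb⟩, firstIdx ν _⟩) (q := ⟨⟨b + 1, hb⟩, j⟩)
        (Fin.mk_lt_mk.mpr (by omega)) (Fin.mk_lt_mk.mpr (by omega)) r).symm

theorem FF_eq (a : ℕ) (ha : a < ν.length) (i : Fin (ν.blocksFun ⟨a, ha⟩)) (r b : ℕ)
    (hb : b < ν.length) (j : Fin (ν.blocksFun ⟨b, hb⟩)) (hab : a < b) :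
    FF ν a ha i r b hb j = PowerSeries.coeff r ((gauss ν).1 ⟨⟨b, hb⟩, j⟩ ⟨⟨a, ha⟩, i⟩) := by
  induction b with
  | zero => omega
  | succ b ih =>
    rw [FF]
    split_ifs with h
    · subst h; rfl
    · rw [ih _ _ (by omega)]
      exact ((isBlockGauss_gauss ν).lower_recursion (matCoeff_blockT_zero ν) (rtt_blockT ν)
        (h := ⟨⟨a, ha⟩, i⟩) (i := ⟨⟨b, b.lt_succ_self.trans hb⟩, firstIdx ν _⟩) (q := ⟨⟨b + 1, hb⟩, j⟩)
        (Fin.mk_lt_mk.mpr (by omega)) (Fin.mk_lt_mk.mpr (by omega)) r).symm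

/-- Both iterated commutators are coefficients of `E`, and these obey the recursion through any `k`.
-/
theorem EE_succ (a b : ℕ) (hab : a < b) (hb : b + 1 < ν.length)
    (i : Fin (ν.blocksFun ⟨a, hab.trans (b.lt_succ_self.trans hb)⟩))
    (k : Fin (ν.blocksFun ⟨b, b.lt_succ_self.trans hb⟩)) (j : Fin (ν.blocksFun ⟨b + 1, hb⟩)) (r : ℕ) :
    EE ν a (hab.trans (b.lt_succ_self.trans hb)) i r (b + 1) hb j =
      ⁅EE ν a (hab.trans (b.lt_succ_self.trans hb)) i r b (b.lt_succ_self.trans hb) k,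
        E ν b hb k j 1⁆ := by
  rw [EE_eq ν _ _ _ _ _ _ _ (by omega), EE_eq ν _ _ _ _ _ _ _ hab]
  exact (isBlockGauss_gauss ν).upper_recursion (matCoeff_blockT_zero ν) (rtt_blockT ν)
    (Fin.mk_lt_mk.mpr hab) (Fin.mk_lt_mk.mpr b.lt_succ_self) r

theorem FF_succ (a b : ℕ) (hab : a < b) (hb : b + 1 < ν.length)
    (i : Fin (ν.blocksFun ⟨a, hab.trans (b.lt_succ_self.trans hb)⟩))
    (k : Fin (ν.blocksFun ⟨b, b.lt_succ_self.trans hb⟩)) (j : Fin (ν.blocksFun ⟨b + 1, hb⟩)) (r : ℕ) :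
    FF ν a (hab.trans (b.lt_succ_self.trans hb)) i r (b + 1) hb j =
      ⁅F ν b hb j k 1,
        FF ν a (hab.trans (b.lt_succ_self.trans hb)) i r b (b.lt_succ_self.trans hb) k⁆ := by
  rw [FF_eq ν _ _ _ _ _ _ _ (by omega), FF_eq ν _ _ _ _ _ _ _ hab]
  exact (isBlockGauss_gauss ν).lower_recursion (matCoeff_blockT_zero ν) (rtt_blockT ν)
    (Fin.mk_lt_mk.mpr hab) (Fin.mk_lt_mk.mpr b.lt_succ_self) r

theorem EFamily_eq (x : EIndex ν) :
    EFamily ν x = PowerSeries.coeff x.r ((gauss ν).2.2 ⟨x.a, x.i⟩ ⟨x.b, x.j⟩) :=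
  EE_eq ν _ _ _ _ _ _ _ x.lt

theorem FFamily_eq (x : FIndex ν) :
    FFamily ν x = PowerSeries.coeff x.r ((gauss ν).1 ⟨x.b, x.i⟩ ⟨x.a, x.j⟩) :=
  FF_eq ν _ _ _ _ _ _ _ x.lt

/-! ### Leading terms -/

/-- The filtration of the Yangian by the degree in a representation. -/
def repFiltration (n k m : ℕ) : AddSubgroup (Yangian n) :=
  (degLE (Op n) (2 * (m - 1) - 1)).comap (rep n k).toAddMonoidHom

theorem isFiltration_repFiltration (k : ℕ) : IsFiltration (repFiltration n k) where
  one_mem := by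
    change (rep n k 1).natDegree ≤ _
    rw [map_one, Polynomial.natDegree_one]
  mul_mem := fun a b x y hx hy => by
    change rep n k (x * y) ∈ degLE _ _
    rw [map_mul]
    exact mul_mem_degLE (show rep n k x ∈ degLE _ _ from hx) (show rep n k y ∈ degLE _ _ from hy)
      (by omega)
  le_succ := fun m => AddSubgroup.comap_mono (degLE_mono (by omega))

theorem gauss_mem_repFiltration (k r : ℕ) (x y : Pos ν) :
    PowerSeries.coeff r ((gauss ν).1 x y) ∈ repFiltration n k (r + 1) ∧
      PowerSeries.coeff r ((gauss ν).2.1 x y) ∈ repFiltration n k (r + 1) ∧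
      PowerSeries.coeff r ((gauss ν).2.2 x y) ∈ repFiltration n k (r + 1) := by
  refine (isFiltration_repFiltration k).coeff_gauss_mem (isBlockGauss_gauss ν)
    (matCoeff_blockT_zero ν) (fun r x y => ?_) r x y
  rw [coeff_blockT]
  change rep n k _ ∈ degLE _ _
  rw [rep_T]
  exact evalT_mem_degLE k r _ _

/-- In a product of total degree `r` whose three factors have degree below `r`, at least two degrees
are positive, and each positive degree `p` contributes at most `2p - 1`. -/
theorem rep_gauss_sub_mem (k : ℕ) {r : ℕ} (hr : 0 < r) (x y : Pos ν) :
    rep n k (PowerSeries.coeff r ((gauss ν).1 x y) + PowerSeries.coeff r ((gauss ν).2.1 x y) +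
      PowerSeries.coeff r ((gauss ν).2.2 x y) -
        T n (ν.embedding x.1 x.2) (ν.embedding y.1 y.2) r) ∈ degLE (Op n) (2 * (r - 1)) := by
  rw [← coeff_blockT]
  refine (isBlockGauss_gauss ν).coeff_sub_mem (matCoeff_blockT_zero ν)
    ((degLE (Op n) (2 * (r - 1))).comap (rep n k).toAddMonoidHom) hr
    (fun p q s hp hq hs hpqs i j l m => ?_) x y
  change rep n k (_ * _ * _) ∈ degLE _ _
  rw [map_mul, map_mul]
  have h1 : rep n k _ ∈ degLE _ _ := (gauss_mem_repFiltration ν k p i j).1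
  have h2 : rep n k _ ∈ degLE _ _ := (gauss_mem_repFiltration ν k q j l).2.1
  have h3 : rep n k _ ∈ degLE _ _ := (gauss_mem_repFiltration ν k s l m).2.2
  exact mul_mem_degLE (mul_mem_degLE h1 h2 le_rfl) h3 (by omega)

/-- The row and the column of a matrix entry, and its degree. -/
def allLabel : DIndex ν ⊕ EIndex ν ⊕ FIndex ν → Pos ν × Pos ν × ℕ+
  | .inl x => (⟨x.a, x.i⟩, ⟨x.a, x.j⟩, x.r)
  | .inr (.inl x) => (⟨x.a, x.i⟩, ⟨x.b, x.j⟩, x.r)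
  | .inr (.inr x) => (⟨x.b, x.i⟩, ⟨x.a, x.j⟩, x.r)

theorem allLabel_injective : Function.Injective (allLabel ν) := by
  rintro (⟨a, i, j, r⟩ | ⟨a, b, h, i, j, r⟩ | ⟨a, b, h, i, j, r⟩)
    (⟨a', i', j', r'⟩ | ⟨a', b', h', i', j', r'⟩ | ⟨a', b', h', i', j', r'⟩) e
  all_goals
    have e1 := congrArg (fun z => z.1) e
    have e2 := congrArg (fun z => z.2.1) e
    have e3 := congrArg (fun z => z.2.2) e
    simp only [allLabel, Sigma.mk.injEq] at e1 e2 e3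
    obtain ⟨rfl, e1⟩ := e1
    obtain ⟨e2, e2'⟩ := e2
    first
    | (obtain rfl := eq_of_heq e1; obtain rfl := eq_of_heq e2'; subst e3; rfl)
    | (obtain rfl := e2; first | exact absurd h (lt_irrefl _) | exact absurd h' (lt_irrefl _) |
        exact absurd h (lt_asymm h') |
        (obtain rfl := eq_of_heq e1; obtain rfl := eq_of_heq e2'; subst e3; rfl))

/-- At the position of a label only one of the three factors has a nonzero coefficient of positive
degree. The sum makes the comparison with `T` uniform in the three families. -/
theorem allFamily_eq (x : DIndex ν ⊕ EIndex ν ⊕ FIndex ν) :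
    allFamily ν x =
      PowerSeries.coeff (allLabel ν x).2.2 ((gauss ν).1 (allLabel ν x).1 (allLabel ν x).2.1) +
      PowerSeries.coeff (allLabel ν x).2.2 ((gauss ν).2.1 (allLabel ν x).1 (allLabel ν x).2.1) +
      PowerSeries.coeff (allLabel ν x).2.2 ((gauss ν).2.2 (allLabel ν x).1 (allLabel ν x).2.1) := by
  have hG := isBlockGauss_gauss ν
  have hr := PNat.pos (allLabel ν x).2.2
  have hD : ∀ p q : Pos ν, p.1 ≠ q.1 → ∀ r, PowerSeries.coeff r ((gauss ν).2.1 p q) = 0 :=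
    fun p q h r => by rw [hG.diag p q h, map_zero]
  rcases x with x | x | x
  · have h1 := hG.coeff_lower_eq_zero hr (i := ⟨x.a, x.i⟩) (j := ⟨x.a, x.j⟩) le_rfl
    have h2 := hG.coeff_upper_eq_zero hr (i := ⟨x.a, x.i⟩) (j := ⟨x.a, x.j⟩) le_rfl
    refine Eq.trans ?_ (congrArg₂ _ (congrArg₂ _ h1.symm rfl) h2.symm)
    rw [zero_add, add_zero]
    rfl
  · have h1 := hG.coeff_lower_eq_zero hr (i := ⟨x.a, x.i⟩) (j := ⟨x.b, x.j⟩) x.lt.le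
    have h2 := hD ⟨x.a, x.i⟩ ⟨x.b, x.j⟩ x.lt.ne x.r
    refine Eq.trans ?_ (congrArg₂ _ (congrArg₂ _ h1.symm h2.symm) rfl)
    rw [zero_add, zero_add]
    exact EFamily_eq ν x
  · have h1 := hG.coeff_upper_eq_zero hr (i := ⟨x.b, x.i⟩) (j := ⟨x.a, x.j⟩) x.lt.le
    have h2 := hD ⟨x.b, x.i⟩ ⟨x.a, x.j⟩ x.lt.ne' x.r
    refine Eq.trans ?_ (congrArg₂ _ (congrArg₂ _ rfl h2.symm) h1.symm)
    rw [add_zero, add_zero]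
    exact FFamily_eq ν x

/-- Ordered monomials in part of the generators are linearly independent. -/
theorem linearIndependent_allFamily_comp {J : Type*} (lo : LinearOrder J)
    (f : J → DIndex ν ⊕ EIndex ν ⊕ FIndex ν) (hf : Function.Injective f) :
    LinearIndependent ℂ (orderedMonomial lo (allFamily ν ∘ f)) := by
  -- The shift `r - 1` matches the labelling by `T^{(r+1)}`; truncation does no harm because `r ≥
  -- 1`.
  have hinj : Function.Injective fun z : Pos ν × Pos ν × ℕ+ =>
      ((z.2.2 : ℕ) - 1, ν.embedding z.1.1 z.1.2, ν.embedding z.2.1.1 z.2.1.2) := by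
    rintro ⟨x, y, r⟩ ⟨x', y', r'⟩ e
    simp only [Prod.mk.injEq] at e
    obtain ⟨e1, e2, e3⟩ := e
    have e2' := ν.blocksFinEquiv.injective (a₁ := x) (a₂ := x') e2
    have e3' := ν.blocksFinEquiv.injective (a₁ := y) (a₂ := y') e3
    have hr := r.pos
    have hr' := r'.pos
    rw [e2', e3', PNat.coe_injective (show (r : ℕ) = r' by omega)]
  refine linearIndependent_orderedMonomial lo _ _ (hinj.comp ((allLabel_injective ν).comp hf))
    fun k i => ?_
  have := rep_gauss_sub_mem ν k (allLabel ν (f i)).2.2.pos (allLabel ν (f i)).1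
    (allLabel ν (f i)).2.1
  rw [← allFamily_eq] at this
  have e := Nat.sub_add_cancel (allLabel ν (f i)).2.2.pos
  simp only [Function.comp_apply]
  rw [e]
  exact this

end BlockGenerators

end Yang
end

noncomputable section

namespace Yang

/-! ### Spanning by ordered monomials. -/

section Spanning

variable {n : ℕ} (ν : Composition n)

theorem IsFiltration.coeff_zero_mem {A ι : Type*} [Ring A] [DecidableEq ι] {P : ℕ → AddSubgroup A}
    (hP : IsFiltration P) {M : Matrix ι ι (PowerSeries A)} (h0 : matCoeff M 0 = 1) (i j : ι) :
    PowerSeries.coeff 0 (M i j) ∈ P 1 := by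
  have e : PowerSeries.coeff 0 (M i j) = (1 : Matrix ι ι A) i j := congrFun (congrFun h0 i) j
  rw [e, Matrix.one_apply]
  split_ifs
  · exact hP.one_mem
  · exact zero_mem _

/-- The filtration consists of the spans of words in the family itself, so the estimate for
commutators stays inside the family. -/
theorem straightens_DFamily : Straightens (DFamily ν) fun x => x.r := by
  have hG := isBlockGauss_gauss ν
  have h0 := matCoeff_blockT_zero ν
  have hP : IsFiltration fun m => (wordSpan (DFamily ν) (fun x => (x.r : ℕ)) m).toAddSubgroup :=
    isFiltration_wordSpan
  intro x y
  refine hP.comm_diag_mem hG h0 (rtt_blockT ν) (fun r i j hij => ?_) (i := ⟨x.a, x.i⟩)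
    (j := ⟨x.a, x.j⟩) (h := ⟨y.a, y.i⟩) (l := ⟨y.a, y.j⟩) rfl rfl x.r y.r
  rcases Nat.eq_zero_or_pos r with rfl | hr
  · exact hP.coeff_zero_mem (hG.coeff_zero h0).2.1 i j
  · obtain ⟨a, i⟩ := i
    obtain ⟨a', j⟩ := j
    obtain rfl : a = a' := hij
    exact mem_wordSpan (x := DFamily ν) (w := fun x => (x.r : ℕ)) ⟨a, i, j, ⟨r, hr⟩⟩

theorem straightens_EFamily : Straightens (EFamily ν) fun x => x.r := by
  have hG := isBlockGauss_gauss ν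
  have h0 := matCoeff_blockT_zero ν
  have hP : IsFiltration fun m => (wordSpan (EFamily ν) (fun x => (x.r : ℕ)) m).toAddSubgroup :=
    isFiltration_wordSpan
  intro x y
  have := hP.comm_upper_mem hG h0 (rtt_blockT ν) (fun r i j => ?_) (i := ⟨x.a, x.i⟩)
    (j := ⟨x.b, x.j⟩) (h := ⟨y.a, y.i⟩) (l := ⟨y.b, y.j⟩) x.lt y.lt x.r y.r
  · rw [← EFamily_eq, ← EFamily_eq] at this
    exact this
  rcases Nat.eq_zero_or_pos r with rfl | hr
  · exact hP.coeff_zero_mem (hG.coeff_zero h0).2.2 i j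
  rcases le_or_gt j.1 i.1 with hij | hij
  · rw [hG.coeff_upper_eq_zero hr hij]; exact zero_mem _
  · have := mem_wordSpan (x := EFamily ν) (w := fun x => (x.r : ℕ)) ⟨i.1, j.1, hij, i.2, j.2, ⟨r, hr⟩⟩
    rw [EFamily_eq] at this
    exact this

theorem straightens_FFamily : Straightens (FFamily ν) fun x => x.r := by
  have hG := isBlockGauss_gauss ν
  have h0 := matCoeff_blockT_zero ν
  have hP : IsFiltration fun m => (wordSpan (FFamily ν) (fun x => (x.r : ℕ)) m).toAddSubgroup :=
    isFiltration_wordSpan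
  intro x y
  have := hP.comm_lower_mem hG h0 (rtt_blockT ν) (fun r i j => ?_) (i := ⟨x.b, x.i⟩)
    (j := ⟨x.a, x.j⟩) (h := ⟨y.b, y.i⟩) (l := ⟨y.a, y.j⟩) x.lt y.lt x.r y.r
  · rw [← FFamily_eq, ← FFamily_eq] at this
    exact this
  rcases Nat.eq_zero_or_pos r with rfl | hr
  · exact hP.coeff_zero_mem (hG.coeff_zero h0).1 i j
  rcases le_or_gt i.1 j.1 with hij | hij
  · rw [hG.coeff_lower_eq_zero hr hij]; exact zero_mem _
  · have := mem_wordSpan (x := FFamily ν) (w := fun x => (x.r : ℕ)) ⟨j.1, i.1, hij, i.2, j.2, ⟨r, hr⟩⟩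
    rw [FFamily_eq] at this
    exact this

theorem adjoin_range_DFamily : Algebra.adjoin ℂ (Set.range (DFamily ν)) = levi ν := by
  refine le_antisymm (Algebra.adjoin_mono ?_) (Algebra.adjoin_le ?_)
  · rintro _ ⟨x, rfl⟩
    exact ⟨x.a, x.i, x.j, x.r, rfl⟩
  · rintro _ ⟨a, i, j, r, rfl⟩
    -- The generators of `levi` include `r = 0`, where they are `0` or `1`.
    rcases Nat.eq_zero_or_pos r with rfl | hr
    · have e : D ν a i j 0 = (1 : Matrix (Pos ν) (Pos ν) (Yangian n)) ⟨a, i⟩ ⟨a, j⟩ :=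
        congrFun (congrFun ((isBlockGauss_gauss ν).coeff_zero (matCoeff_blockT_zero ν)).2.1 _) _
      rw [e, Matrix.one_apply]
      split_ifs
      · exact one_mem _
      · exact zero_mem _
    · exact Algebra.subset_adjoin ⟨⟨a, i, j, ⟨r, hr⟩⟩, rfl⟩

theorem lie_mem_subalgebra {A : Type*} [Ring A] [Algebra ℂ A] (S : Subalgebra ℂ A) {x y : A}
    (hx : x ∈ S) (hy : y ∈ S) : ⁅x, y⁆ ∈ S := by
  rw [Ring.lie_def]
  exact sub_mem (mul_mem hx hy) (mul_mem hy hx)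

theorem EE_mem_plus (a : ℕ) (ha : a < ν.length) (i : Fin (ν.blocksFun ⟨a, ha⟩)) (r : ℕ) (hr : 1 ≤ r)
    (b : ℕ) (hb : b < ν.length) (j : Fin (ν.blocksFun ⟨b, hb⟩)) : EE ν a ha i r b hb j ∈ plus ν := by
  induction b with
  | zero => exact zero_mem _
  | succ b ih =>
    rw [EE]
    split_ifs with h
    · exact Algebra.subset_adjoin ⟨_, _, _, _, r, hr, rfl⟩
    · exact lie_mem_subalgebra _ (ih _ _) (Algebra.subset_adjoin ⟨_, _, _, _, 1, le_rfl, rfl⟩)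

theorem FF_mem_minus (a : ℕ) (ha : a < ν.length) (i : Fin (ν.blocksFun ⟨a, ha⟩)) (r : ℕ)
    (hr : 1 ≤ r) (b : ℕ) (hb : b < ν.length) (j : Fin (ν.blocksFun ⟨b, hb⟩)) :
    FF ν a ha i r b hb j ∈ minus ν := by
  induction b with
  | zero => exact zero_mem _
  | succ b ih =>
    rw [FF]
    split_ifs with h
    · exact Algebra.subset_adjoin ⟨_, _, _, _, r, hr, rfl⟩
    · exact lie_mem_subalgebra _ (Algebra.subset_adjoin ⟨_, _, _, _, 1, le_rfl, rfl⟩) (ih _ _)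

theorem adjoin_range_EFamily : Algebra.adjoin ℂ (Set.range (EFamily ν)) = plus ν := by
  refine le_antisymm (Algebra.adjoin_le ?_) (Algebra.adjoin_mono ?_)
  · rintro _ ⟨x, rfl⟩
    exact EE_mem_plus ν _ _ _ _ x.r.pos _ _ _
  · rintro _ ⟨a, ha, i, j, r, hr, rfl⟩
    exact ⟨⟨⟨a, a.lt_succ_self.trans ha⟩, ⟨a + 1, ha⟩, Fin.mk_lt_mk.mpr a.lt_succ_self, i, j, ⟨r, hr⟩⟩,
      EFamily_eq ν _⟩

theorem adjoin_range_FFamily : Algebra.adjoin ℂ (Set.range (FFamily ν)) = minus ν := by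
  refine le_antisymm (Algebra.adjoin_le ?_) (Algebra.adjoin_mono ?_)
  · rintro _ ⟨x, rfl⟩
    exact FF_mem_minus ν _ _ _ _ x.r.pos _ _ _
  · rintro _ ⟨a, ha, i, j, r, hr, rfl⟩
    exact ⟨⟨⟨a, a.lt_succ_self.trans ha⟩, ⟨a + 1, ha⟩, Fin.mk_lt_mk.mpr a.lt_succ_self, i, j, ⟨r, hr⟩⟩,
      FFamily_eq ν _⟩

/-! ### All generators -/

/-- The generators `T_{i,j}^{(r)}` with `r ≥ 1`, in block form. -/
def TFamily (x : Pos ν × Pos ν × ℕ+) : Yangian n := PowerSeries.coeff x.2.2 (blockT ν x.1 x.2.1)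

theorem coeff_blockT_mem_wordSpan (r : ℕ) (i j : Pos ν) :
    PowerSeries.coeff r (blockT ν i j) ∈ wordSpan (TFamily ν) (fun x => (x.2.2 : ℕ)) (r + 1) := by
  have hP : IsFiltration fun m =>
    (wordSpan (TFamily ν) (fun x => (x.2.2 : ℕ)) m).toAddSubgroup := isFiltration_wordSpan
  rcases Nat.eq_zero_or_pos r with rfl | hr
  · exact hP.coeff_zero_mem (matCoeff_blockT_zero ν) i j
  · exact mem_wordSpan (x := TFamily ν) (w := fun x => (x.2.2 : ℕ)) (i, j, ⟨r, hr⟩)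

theorem straightens_TFamily : Straightens (TFamily ν) fun x => x.2.2 := fun x y =>
  isFiltration_wordSpan.comm_rtt_mem (rtt_blockT ν) (coeff_blockT_mem_wordSpan ν) x.1 x.2.1 y.1
    y.2.1 x.2.2 y.2.2

theorem allFamily_mem_wordSpan (x : DIndex ν ⊕ EIndex ν ⊕ FIndex ν) :
    allFamily ν x ∈ wordSpan (TFamily ν) (fun x => (x.2.2 : ℕ)) ((allLabel ν x).2.2 + 1) := by
  have hP : IsFiltration fun m =>
    (wordSpan (TFamily ν) (fun x => (x.2.2 : ℕ)) m).toAddSubgroup := isFiltration_wordSpan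
  obtain ⟨h1, h2, h3⟩ := hP.coeff_gauss_mem (isBlockGauss_gauss ν) (matCoeff_blockT_zero ν)
    (coeff_blockT_mem_wordSpan ν) (allLabel ν x).2.2 (allLabel ν x).1 (allLabel ν x).2.1
  rw [allFamily_eq]
  exact add_mem (add_mem h1 h2) h3

theorem gauss_mem_wordSpan (r : ℕ) (i j : Pos ν) :
    PowerSeries.coeff r ((gauss ν).1 i j) ∈
        wordSpan (allFamily ν) (fun x => ((allLabel ν x).2.2 : ℕ)) (r + 1) ∧
      PowerSeries.coeff r ((gauss ν).2.1 i j) ∈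
        wordSpan (allFamily ν) (fun x => ((allLabel ν x).2.2 : ℕ)) (r + 1) ∧
      PowerSeries.coeff r ((gauss ν).2.2 i j) ∈
        wordSpan (allFamily ν) (fun x => ((allLabel ν x).2.2 : ℕ)) (r + 1) := by
  have hP : IsFiltration fun m =>
    (wordSpan (allFamily ν) (fun x => ((allLabel ν x).2.2 : ℕ)) m).toAddSubgroup :=
      isFiltration_wordSpan
  have hG := isBlockGauss_gauss ν
  rcases Nat.eq_zero_or_pos r with rfl | hr
  · obtain ⟨f0, d0, e0⟩ := hG.coeff_zero (matCoeff_blockT_zero ν)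
    exact ⟨hP.coeff_zero_mem f0 i j, hP.coeff_zero_mem d0 i j, hP.coeff_zero_mem e0 i j⟩
  have mem := fun x => mem_wordSpan (x := allFamily ν) (w := fun x => ((allLabel ν x).2.2 : ℕ)) x
  obtain ⟨a, i⟩ := i
  obtain ⟨b, j⟩ := j
  have hD : a ≠ b → PowerSeries.coeff r ((gauss ν).2.1 ⟨a, i⟩ ⟨b, j⟩) = 0 := fun h => by
    rw [hG.diag _ _ h, map_zero]
  rcases lt_trichotomy a b with h | h | h
  · refine ⟨?_, ?_, ?_⟩
    · rw [hG.coeff_lower_eq_zero hr h.le]; exact zero_mem _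
    · rw [hD h.ne]; exact zero_mem _
    · have := mem (.inr (.inl ⟨a, b, h, i, j, ⟨r, hr⟩⟩))
      change EFamily ν _ ∈ _ at this
      rw [EFamily_eq] at this
      exact this
  · subst h
    refine ⟨?_, mem (.inl ⟨a, i, j, ⟨r, hr⟩⟩), ?_⟩
    · rw [hG.coeff_lower_eq_zero hr (i := ⟨a, i⟩) (j := ⟨a, j⟩) le_rfl]; exact zero_mem _
    · rw [hG.coeff_upper_eq_zero hr (i := ⟨a, i⟩) (j := ⟨a, j⟩) le_rfl]; exact zero_mem _
  · refine ⟨?_, ?_, ?_⟩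
    · have := mem (.inr (.inr ⟨b, a, h, i, j, ⟨r, hr⟩⟩))
      change FFamily ν _ ∈ _ at this
      rw [FFamily_eq] at this
      exact this
    · rw [hD h.ne']; exact zero_mem _
    · rw [hG.coeff_upper_eq_zero hr h.le]; exact zero_mem _

theorem TFamily_mem_wordSpan (x : Pos ν × Pos ν × ℕ+) :
    TFamily ν x ∈ wordSpan (allFamily ν) (fun x => ((allLabel ν x).2.2 : ℕ)) (x.2.2 + 1) := by
  have hP : IsFiltration fun m =>
    (wordSpan (allFamily ν) (fun x => ((allLabel ν x).2.2 : ℕ)) m).toAddSubgroup :=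
      isFiltration_wordSpan
  have e : blockT ν x.1 x.2.1 = ∑ l, ((gauss ν).1 * (gauss ν).2.1) x.1 l * (gauss ν).2.2 l x.2.1 :=
    (congrFun (congrFun (isBlockGauss_gauss ν).factor _) _).trans (Matrix.mul_apply ..)
  rw [TFamily, e]
  refine hP.coeff_sum_mem _ _ (fun l r => ?_) (fun l r => (gauss_mem_wordSpan ν r _ _).2.2) _
  rw [Matrix.mul_apply]
  exact hP.coeff_sum_mem _ _ (fun k r => (gauss_mem_wordSpan ν r _ _).1)
    (fun k r => (gauss_mem_wordSpan ν r _ _).2.1) _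

/-- A commutator of block generators is computed in words of the `T`'s, where weight drops, and
rewritten in block generators without raising the weight. -/
theorem straightens_allFamily : Straightens (allFamily ν) fun x => (allLabel ν x).2.2 := by
  intro x y
  exact wordSpan_le (TFamily_mem_wordSpan ν) _
    ((straightens_TFamily ν).comm_mem (allFamily_mem_wordSpan ν x) (allFamily_mem_wordSpan ν y))

theorem adjoin_range_allFamily : Algebra.adjoin ℂ (Set.range (allFamily ν)) = ⊤ := by
  classical
  have hle : ∀ m, wordSpan (allFamily ν) (fun x => ((allLabel ν x).2.2 : ℕ)) m ≤
      Subalgebra.toSubmodule (Algebra.adjoin ℂ (Set.range (allFamily ν))) := by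
    intro m
    refine Submodule.span_le.mpr ?_
    rintro _ ⟨l, -, rfl⟩
    refine list_prod_mem (S := Algebra.adjoin ℂ (Set.range (allFamily ν))) fun y hy => ?_
    obtain ⟨i, -, rfl⟩ := List.mem_map.mp hy
    exact Algebra.subset_adjoin ⟨i, rfl⟩
  rw [eq_top_iff]
  have hs : Function.Surjective (proj n) := RingQuot.mkAlgHom_surjective ℂ (Rel n)
  rw [← (AlgHom.range_eq_top (proj n)).mpr hs, ← Algebra.map_top, ← FreeAlgebra.adjoin_range_ι,
    AlgHom.map_adjoin]
  refine Algebra.adjoin_le ?_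
  rintro _ ⟨_, ⟨⟨i, j, r⟩, rfl⟩, rfl⟩
  obtain ⟨x, hx⟩ := ν.blocksFinEquiv.surjective i
  obtain ⟨y, hy⟩ := ν.blocksFinEquiv.surjective j
  have key := hle _ (TFamily_mem_wordSpan ν (x, y, r))
  rw [TFamily, coeff_blockT, T, freeT, dif_pos r.pos] at key
  rw [← hx, ← hy]
  exact key

theorem isPBWBasis_DFamily (lo : LinearOrder (DIndex ν)) :
    IsPBWBasis lo (DFamily ν) (levi ν) :=
  ⟨linearIndependent_allFamily_comp ν lo Sum.inl Sum.inl_injective, by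
    rw [(straightens_DFamily ν).span_orderedMonomial, adjoin_range_DFamily]⟩

theorem isPBWBasis_EFamily (lo : LinearOrder (EIndex ν)) :
    IsPBWBasis lo (EFamily ν) (plus ν) :=
  ⟨linearIndependent_allFamily_comp ν lo (Sum.inr ∘ Sum.inl)
    (Sum.inr_injective.comp Sum.inl_injective), by
    rw [(straightens_EFamily ν).span_orderedMonomial, adjoin_range_EFamily]⟩

theorem isPBWBasis_FFamily (lo : LinearOrder (FIndex ν)) :
    IsPBWBasis lo (FFamily ν) (minus ν) :=
  ⟨linearIndependent_allFamily_comp ν lo (Sum.inr ∘ Sum.inr)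
    (Sum.inr_injective.comp Sum.inr_injective), by
    rw [(straightens_FFamily ν).span_orderedMonomial, adjoin_range_FFamily]⟩

theorem isPBWBasis_allFamily (lo : LinearOrder (DIndex ν ⊕ EIndex ν ⊕ FIndex ν)) :
    IsPBWBasis lo (allFamily ν) ⊤ :=
  ⟨linearIndependent_allFamily_comp ν lo id Function.injective_id, by
    rw [(straightens_allFamily ν).span_orderedMonomial, adjoin_range_allFamily]⟩

end Spanning

end Yang
end

noncomputable section

namespace Yang

/-! ### Triangular decomposition. -/

section Triangular

variable {I J A : Type*}

theorem orderedMonomial_add [Monoid A] (lo : LinearOrder I) (x : I → A) {s t : Multiset I}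
    (h : ∀ i ∈ s, ∀ j ∈ t, i ≤ j) :
    orderedMonomial lo x (s + t) = orderedMonomial lo x s * orderedMonomial lo x t := by
  have e : (s + t).sort (fun i j => i ≤ j) =
      s.sort (fun i j => i ≤ j) ++ t.sort (fun i j => i ≤ j) := by
    refine List.Perm.eq_of_pairwise' (r := fun i j => i ≤ j) (Multiset.pairwise_sort _ _) ?_ ?_
    · refine List.pairwise_append.mpr ⟨Multiset.pairwise_sort _ _, Multiset.pairwise_sort _ _,
        fun i hi j hj => h i ((Multiset.mem_sort _).mp hi) j ((Multiset.mem_sort _).mp hj)⟩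
    · rw [← Multiset.coe_eq_coe, Multiset.sort_eq, ← Multiset.coe_add, Multiset.sort_eq,
        Multiset.sort_eq]
  rw [orderedMonomial, e, List.map_append, List.prod_append]
  rfl

theorem orderedMonomial_map [Monoid A] (lo : LinearOrder I) (x : I → A) {f : J → I}
    (hf : Function.Injective f) (s : Multiset J) :
    orderedMonomial lo x (s.map f) = orderedMonomial (LinearOrder.lift' f hf) (x ∘ f) s := by
  let _ := LinearOrder.lift' f hf
  have e : (s.sort fun i j : J => i ≤ j).map f = (s.map f).sort fun i j : I => i ≤ j :=
    Multiset.map_sort f s _ _ fun _ _ _ _ => Iff.rfl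
  rw [orderedMonomial, ← e, List.map_map]
  rfl

/-- A linear order for which a given function to the natural numbers is monotone. -/
theorem exists_linearOrder_lt_of_lt (g : I → ℕ) :
    ∃ lo : LinearOrder I, ∀ i j, g i < g j → lo.le i j := by
  let _ : LinearOrder I := IsWellOrder.linearOrder WellOrderingRel
  exact ⟨LinearOrder.lift' (fun i => toLex (g i, i)) fun i j h => congrArg Prod.snd h,
    fun i j h => Prod.Lex.le_iff.mpr (Or.inl h)⟩

variable [Ring A] [Algebra ℂ A]

theorem IsPBWBasis.exists_basis {lo : LinearOrder I} {x : I → A} {S : Subalgebra ℂ A}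
    (h : IsPBWBasis lo x S) :
    ∃ b : Module.Basis (Multiset I) ℂ S, ∀ s, (b s : A) = orderedMonomial lo x s := by
  refine ⟨(Module.Basis.span h.1).map
    ((LinearEquiv.ofEq _ _ h.2).trans S.toSubmoduleEquiv), fun s => ?_⟩
  rw [Module.Basis.map_apply]
  exact congrArg Subtype.val (Module.Basis.span_apply h.1 s)

theorem mulMap3_tmul (P Q S : Subalgebra ℂ A) (x : P) (y : Q) (z : S) :
    mulMap3 P Q S ((x ⊗ₜ y) ⊗ₜ z) = (x : A) * y * z := rfl

theorem filterMap_none (s : Multiset I) : s.filterMap (fun _ => (none : Option J)) = 0 := by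
  induction s using Multiset.induction with
  | empty => rfl
  | cons a s ih => rw [Multiset.filterMap_cons_none _ _ rfl, ih]

variable {ID IE IF : Type*}

/-- A multiset on a disjoint union splits uniquely into its three parts, each recovered by
`filterMap`. -/
theorem bijective_multiset_sum : Function.Bijective
    fun z : (Multiset IF × Multiset ID) × Multiset IE =>
      z.1.1.map (Sum.inr ∘ Sum.inr) + z.1.2.map Sum.inl + z.2.map (Sum.inr ∘ Sum.inl) := by
  constructor
  · rintro ⟨⟨s, t⟩, u⟩ ⟨⟨s', t'⟩, u'⟩ h
    have hF := congrArg (Multiset.filterMap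
      (Sum.elim (fun _ : ID => none) (Sum.elim (fun _ : IE => none) (fun a : IF => some a)))) h
    have hD := congrArg (Multiset.filterMap
      (Sum.elim (fun a : ID => some a) (Sum.elim (fun _ : IE => none) (fun _ : IF => none)))) h
    have hE := congrArg (Multiset.filterMap
      (Sum.elim (fun _ : ID => none) (Sum.elim (fun a : IE => some a) (fun _ : IF => none)))) h
    simp only [Multiset.filterMap_add, Multiset.filterMap_map, Function.comp_def, Sum.elim_inl,
      Sum.elim_inr, filterMap_none, Multiset.filterMap_some, zero_add, add_zero] at hF hD hE
    rw [hF, hD, hE]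
  · intro s
    induction s using Multiset.induction with
    | empty => exact ⟨((0, 0), 0), by simp⟩
    | cons a s ih =>
      obtain ⟨⟨⟨u, t⟩, v⟩, rfl⟩ := ih
      rcases a with a | a | a
      · exact ⟨((u, a ::ₘ t), v), by simp⟩
      · exact ⟨((u, t), a ::ₘ v), by simp⟩
      · exact ⟨((a ::ₘ u, t), v), by simp⟩

/-- For an order in which the three families follow each other, an ordered monomial factors into one
monomial from each. Multiplication then carries a tensor product basis to a basis. -/
theorem mulMap3_bijective {x : ID ⊕ IE ⊕ IF → A} {P Q S : Subalgebra ℂ A}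
    (hF : ∀ lo : LinearOrder IF, IsPBWBasis lo (x ∘ Sum.inr ∘ Sum.inr) P)
    (hD : ∀ lo : LinearOrder ID, IsPBWBasis lo (x ∘ Sum.inl) Q)
    (hE : ∀ lo : LinearOrder IE, IsPBWBasis lo (x ∘ Sum.inr ∘ Sum.inl) S)
    (hA : ∀ lo : LinearOrder (ID ⊕ IE ⊕ IF), IsPBWBasis lo x ⊤) :
    Function.Bijective (mulMap3 P Q S) := by
  -- The ranks `0`, `1`, `2` for `F`, `D`, `E` follow the order of the tensor factors; the orders on
  -- the single families are those induced by `lo`.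
  obtain ⟨lo, hlo⟩ := exists_linearOrder_lt_of_lt
    (Sum.elim (fun _ => 1) (Sum.elim (fun _ => 2) fun _ => 0) : ID ⊕ IE ⊕ IF → ℕ)
  have iF : Function.Injective (Sum.inr ∘ Sum.inr : IF → ID ⊕ IE ⊕ IF) :=
    Sum.inr_injective.comp Sum.inr_injective
  have iD : Function.Injective (Sum.inl : ID → ID ⊕ IE ⊕ IF) := Sum.inl_injective
  have iE : Function.Injective (Sum.inr ∘ Sum.inl : IE → ID ⊕ IE ⊕ IF) :=
    Sum.inr_injective.comp Sum.inl_injective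
  obtain ⟨bF, hbF⟩ := (hF (LinearOrder.lift' _ iF)).exists_basis
  obtain ⟨bD, hbD⟩ := (hD (LinearOrder.lift' _ iD)).exists_basis
  obtain ⟨bE, hbE⟩ := (hE (LinearOrder.lift' _ iE)).exists_basis
  let bA : Module.Basis (Multiset (ID ⊕ IE ⊕ IF)) ℂ A := Module.Basis.mk (hA lo).1 (hA lo).2.ge
  let φ := ((bF.tensorProduct bD).tensorProduct bE).equiv bA
    (Equiv.ofBijective _ bijective_multiset_sum)
  have e : mulMap3 P Q S = φ.toLinearMap := by
    refine ((bF.tensorProduct bD).tensorProduct bE).ext fun z => ?_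
    obtain ⟨⟨s, t⟩, u⟩ := z
    rw [Module.Basis.tensorProduct_apply, Module.Basis.tensorProduct_apply, mulMap3_tmul, hbF, hbD,
      hbE]
    have h1 : φ (((bF.tensorProduct bD) (s, t)) ⊗ₜ bE u) =
        orderedMonomial lo x
          (s.map (Sum.inr ∘ Sum.inr) + t.map Sum.inl + u.map (Sum.inr ∘ Sum.inl)) := by
      rw [← Module.Basis.tensorProduct_apply, Module.Basis.equiv_apply]
      exact Module.Basis.mk_apply _ _ _
    rw [Module.Basis.tensorProduct_apply] at h1
    refine Eq.trans ?_ h1.symm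
    rw [orderedMonomial_add, orderedMonomial_add, orderedMonomial_map lo x iF,
      orderedMonomial_map lo x iD, orderedMonomial_map lo x iE]
    · intro i hi j hj
      obtain ⟨i, -, rfl⟩ := Multiset.mem_map.mp hi
      obtain ⟨j, -, rfl⟩ := Multiset.mem_map.mp hj
      exact hlo _ _ (by simp)
    · intro i hi j hj
      obtain ⟨j, -, rfl⟩ := Multiset.mem_map.mp hj
      rcases Multiset.mem_add.mp hi with hi | hi <;>
        obtain ⟨i, -, rfl⟩ := Multiset.mem_map.mp hi <;> exact hlo _ _ (by simp)
  rw [e]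
  exact φ.bijective

end Triangular

end Yang
end

theorem theoremB (n : ℕ) (ν : Composition n) :
    -- the iterated commutators do not depend on the choice of `k`
    (∀ (a b : ℕ) (hab : a < b) (hb : b + 1 < ν.length)
      (i : Fin (ν.blocksFun ⟨a, hab.trans (b.lt_succ_self.trans hb)⟩))
      (k : Fin (ν.blocksFun ⟨b, b.lt_succ_self.trans hb⟩))
      (j : Fin (ν.blocksFun ⟨b + 1, hb⟩)) (r : ℕ), 1 ≤ r →
      Yang.EE ν a (hab.trans (b.lt_succ_self.trans hb)) i r (b + 1) hb j =
        ⁅Yang.EE ν a (hab.trans (b.lt_succ_self.trans hb)) i r b (b.lt_succ_self.trans hb) k,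
          Yang.E ν b hb k j 1⁆ ∧
      Yang.FF ν a (hab.trans (b.lt_succ_self.trans hb)) i r (b + 1) hb j =
        ⁅Yang.F ν b hb j k 1,
          Yang.FF ν a (hab.trans (b.lt_succ_self.trans hb)) i r b (b.lt_succ_self.trans hb) k⁆) ∧
    (∀ lo : LinearOrder (Yang.DIndex ν),
      Yang.IsPBWBasis lo (Yang.DFamily ν) (Yang.levi ν)) ∧
    (∀ lo : LinearOrder (Yang.EIndex ν),
      Yang.IsPBWBasis lo (Yang.EFamily ν) (Yang.plus ν)) ∧
    (∀ lo : LinearOrder (Yang.FIndex ν),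
      Yang.IsPBWBasis lo (Yang.FFamily ν) (Yang.minus ν)) ∧
    (∀ lo : LinearOrder (Yang.DIndex ν ⊕ Yang.EIndex ν ⊕ Yang.FIndex ν),
      Yang.IsPBWBasis lo (Yang.allFamily ν) ⊤) ∧
    Function.Bijective (Yang.mulMap3 (Yang.minus ν) (Yang.levi ν) (Yang.plus ν)) :=
  ⟨fun a b hab hb i k j r _ => ⟨Yang.EE_succ ν a b hab hb i k j r, Yang.FF_succ ν a b hab hb i k j r⟩,
    Yang.isPBWBasis_DFamily ν, Yang.isPBWBasis_EFamily ν, Yang.isPBWBasis_FFamily ν,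
    Yang.isPBWBasis_allFamily ν,
    Yang.mulMap3_bijective (x := Yang.allFamily ν) (Yang.isPBWBasis_FFamily ν)
      (Yang.isPBWBasis_DFamily ν) (Yang.isPBWBasis_EFamily ν) (Yang.isPBWBasis_allFamily ν)⟩
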